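/- Let $K$ be a field of characteristic zero (for example $\mathbb C$). All spaces are $\mathbb Z/2$-graded (super) $K$-vector spaces, and $\Pi$ denotes parity reversion. An inner product on a finite-dimensional space $V=V_0\oplus V_1$ is an even, supersymmetric, nondegenerate bilinear form; an inner product space is a finite-dimensional space with an inner product, and $V\oplus W$ carries the orthogonal sum of the two inner products. Let $\mathcal A(V)$ be either the completed symmetric algebra $\hat S\Pi V^*$ or the completed tensor algebra $\hat T\Pi V^*$. Restriction to generators and the inner product identify the continuous derivations of $\mathcal A(V)$ with $\operatorname{Hom}(\Pi V^*,\mathcal A(V))\cong \Pi V^*\otimes\mathcal A(V)$. Let $\operatorname{CDer}(\mathcal A(V))$ be the formal (linearly compact) Lie superalgebra, under the supercommutator, of the derivations whose tensor is invariant under signed cyclic permutations (in the case of $\hat S$, symmetric powers being regarded as symmetric tensors), and let $\operatorname{CDer}^0(\mathcal A(V))$ be the subalgebra of those which preserve the augmentation ideal, i.e. have no constant term. For a formal Lie superalgebra $\mathfrak g$, let $\operatorname{CE}^i(\mathfrak g)=S^i(\Pi\mathfrak g^*)$ be the space of continuous supersymmetric $i$-linear forms on $\Pi\mathfrak g$,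 with the Chevalley–Eilenberg differential $\operatorname{CE}^i\to\operatorname{CE}^{i+1}$ induced by the bracket, and let $\operatorname{CE}_\bullet(\mathfrak g)=(\operatorname{CE}^\bullet(\mathfrak g))^*$ be the dual complex, so that $\operatorname{CE}_i(\mathfrak g)=\hat S^i(\Pi\mathfrak g)$, with boundary $\operatorname{CE}_{i+1}\to\operatorname{CE}_i$. For inner product spaces $V$ and $W$ let $$\varphi_{V,W}\colon \operatorname{CE}_i(\operatorname{CDer}(\mathcal A(V)))\to\operatorname{CE}_i(\operatorname{CDer}(\mathcal A(V\oplus W)))$$ be the map induced by extending a cyclic derivation of $\mathcal A(V)$ to the cyclic derivation of $\mathcal A(V\oplus W)$ that agrees with it on $\Pi V^*$ and vanishes on $\Pi W^*$. **Theorem.** Let $V$ and $W$ be inner product spaces with $W_0\neq 0$. Then for every $i\ge 1$ the compositions $$\operatorname{CE}_i(\operatorname{CDer}^0(\hat S\Pi V^*))\to\operatorname{CE}_i(\operatorname{CDer}(\hat S\Pi V^*))\xrightarrow{\varphi_{V,W}}\operatorname{CE}_i(\operatorname{CDer}(\hat S\Pi(V\oplus W)^*)),$$ $$\operatorname{CE}_i(\operatorname{CDer}^0(\hat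 T\Pi V^*))\to\operatorname{CE}_i(\operatorname{CDer}(\hat T\Pi V^*))\xrightarrow{\varphi_{V,W}}\operatorname{CE}_i(\operatorname{CDer}(\hat T\Pi(V\oplus W)^*))$$ are zero on homology, i.e. they send every cycle to a boundary. -/

import Mathlib

/-!
All spaces are `ZMod 2`-graded; a superspace is a family `V : ZMod 2 → Type*` of vector spaces.
-/

set_option linter.unusedSectionVars false

namespace CurvedStab

section Words

/-- The sign `(-1)^p`. -/
def sgn (K : Type*) [Field K] (p : ZMod 2) : K := if p = 0 then 1 else -1

theorem sgn_zero (K : Type*) [Field K] : sgn K 0 = 1 := by simp [sgn]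

theorem zmod2_cases (p : ZMod 2) : p = 0 ∨ p = 1 := by
  revert p; decide

theorem sgn_add (K : Type*) [Field K] (p q : ZMod 2) : sgn K (p + q) = sgn K p * sgn K q := by
  have h2 : (1 + 1 : ZMod 2) = 0 := by decide
  rcases zmod2_cases p with rfl | rfl <;> rcases zmod2_cases q with rfl | rfl <;> simp [sgn, h2]

theorem sgn_sq (K : Type*) [Field K] (p : ZMod 2) : sgn K p * sgn K p = 1 := by
  rcases zmod2_cases p with rfl | rfl <;> simp [sgn]

/-- A homogeneous vector of `V`, tagged with its parity. -/
abbrev Letter (V : ZMod 2 → Type*) := Σ p : ZMod 2, V p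

/-- Functions on words of homogeneous vectors. An element of the completed tensor algebra of the
dual of `ΠV` is the same as a sequence of multilinear forms on `ΠV`, and is recorded by its values
on words. -/
abbrev Fn (K : Type*) (V : ZMod 2 → Type*) := List (Letter V) → K

/-- The two cases: `ass` for the completed tensor algebra `T̂ΠV*`, `com` for the completed
symmetric algebra `ŜΠV*`. -/
inductive Flavour
  | ass
  | com

variable {K : Type*} [Field K] {V : ZMod 2 → Type*}

/-- The parity of the vector `Πu` in `ΠV`. -/
def par (u : Letter V) : ZMod 2 := u.1 + 1

/-- The parity of a word in `ΠV`. -/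
def wpar : List (Letter V) → ZMod 2
  | [] => 0
  | u :: w => par u + wpar w

/-- The sum of `F a b` over all ways to write the word as a concatenation `a ++ b`. -/
def catSum : (List (Letter V) → List (Letter V) → K) → Fn K V
  | F, [] => F [] []
  | F, u :: w => F [] (u :: w) + catSum (fun a b => F (u :: a) b) w

/-- The sum of `± F a b` over all ways to split the word into two complementary subwords `a`, `b`,
with the Koszul sign of the corresponding permutation of vectors of `ΠV`. -/
def shSum : (List (Letter V) → List (Letter V) → K) → Fn K V
  | F, [] => F [] []
  | F, u :: w => shSum (fun a b => F (u :: a) b + sgn K (par u * wpar a) * F a (u :: b)) w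

/-- Sum over deconcatenations (tensor case) or over unshuffles (symmetric case). -/
def conv (c : Flavour) (F : List (Letter V) → List (Letter V) → K) : Fn K V :=
  match c with
  | .ass => catSum F
  | .com => shSum F

theorem wpar_append (a b : List (Letter V)) : wpar (a ++ b) = wpar a + wpar b := by
  induction a with
  | nil => simp [wpar]
  | cons u a ih => simp [wpar, ih, add_assoc]

theorem catSum_lin (a : K) (F G : List (Letter V) → List (Letter V) → K) (w : List (Letter V)) :
    catSum (fun x y => a * F x y + G x y) w = a * catSum F w + catSum G w := by
  induction w generalizing F G with
  | nil => simp [catSum]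
  | cons u w ih => simp only [catSum, ih]; ring

theorem shSum_lin (a : K) (F G : List (Letter V) → List (Letter V) → K) (w : List (Letter V)) :
    shSum (fun x y => a * F x y + G x y) w = a * shSum F w + shSum G w := by
  induction w generalizing F G with
  | nil => simp [shSum]
  | cons u w ih =>
    simp only [shSum, ← ih]
    congr 1; funext x y; ring

theorem conv_lin (c : Flavour) (a : K) (F G : List (Letter V) → List (Letter V) → K)
    (w : List (Letter V)) :
    conv c (fun x y => a * F x y + G x y) w = a * conv c F w + conv c G w := by
  cases c
  · exact catSum_lin a F G w
  · exact shSum_lin a F G w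

theorem conv_zero (c : Flavour) (w : List (Letter V)) :
    conv c (fun _ _ => (0 : K)) w = 0 := by
  have := conv_lin c (-1 : K) (fun _ _ => 0) (fun _ _ => 0) w
  simpa using this

theorem conv_add (c : Flavour) (F G : List (Letter V) → List (Letter V) → K)
    (w : List (Letter V)) :
    conv c (fun x y => F x y + G x y) w = conv c F w + conv c G w := by
  simpa using conv_lin c 1 F G w

theorem conv_smul (c : Flavour) (a : K) (F : List (Letter V) → List (Letter V) → K)
    (w : List (Letter V)) :
    conv c (fun x y => a * F x y) w = a * conv c F w := by
  simpa [conv_zero] using conv_lin c a F (fun _ _ => 0) w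

theorem conv_sum (c : Flavour) {ι : Type*} (s : Finset ι)
    (F : ι → List (Letter V) → List (Letter V) → K) (w : List (Letter V)) :
    conv c (fun x y => ∑ i ∈ s, F i x y) w = ∑ i ∈ s, conv c (F i) w := by
  classical
  induction s using Finset.induction_on with
  | empty => simp [conv_zero]
  | insert i s hi ih => simp only [Finset.sum_insert hi, conv_add, ih]

theorem conv_nil (c : Flavour) (F : List (Letter V) → List (Letter V) → K) :
    conv c F [] = F [] [] := by cases c <;> rfl

/-- If `F a b` vanishes unless `|a| + |b| = ε`, so does `conv c F`. -/
theorem conv_parity (c : Flavour) (ε : ZMod 2) (F : List (Letter V) → List (Letter V) → K)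
    (hF : ∀ a b, wpar a + wpar b ≠ ε → F a b = 0) (w : List (Letter V)) (hw : wpar w ≠ ε) :
    conv c F w = 0 := by
  cases c
  · show catSum F w = 0
    induction w generalizing F ε with
    | nil => exact hF [] [] (by simpa [wpar] using hw)
    | cons u w ih =>
      simp only [catSum]
      rw [hF [] (u :: w) (by simpa [wpar] using hw), zero_add]
      refine ih (ε - par u) _ (fun a b h => hF _ _ fun h' => h ?_) (fun h' => hw ?_)
      · simp only [wpar] at h'; rw [← h']; ring
      · simp only [wpar]; rw [h']; ring
  · show shSum F w = 0
    induction w generalizing F ε with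
    | nil => exact hF [] [] (by simpa [wpar] using hw)
    | cons u w ih =>
      simp only [shSum]
      refine ih (ε - par u) _ (fun a b h => ?_) (fun h' => hw ?_)
      · rw [hF (u :: a) b, hF a (u :: b)]
        · simp
        · intro h'; apply h; simp only [wpar] at h'; rw [← h']; ring
        · intro h'; apply h; simp only [wpar] at h'; rw [← h']; ring
      · simp only [wpar]; rw [h']; ring

/-- If `F a b` vanishes when `a` and `b` have less than `n` letters altogether, then `conv c F`
vanishes on words of length less than `n`. -/
theorem conv_length (c : Flavour) (n : ℕ) (F : List (Letter V) → List (Letter V) → K)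
    (hF : ∀ a b, a.length + b.length < n → F a b = 0) (w : List (Letter V)) (hw : w.length < n) :
    conv c F w = 0 := by
  cases c
  · show catSum F w = 0
    induction w generalizing F n with
    | nil => exact hF [] [] (by simpa using hw)
    | cons u w ih =>
      simp only [List.length_cons] at hw
      simp only [catSum]
      rw [hF [] (u :: w) (by simpa using hw), zero_add]
      refine ih (n - 1) _ (fun a b h => hF _ _ ?_) (by omega)
      simp only [List.length_cons]; omega
  · show shSum F w = 0
    induction w generalizing F n with
    | nil => exact hF [] [] (by simpa using hw)
    | cons u w ih =>
      simp only [List.length_cons] at hw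
      simp only [shSum]
      refine ih (n - 1) _ (fun a b h => ?_) (by omega)
      rw [hF (u :: a) b (by simp only [List.length_cons]; omega),
        hF a (u :: b) (by simp only [List.length_cons]; omega)]
      simp

/-! shuffle identities -/

theorem shSum_sgn (t : ZMod 2) (F : List (Letter V) → List (Letter V) → K) (w : List (Letter V)) :
    shSum (fun a b => sgn K (t * wpar a) * sgn K (t * wpar b) * F a b) w
      = sgn K (t * wpar w) * shSum F w := by
  induction w generalizing F with
  | nil => simp [shSum, wpar, sgn_zero]
  | cons u w ih =>
    have e : (fun (a b : List (Letter V)) =>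
        sgn K (t * wpar (u :: a)) * sgn K (t * wpar b) * F (u :: a) b
        + sgn K (par u * wpar a) * (sgn K (t * wpar a) * sgn K (t * wpar (u :: b)) * F a (u :: b)))
        = fun a b => sgn K (t * par u) * (sgn K (t * wpar a) * sgn K (t * wpar b) *
            (F (u :: a) b + sgn K (par u * wpar a) * F a (u :: b))) + 0 := by
      funext a b; simp only [wpar, mul_add, sgn_add]; ring
    simp only [shSum]
    rw [e, shSum_lin, ih]
    have z : shSum (fun _ _ => (0 : K)) w = 0 := conv_zero .com w
    rw [z]
    simp only [wpar, mul_add, sgn_add]; ring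

theorem shSum_comm (F : List (Letter V) → List (Letter V) → K) (w : List (Letter V)) :
    shSum (fun a b => sgn K (wpar a * wpar b) * F b a) w = shSum F w := by
  induction w generalizing F with
  | nil => simp [shSum, wpar, sgn_zero]
  | cons u w ih =>
    simp only [shSum]
    rw [← ih]
    congr 1; funext a b
    simp only [wpar, mul_add, add_mul, sgn_add]
    have h1 := sgn_sq K (par u * wpar b)
    have h2 := sgn_sq K (wpar a * wpar b)
    rw [mul_comm (wpar b) (par u), mul_comm (wpar b) (wpar a)]
    linear_combination (sgn K (par u * wpar a) * F a (u :: b)) * h2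
      + (F (u :: a) b) * h2 + (F (u :: a) b * sgn K (wpar a * wpar b) ^ 2) * h1

theorem shSum_assoc (H : List (Letter V) → List (Letter V) → List (Letter V) → K)
    (w : List (Letter V)) :
    shSum (fun a b => shSum (fun a₁ a₂ => H a₁ a₂ b) a) w
      = shSum (fun a b => shSum (fun b₁ b₂ => H a b₁ b₂) b) w := by
  induction w generalizing H with
  | nil => simp [shSum]
  | cons u w ih =>
    have key := ih (fun a b c => H (u :: a) b c + sgn K (par u * wpar a) * H a (u :: b) c
      + sgn K (par u * wpar a) * sgn K (par u * wpar b) * H a b (u :: c))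
    have add : ∀ (F G : List (Letter V) → List (Letter V) → K) (w : List (Letter V)),
      shSum (fun x y => F x y + G x y) w = shSum F w + shSum G w := conv_add .com
    have smul : ∀ (a : K) (F : List (Letter V) → List (Letter V) → K) (w : List (Letter V)),
      shSum (fun x y => a * F x y) w = a * shSum F w := conv_smul .com
    simp only [shSum]
    convert key using 2
    · funext a b
      rw [← shSum_sgn (par u) (fun a₁ a₂ => H a₁ a₂ (u :: b)), ← add]
    · funext a b
      rw [← smul, ← add]
      congr 1; funext b₁ b₂; ring

theorem catSum_assoc (H : List (Letter V) → List (Letter V) → List (Letter V) → K)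
    (w : List (Letter V)) :
    catSum (fun a b => catSum (fun a₁ a₂ => H a₁ a₂ b) a) w
      = catSum (fun a b => catSum (fun b₁ b₂ => H a b₁ b₂) b) w := by
  induction w generalizing H with
  | nil => simp [catSum]
  | cons u w ih =>
    have add : ∀ (F G : List (Letter V) → List (Letter V) → K) (w : List (Letter V)),
      catSum (fun x y => F x y + G x y) w = catSum F w + catSum G w := conv_add .ass
    simp only [catSum]
    rw [add, ih]
    ring

theorem wpar_swap (l r : List (Letter V)) (u v : Letter V) :
    wpar (l ++ u :: v :: r) = wpar (l ++ v :: u :: r) := by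
  simp only [wpar_append, wpar]; ring

theorem wpar_slot (l r : List (Letter V)) (p : ZMod 2) (x y : V p) :
    wpar (l ++ (⟨p, x⟩ : Letter V) :: r) = wpar (l ++ (⟨p, y⟩ : Letter V) :: r) := by
  simp only [wpar_append, wpar, par]

theorem conv_assoc (c : Flavour) (H : List (Letter V) → List (Letter V) → List (Letter V) → K)
    (w : List (Letter V)) :
    conv c (fun a b => conv c (fun a₁ a₂ => H a₁ a₂ b) a) w
      = conv c (fun a b => conv c (fun b₁ b₂ => H a b₁ b₂) b) w := by
  cases c
  · exact catSum_assoc H w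
  · exact shSum_assoc H w

/-! slot linearity and symmetry -/

variable [∀ p, AddCommGroup (V p)] [∀ p, Module K (V p)]

/-- Multilinearity in the letters of the word. -/
def SlotLinear (f : Fn K V) : Prop :=
  ∀ (l r : List (Letter V)) (p : ZMod 2) (a : K) (x y : V p),
    f (l ++ ⟨p, a • x + y⟩ :: r) = a * f (l ++ ⟨p, x⟩ :: r) + f (l ++ ⟨p, y⟩ :: r)

/-- Invariance under permutations of the letters, with Koszul signs in `ΠV`. -/
def SuperSymm (f : Fn K V) : Prop :=
  ∀ (l r : List (Letter V)) (u v : Letter V),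
    f (l ++ u :: v :: r) = sgn K (par u * par v) * f (l ++ v :: u :: r)

variable (K V) in
/-- The multilinear forms on `ΠV`, one of each degree; supersymmetric ones in the symmetric case. -/
def algSub (c : Flavour) : Submodule K (Fn K V) where
  carrier := {f | SlotLinear f ∧ (c = .com → SuperSymm f)}
  add_mem' := by
    rintro f g ⟨hf, hf'⟩ ⟨hg, hg'⟩
    refine ⟨fun l r p a x y => ?_, fun h l r u v => ?_⟩
    · simp only [Pi.add_apply, hf l r p a x y, hg l r p a x y]; ring
    · simp only [Pi.add_apply, hf' h l r u v, hg' h l r u v]; ring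
  zero_mem' := ⟨fun l r p a x y => by simp, fun _ l r u v => by simp⟩
  smul_mem' := by
    rintro s f ⟨hf, hf'⟩
    refine ⟨fun l r p a x y => ?_, fun h l r u v => ?_⟩
    · simp only [Pi.smul_apply, smul_eq_mul, hf l r p a x y]; ring
    · simp only [Pi.smul_apply, smul_eq_mul, hf' h l r u v]; ring

variable (K V) in
/-- `T̂ΠV*` for `c = .ass`: sequences of multilinear forms on `ΠV`, multiplied by concatenation.
`ŜΠV*` for `c = .com`: sequences of supersymmetric multilinear forms on `ΠV`, with the product dual
to the unshuffle coproduct of the symmetric coalgebra on `ΠV`; in characteristic zero this is the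
completed symmetric algebra on `ΠV*`. -/
abbrev Alg (c : Flavour) : Type _ := ↥(algSub K V c)

theorem shift_mem {c : Flavour} {f : Fn K V} (hf : f ∈ algSub K V c) (u : Letter V) :
    (fun w => f (u :: w)) ∈ algSub K V c :=
  ⟨fun l r => hf.1 (u :: l) r, fun h l r => hf.2 h (u :: l) r⟩

theorem shift_lin {c : Flavour} {f : Fn K V} (hf : f ∈ algSub K V c) (p : ZMod 2) (a : K) (x y : V p)
    (w : List (Letter V)) :
    f (⟨p, a • x + y⟩ :: w) = a * f (⟨p, x⟩ :: w) + f (⟨p, y⟩ :: w) := hf.1 [] w p a x y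

theorem slot_smul {f : Fn K V} (hf : SlotLinear f) (l r : List (Letter V)) (p : ZMod 2)
    (a : K) (x : V p) : f (l ++ ⟨p, a • x⟩ :: r) = a * f (l ++ ⟨p, x⟩ :: r) := by
  have h0 := hf l r p 1 0 0
  simp only [one_smul, add_zero, one_mul] at h0
  have h := hf l r p a x 0
  rw [add_zero] at h
  rw [h]
  have : f (l ++ ⟨p, 0⟩ :: r) = 0 := by
    have := h0; exact left_eq_add.mp this
  rw [this, add_zero]

/-- Multiplying by a sign that depends on the parity of the word preserves membership. -/
theorem sgn_mul_mem {c : Flavour} {f : Fn K V} (hf : f ∈ algSub K V c) (t : ZMod 2) :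
    (fun w => sgn K (t * wpar w) * f w) ∈ algSub K V c := by
  refine ⟨fun l r p a x y => ?_, fun h l r u v => ?_⟩
  · simp only [hf.1 l r p a x y]
    rw [wpar_slot l r p (a • x + y) x, wpar_slot l r p y x]; ring
  · simp only [hf.2 h l r u v, wpar_swap l r u v]; ring

theorem conv_mem {c : Flavour} {F : List (Letter V) → List (Letter V) → K}
    (h₁ : ∀ b, (fun a => F a b) ∈ algSub K V c) (h₂ : ∀ a, F a ∈ algSub K V c) :
    conv c F ∈ algSub K V c := by
  cases c
  · refine ⟨fun l r p a x y => ?_, fun h => by cases h⟩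
    show catSum F _ = a * catSum F _ + catSum F _
    induction l generalizing F with
    | nil =>
      simp only [List.nil_append, catSum]
      have e : (fun a' b => F (⟨p, a • x + y⟩ :: a') b)
          = fun a' b => a * F (⟨p, x⟩ :: a') b + F (⟨p, y⟩ :: a') b := by
        funext a' b; exact shift_lin (h₁ b) p a x y a'
      rw [e, catSum_lin, shift_lin (h₂ []) p a x y r]; ring
    | cons u l ih =>
      simp only [List.cons_append, catSum]
      rw [ih (F := fun a b => F (u :: a) b) (fun b => shift_mem (h₁ b) u) (fun a => h₂ _)]
      have := (h₂ []).1 (u :: l) r p a x y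
      simp only [List.cons_append] at this
      rw [this]; ring
  · have step : ∀ (F : List (Letter V) → List (Letter V) → K) (u : Letter V),
        (∀ b, (fun a => F a b) ∈ algSub K V .com) → (∀ a, F a ∈ algSub K V .com) →
        (∀ b, (fun a => F (u :: a) b + sgn K (par u * wpar a) * F a (u :: b)) ∈ algSub K V .com) ∧
        (∀ a, (fun b => F (u :: a) b + sgn K (par u * wpar a) * F a (u :: b)) ∈ algSub K V .com) := by
      intro F u h₁ h₂
      refine ⟨fun b => ?_, fun a => ?_⟩
      · exact add_mem (shift_mem (h₁ b) u) (sgn_mul_mem (h₁ (u :: b)) (par u))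
      · exact add_mem (h₂ _) ((algSub K V .com).smul_mem _ (shift_mem (h₂ a) u))
    refine ⟨fun l r p a x y => ?_, fun _ l r u v => ?_⟩
    · show shSum F _ = a * shSum F _ + shSum F _
      induction l generalizing F with
      | nil =>
        simp only [List.nil_append, shSum]
        rw [← shSum_lin]
        congr 1; funext a' b
        rw [shift_lin (h₁ b) p a x y a', shift_lin (h₂ a') p a x y b]
        simp only [par]; ring
      | cons u l ih =>
        simp only [List.cons_append, shSum]
        exact ih (step F u h₁ h₂).1 (step F u h₁ h₂).2
    · show shSum F _ = _ * shSum F _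
      induction l generalizing F with
      | nil =>
        simp only [List.nil_append, shSum]
        have smul : ∀ (a : K) (F : List (Letter V) → List (Letter V) → K) (w : List (Letter V)),
          shSum (fun x y => a * F x y) w = a * shSum F w := conv_smul .com
        rw [← smul]
        congr 1; funext a b
        have e₁ := (h₁ b).2 rfl [] a u v
        have e₂ := (h₂ a).2 rfl [] b u v
        simp only [List.nil_append] at e₁ e₂
        rw [e₁, e₂]
        simp only [wpar, mul_add, sgn_add]
        rw [show par v * par u = par u * par v by ring]
        have hs := sgn_sq K (par u * par v)
        linear_combination (-(sgn K (par v * wpar a) * F (u :: a) (v :: b))) * hs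
      | cons w l ih =>
        simp only [List.cons_append, shSum]
        exact ih (step F w h₁ h₂).1 (step F w h₁ h₂).2

end Words



section Algebra

variable {K : Type*} [Field K] {V : ZMod 2 → Type*}
  [∀ p, AddCommGroup (V p)] [∀ p, Module K (V p)]

instance (c : Flavour) : Mul (Alg K V c) where
  mul f g := ⟨conv c (fun a b => f.1 a * g.1 b), conv_mem
    (fun b => by
      have h := (algSub K V c).smul_mem (g.1 b) f.2
      have e : (fun a => f.1 a * g.1 b) = g.1 b • f.1 := by
        funext a; simp [mul_comm]
      rw [e]; exact h)
    (fun a => (algSub K V c).smul_mem (f.1 a) g.2)⟩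

/-- The unit: the form of degree zero with value `1`. -/
def Alg.one (c : Flavour) : Alg K V c :=
  ⟨fun w => match w with
    | [] => 1
    | _ => 0, by
    refine ⟨fun l r p a x y => ?_, fun _ l r u v => ?_⟩
    · rcases l with _ | ⟨v, l⟩ <;> simp
    · rcases l with _ | ⟨v, l⟩ <;> simp⟩

instance (c : Flavour) : One (Alg K V c) := ⟨Alg.one c⟩

theorem Alg.mul_val {c : Flavour} (f g : Alg K V c) (w : List (Letter V)) :
    (f * g).1 w = conv c (fun a b => f.1 a * g.1 b) w := rfl

theorem alg_mul_add {c : Flavour} (f g h : Alg K V c) :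
    f * (g + h) = f * g + f * h := by
  ext w
  show conv c (fun a b => f.1 a * (g.1 b + h.1 b)) w = conv c _ w + conv c _ w
  rw [← conv_add]; congr 1; funext a b; ring

theorem alg_add_mul {c : Flavour} (f g h : Alg K V c) :
    (f + g) * h = f * h + g * h := by
  ext w
  show conv c (fun a b => (f.1 a + g.1 a) * h.1 b) w = conv c _ w + conv c _ w
  rw [← conv_add]; congr 1; funext a b; ring

theorem alg_mul_smul {c : Flavour} (a : K) (f g : Alg K V c) :
    f * (a • g) = a • (f * g) := by
  ext w
  show conv c (fun x y => f.1 x * (a * g.1 y)) w = a * conv c _ w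
  rw [← conv_smul]; congr 1; funext x y; ring

theorem alg_smul_mul {c : Flavour} (a : K) (f g : Alg K V c) :
    (a • f) * g = a • (f * g) := by
  ext w
  show conv c (fun x y => (a * f.1 x) * g.1 y) w = a * conv c _ w
  rw [← conv_smul]; congr 1; funext x y; ring

theorem alg_one_mul {c : Flavour} (f : Alg K V c) : 1 * f = f := by
  ext w
  cases c
  · show catSum (fun a b => (Alg.one (K := K) (V := V) .ass).1 a * f.1 b) w = f.1 w
    rcases w with _ | ⟨u, w⟩
    · simp [catSum, Alg.one]
    · have : catSum (fun a b => (0 : K) * f.1 b) w = 0 := by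
        simpa [conv] using conv_zero (K := K) .ass w
      simp only [catSum, Alg.one, this]; ring
  · show shSum (fun a b => (Alg.one (K := K) (V := V) .com).1 a * f.1 b) w = f.1 w
    suffices h : ∀ g : Fn K V,
        shSum (fun a b => (Alg.one (K := K) (V := V) .com).1 a * g b) w = g w from h f.1
    induction w with
    | nil => intro g; simp [shSum, Alg.one]
    | cons u w ih =>
      intro g
      simp only [shSum]
      rw [← ih (fun w => g (u :: w))]
      congr 1; funext a b
      rcases a with _ | ⟨v, a⟩ <;> simp [Alg.one, wpar, sgn_zero]

theorem alg_mul_one {c : Flavour} (f : Alg K V c) : f * 1 = f := by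
  ext w
  cases c
  · show catSum (fun a b => f.1 a * (Alg.one (K := K) (V := V) .ass).1 b) w = f.1 w
    suffices h : ∀ g : Fn K V,
        catSum (fun a b => g a * (Alg.one (K := K) (V := V) .ass).1 b) w = g w from h f.1
    induction w with
    | nil => intro g; simp [catSum, Alg.one]
    | cons u w ih =>
      intro g
      simp only [catSum]
      rw [ih (fun w => g (u :: w))]
      simp [Alg.one]
  · show shSum (fun a b => f.1 a * (Alg.one (K := K) (V := V) .com).1 b) w = f.1 w
    suffices h : ∀ g : Fn K V,
        shSum (fun a b => g a * (Alg.one (K := K) (V := V) .com).1 b) w = g w from h f.1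
    induction w with
    | nil => intro g; simp [shSum, Alg.one]
    | cons u w ih =>
      intro g
      simp only [shSum]
      rw [← ih (fun w => g (u :: w))]
      congr 1; funext a b
      simp [Alg.one]

theorem alg_mul_assoc {c : Flavour} (f g h : Alg K V c) : f * g * h = f * (g * h) := by
  ext w
  show conv c (fun a b => conv c (fun a₁ a₂ => f.1 a₁ * g.1 a₂) a * h.1 b) w
    = conv c (fun a b => f.1 a * conv c (fun b₁ b₂ => g.1 b₁ * h.1 b₂) b) w
  have := conv_assoc c (fun x y z => f.1 x * g.1 y * h.1 z) w
  convert this using 2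
  · funext a b
    rw [mul_comm, ← conv_smul]; congr 1; funext x y; ring
  · funext a b
    rw [← conv_smul]; congr 1; funext x y; ring

theorem alg_zero_mul {c : Flavour} (f : Alg K V c) : 0 * f = 0 := by
  simpa using alg_smul_mul (0 : K) 0 f

theorem alg_mul_zero {c : Flavour} (f : Alg K V c) : f * 0 = 0 := by
  simpa using alg_mul_smul (0 : K) f 0

instance (c : Flavour) : Ring (Alg K V c) :=
  { (inferInstance : AddCommGroup (Alg K V c)) with
    mul := (· * ·)
    one := 1
    left_distrib := alg_mul_add
    right_distrib := alg_add_mul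
    zero_mul := alg_zero_mul
    mul_zero := alg_mul_zero
    mul_assoc := alg_mul_assoc
    one_mul := alg_one_mul
    mul_one := alg_mul_one }

instance (c : Flavour) : Algebra K (Alg K V c) :=
  Algebra.ofModule alg_smul_mul (fun a f g => alg_mul_smul a f g)

/-- Multiply the part of parity `q` by `(-1)^(t q)`. -/
def Alg.twist {c : Flavour} (t : ZMod 2) (f : Alg K V c) : Alg K V c :=
  ⟨fun w => sgn K (t * wpar w) * f.1 w, sgn_mul_mem f.2 t⟩

/-- `f` is homogeneous of parity `t`. -/
def Alg.IsHomog {c : Flavour} (t : ZMod 2) (f : Alg K V c) : Prop :=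
  ∀ w, wpar w ≠ t → f.1 w = 0

variable (K V) in
/-- The elements all of whose components in tensor degree less than `n` vanish. These subspaces
are the basic neighbourhoods of zero; `Alg.fil K V c 1` is the augmentation ideal. -/
def Alg.fil (c : Flavour) (n : ℕ) : Submodule K (Alg K V c) where
  carrier := {f | ∀ w, w.length < n → f.1 w = 0}
  add_mem' := fun {f g} hf hg w hw => by
    show f.1 w + g.1 w = 0
    rw [hf w hw, hg w hw, add_zero]
  zero_mem' := fun _ _ => rfl
  smul_mem' := fun a f hf w hw => by
    show a * f.1 w = 0
    rw [hf w hw, mul_zero]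

/-- A linear form on `ΠV` as a generator of the algebra. -/
def Alg.gen (c : Flavour) (φ : ∀ p, V p →ₗ[K] K) : Alg K V c :=
  ⟨fun w => match w with
    | [u] => φ u.1 u.2
    | _ => 0, by
    refine ⟨fun l r p a x y => ?_, fun _ l r u v => ?_⟩
    · rcases l with _ | ⟨v, l⟩
      · rcases r with _ | ⟨v, r⟩ <;> simp
      · rcases l with _ | ⟨v, l⟩ <;> simp
    · rcases l with _ | ⟨v, l⟩
      · simp
      · rcases l with _ | ⟨v, l⟩ <;> simp⟩

theorem Alg.mul_parity {c : Flavour} {s t : ZMod 2} {f g : Alg K V c} (hf : f.IsHomog s)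
    (hg : g.IsHomog t) : Alg.IsHomog (s + t) (f * g) := by
  intro w hw
  refine conv_parity c (s + t) _ (fun a b h => ?_) w hw
  by_cases ha : wpar a = s
  · rw [hg b (fun hb => h (by rw [ha, hb])), mul_zero]
  · rw [hf a ha, zero_mul]

theorem Alg.mul_fil {c : Flavour} {m n : ℕ} {f g : Alg K V c} (hf : f ∈ Alg.fil K V c m)
    (hg : g ∈ Alg.fil K V c n) : f * g ∈ Alg.fil K V c (m + n) := by
  intro w hw
  refine conv_length c (m + n) _ (fun a b h => ?_) w hw
  by_cases ha : a.length < m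
  · rw [hf a ha, zero_mul]
  · rw [hg b (by omega), mul_zero]

theorem Alg.twist_add {c : Flavour} (t : ZMod 2) (f g : Alg K V c) :
    (f + g).twist t = f.twist t + g.twist t := by
  ext w
  show _ * (f.1 w + g.1 w) = _ * f.1 w + _ * g.1 w
  ring

theorem Alg.twist_smul {c : Flavour} (t : ZMod 2) (a : K) (f : Alg K V c) :
    (a • f).twist t = a • f.twist t := by
  ext w
  show _ * (a * f.1 w) = a * (_ * f.1 w)
  ring

theorem Alg.twist_twist {c : Flavour} (s t : ZMod 2) (f : Alg K V c) :
    (f.twist s).twist t = f.twist (s + t) := by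
  ext w
  show sgn K (t * wpar w) * (sgn K (s * wpar w) * f.1 w) = sgn K ((s + t) * wpar w) * f.1 w
  rw [add_mul, sgn_add]; ring

theorem Alg.twist_fil {c : Flavour} {n : ℕ} (t : ZMod 2) {f : Alg K V c}
    (hf : f ∈ Alg.fil K V c n) : f.twist t ∈ Alg.fil K V c n := fun w hw => by
  show _ * f.1 w = 0
  rw [hf w hw, mul_zero]

theorem Alg.gen_fil {c : Flavour} (φ : ∀ p, V p →ₗ[K] K) :
    Alg.gen c φ ∈ Alg.fil K V c 1 := by
  intro w hw
  have : w = [] := List.length_eq_zero_iff.mp (by omega)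
  subst this; rfl

/-! Components -/

variable (K V) in
/-- The component of parity `ε`. -/
def Alg.comp0 (c : Flavour) (ε : ZMod 2) (f : Alg K V c) : Alg K V c :=
  ⟨fun w => if wpar w = ε then f.1 w else 0, by
    refine ⟨fun l r p a x y => ?_, fun h l r u v => ?_⟩
    · show (if _ then _ else _) = _ * (if _ then _ else _) + (if _ then _ else _)
      rw [wpar_slot l r p (a • x + y) x, wpar_slot l r p y x, f.2.1 l r p a x y]
      split_ifs <;> simp
    · show (if _ then _ else _) = _ * (if _ then _ else _)
      rw [wpar_swap l r u v, f.2.2 h l r u v]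
      split_ifs <;> simp⟩

theorem Alg.mul_comm_sgn {s t : ZMod 2} {f g : Alg K V .com} (hf : f.IsHomog s)
    (hg : g.IsHomog t) : f * g = sgn K (s * t) • (g * f) := by
  ext w
  show shSum (fun a b => f.1 a * g.1 b) w = sgn K (s * t) * shSum (fun a b => g.1 a * f.1 b) w
  rw [← shSum_comm]
  rw [show sgn K (s * t) * shSum (fun a b => g.1 a * f.1 b) w
    = shSum (fun a b => sgn K (s * t) * (g.1 a * f.1 b)) w from
      (conv_smul .com (sgn K (s * t)) (fun a b => g.1 a * f.1 b) w).symm]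
  congr 1; funext a b
  by_cases ha : wpar a = t
  · by_cases hb : wpar b = s
    · rw [ha, hb, mul_comm t s]; ring
    · rw [hf b hb]; ring
  · rw [hg a ha]; ring

/-! Derivations. -/

variable (K V) in
/-- Continuous derivations of parity `d`: `D (f g) = (D f) g + (-1)^(d |f|) f (D g)`. -/
def Der (c : Flavour) (d : ZMod 2) : Submodule K (Module.End K (Alg K V c)) where
  carrier := {D |
    (∀ t (f : Alg K V c), Alg.IsHomog t f → Alg.IsHomog (d + t) (D f)) ∧
    (∀ f g : Alg K V c, D (f * g) = D f * g + f.twist d * D g) ∧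
    (∀ n, ∃ m, ∀ f ∈ Alg.fil K V c m, D f ∈ Alg.fil K V c n)}
  add_mem' := by
    rintro D E ⟨h₁, h₂, h₃⟩ ⟨k₁, k₂, k₃⟩
    refine ⟨fun t f hf w hw => ?_, fun f g => ?_, fun n => ?_⟩
    · show (D f).1 w + (E f).1 w = 0
      rw [h₁ t f hf w hw, k₁ t f hf w hw, add_zero]
    · simp only [LinearMap.add_apply, h₂, k₂, mul_add, add_mul]; abel
    · obtain ⟨m, hm⟩ := h₃ n
      obtain ⟨m', hm'⟩ := k₃ n
      refine ⟨max m m', fun f hf => add_mem (hm f fun w hw => hf w ?_) (hm' f fun w hw => hf w ?_)⟩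
      · exact lt_of_lt_of_le hw (le_max_left _ _)
      · exact lt_of_lt_of_le hw (le_max_right _ _)
  zero_mem' := by
    refine ⟨fun t f hf w hw => rfl, fun f g => ?_, fun n => ⟨0, fun f hf => zero_mem _⟩⟩
    simp
  smul_mem' := by
    rintro a D ⟨h₁, h₂, h₃⟩
    refine ⟨fun t f hf w hw => ?_, fun f g => ?_, fun n => ?_⟩
    · show a * (D f).1 w = 0
      rw [h₁ t f hf w hw, mul_zero]
    · simp only [LinearMap.smul_apply, h₂, mul_smul_comm, smul_mul_assoc, smul_add]
    · obtain ⟨m, hm⟩ := h₃ n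
      exact ⟨m, fun f hf => Submodule.smul_mem _ _ (hm f hf)⟩

theorem der_twist {c : Flavour} {d : ZMod 2} {D : Module.End K (Alg K V c)} (hD : D ∈ Der K V c d)
    (t : ZMod 2) (f : Alg K V c) : D (f.twist t) = sgn K (t * d) • Alg.twist t (D f) := by
  have hf : ∀ (t : ZMod 2) (g : Alg K V c), Alg.IsHomog t g → ∀ s, g.twist s = sgn K (s * t) • g := by
    intro t g hg s; ext w
    show sgn K (s * wpar w) * g.1 w = sgn K (s * t) * g.1 w
    by_cases hw : wpar w = t
    · rw [hw]
    · rw [hg w hw]; simp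
  have hom : ∀ ε, Alg.IsHomog ε (Alg.comp0 K V c ε f) := fun ε w hw => if_neg hw
  have dec : f = Alg.comp0 K V c 0 f + Alg.comp0 K V c 1 f := by
    ext w
    show f.1 w = (if wpar w = 0 then f.1 w else 0) + (if wpar w = 1 then f.1 w else 0)
    rcases zmod2_cases (wpar w) with h | h <;> simp [h]
  have main : ∀ ε g, Alg.IsHomog (K := K) (V := V) (c := c) ε g →
      D (g.twist t) = sgn K (t * d) • Alg.twist t (D g) := by
    intro ε g hg
    rw [hf ε g hg, hf (d + ε) (D g) (hD.1 ε g hg), map_smul, smul_smul, mul_add, sgn_add,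
      ← mul_assoc, sgn_sq, one_mul]
  rw [dec, Alg.twist_add, map_add, map_add, Alg.twist_add, smul_add, main 0 _ (hom 0),
    main 1 _ (hom 1)]

theorem der_bracket {c : Flavour} {d e : ZMod 2} {D E : Module.End K (Alg K V c)}
    (hD : D ∈ Der K V c d) (hE : E ∈ Der K V c e) :
    D * E - sgn K (d * e) • (E * D) ∈ Der K V c (d + e) := by
  refine ⟨fun t f hf w hw => ?_, fun f g => ?_, fun n => ?_⟩
  · show (D (E f)).1 w - sgn K (d * e) * (E (D f)).1 w = 0
    rw [hD.1 _ _ (hE.1 t f hf) w (by rwa [← add_assoc]),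
      hE.1 _ _ (hD.1 t f hf) w (by rwa [← add_assoc, add_comm e d])]
    simp
  · simp only [LinearMap.sub_apply, Module.End.mul_apply, LinearMap.smul_apply]
    simp only [hE.2.1, hD.2.1, map_add, der_twist hD, der_twist hE, Alg.twist_twist,
      smul_mul_assoc, smul_add, smul_smul]
    rw [mul_comm e d, add_comm e d, sgn_sq, one_smul]
    have key : ∀ x y : Alg K V c, x - y = x + (-1 : K) • y := fun x y => by
      rw [neg_smul, one_smul, sub_eq_add_neg]
    simp only [key, add_mul, mul_add, smul_mul_assoc, mul_smul_comm, smul_add, smul_smul]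
    simp only [neg_mul, one_mul, neg_smul, one_smul]
    abel
  · obtain ⟨m, hm⟩ := hD.2.2 n
    obtain ⟨m₁, hm₁⟩ := hE.2.2 m
    obtain ⟨l, hl⟩ := hE.2.2 n
    obtain ⟨l₁, hl₁⟩ := hD.2.2 l
    refine ⟨max m₁ l₁, fun f hf => ?_⟩
    refine sub_mem (hm _ (hm₁ f fun w hw => hf w ?_))
      (Submodule.smul_mem _ _ (hl _ (hl₁ f fun w hw => hf w ?_)))
    · exact lt_of_lt_of_le hw (le_max_left _ _)
    · exact lt_of_lt_of_le hw (le_max_right _ _)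



/-! Generators and uniqueness of derivations. -/

section Gen

variable (K V) in
/-- Indices of a homogeneous basis of `V`. -/
abbrev Idx : Type := Σ p : ZMod 2, Fin (Module.finrank K (V p))

/-- Euler-type identity in the symmetric case. -/
theorem shSum_euler {h : Fn K V} (hh : h ∈ algSub K V .com) (w : List (Letter V)) :
    shSum (fun a b => match a with | [u] => h (u :: b) | _ => 0) w = w.length * h w := by
  have unit : ∀ (g : Fn K V) (w : List (Letter V)),
      shSum (fun a b => match a with | [] => g b | _ => 0) w = g w := by
    intro g w
    induction w generalizing g with
    | nil => simp [shSum]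
    | cons u w ih =>
      simp only [shSum]
      rw [← ih (fun w => g (u :: w))]
      congr 1; funext a b
      rcases a with _ | ⟨v, a⟩ <;> simp [wpar, sgn_zero]
  induction w generalizing h with
  | nil => simp [shSum]
  | cons u w ih =>
    simp only [shSum]
    have e : (fun (a b : List (Letter V)) =>
        (match u :: a with | [u] => h (u :: b) | _ => 0)
        + sgn K (par u * wpar a) * (match a with | [v] => h (v :: u :: b) | _ => 0))
        = fun a b => (match a with | [] => h (u :: b) | _ => 0)
          + (match a with | [v] => h (u :: v :: b) | _ => 0) := by
      funext a b
      rcases a with _ | ⟨v, _ | ⟨v', a⟩⟩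
      · simp
      · have := hh.2 rfl [] b u v
        simp only [List.nil_append] at this
        simp [wpar, this]
      · simp
    rw [e]
    have add := conv_add (K := K) (V := V) .com
      (fun a b => match a with | [] => h (u :: b) | _ => 0)
      (fun a b => match a with | [v] => h (u :: v :: b) | _ => 0) w
    have add' : ∀ (F G : List (Letter V) → List (Letter V) → K) (w : List (Letter V)),
      shSum (fun x y => F x y + G x y) w = shSum F w + shSum G w := conv_add .com
    rw [add', unit (fun w => h (u :: w)), ih (shift_mem hh u)]
    push_cast [List.length_cons]; ring

theorem catSum_euler (h : Fn K V) (u : Letter V) (w : List (Letter V)) :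
    catSum (fun a b => match a with | [u] => h (u :: b) | _ => 0) (u :: w) = h (u :: w) := by
  have z : ∀ w : List (Letter V), catSum (fun _ _ => (0 : K)) w = 0 := conv_zero .ass
  rcases w with _ | ⟨v, w⟩
  · simp [catSum]
  · simp [catSum, z]

variable [∀ p, Module.Finite K (V p)]

variable (K V) in
/-- A homogeneous basis of `V`. -/
noncomputable def bas (i : Idx K V) : Letter V := ⟨i.1, Module.finBasis K (V i.1) i.2⟩

variable (K V) in
/-- The dual basis of `V*`. -/
noncomputable def crd (i : Idx K V) (p : ZMod 2) : V p →ₗ[K] K :=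
  if h : i.1 = p then h ▸ (Module.finBasis K (V i.1)).coord i.2 else 0

theorem crd_parity (i : Idx K V) (p : ZMod 2) (h : p ≠ i.1) : crd K V i p = 0 := by
  simp [crd, h.symm]

theorem sum_crd (φ : ∀ p, V p →ₗ[K] K) (u : Letter V) :
    ∑ i : Idx K V, crd K V i u.1 u.2 * φ (bas K V i).1 (bas K V i).2 = φ u.1 u.2 := by
  obtain ⟨p, x⟩ := u
  rw [Fintype.sum_sigma, Finset.sum_eq_single p]
  · have : ∀ j : Fin (Module.finrank K (V p)),
        crd K V ⟨p, j⟩ p x = (Module.finBasis K (V p)).coord j x := by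
      intro j; simp [crd]
    simp only [this, bas]
    conv_rhs => rw [← (Module.finBasis K (V p)).sum_repr x]
    rw [map_sum]
    simp only [map_smul, smul_eq_mul]
    rfl
  · intro q _ hq
    refine Finset.sum_eq_zero fun j _ => ?_
    rw [crd_parity ⟨q, j⟩ p hq.symm]; simp
  · intro h; exact absurd (Finset.mem_univ p) h

theorem sum_crd_fn {f : Fn K V} (hf : SlotLinear f) (u : Letter V) (w : List (Letter V)) :
    ∑ i : Idx K V, crd K V i u.1 u.2 * f (bas K V i :: w) = f (u :: w) := by
  let φ : ∀ p, V p →ₗ[K] K := fun p =>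
    { toFun := fun x => f (⟨p, x⟩ :: w)
      map_add' := fun x y => by simpa using hf [] w p 1 x y
      map_smul' := fun a x => by simpa using slot_smul hf [] w p a x }
  exact sum_crd φ u

theorem gen_expand (c : Flavour) (φ : ∀ p, V p →ₗ[K] K) :
    Alg.gen c φ = ∑ i : Idx K V, φ (bas K V i).1 (bas K V i).2 • Alg.gen c (crd K V i) := by
  apply Subtype.ext
  rw [AddSubmonoidClass.coe_finsetSum]
  funext w
  rw [Finset.sum_apply]
  show (match w with | [u] => φ u.1 u.2 | _ => 0) = ∑ i : Idx K V,
      φ (bas K V i).1 (bas K V i).2 * (match w with | [u] => crd K V i u.1 u.2 | _ => 0)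
  match w with
  | [] => simp
  | [u] =>
    show φ u.1 u.2 = ∑ i : Idx K V, φ (bas K V i).1 (bas K V i).2 * crd K V i u.1 u.2
    rw [← sum_crd φ u]; exact Finset.sum_congr rfl fun i _ => mul_comm _ _
  | u :: v :: w => simp

variable [CharZero K]

/-- Every element is its constant term plus a combination of generators. -/
theorem exists_decomp {c : Flavour} (f : Alg K V c) : ∃ g : Idx K V → Alg K V c,
    f = f.1 [] • 1 + ∑ i, Alg.gen c (crd K V i) * g i ∧
    ∀ n, f ∈ Alg.fil K V c (n + 1) → ∀ i, g i ∈ Alg.fil K V c n := by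
  have gmul : ∀ (φ : ∀ p, V p →ₗ[K] K) (g : Alg K V c) (w : List (Letter V)),
      (Alg.gen c φ * g).1 w
        = conv c (fun a b => match a with | [u] => φ u.1 u.2 * g.1 b | _ => 0) w := by
    intro φ g w
    show conv c _ w = conv c _ w
    congr 1; funext a b
    rcases a with _ | ⟨v, _ | ⟨v', a⟩⟩ <;> simp [Alg.gen]
  have onev : ∀ u : Letter V, ∀ w, (1 : Alg K V c).1 (u :: w) = 0 := fun _ _ => rfl
  have one0 : (1 : Alg K V c).1 [] = 1 := rfl
  have fin : ∀ (g : Idx K V → Alg K V c) (w : List (Letter V)),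
      (f.1 [] • (1 : Alg K V c) + ∑ i, Alg.gen c (crd K V i) * g i).1 w
      = f.1 [] * (1 : Alg K V c).1 w
        + conv c (fun a b => match a with
            | [u] => ∑ i, crd K V i u.1 u.2 * (g i).1 b | _ => 0) w := by
    intro g w
    show f.1 [] * (1 : Alg K V c).1 w + (∑ i, Alg.gen c (crd K V i) * g i).1 w = _
    congr 1
    rw [AddSubmonoidClass.coe_finsetSum, Finset.sum_apply]
    simp only [gmul]
    rw [← conv_sum]
    congr 1; funext a b
    rcases a with _ | ⟨v, _ | ⟨v', a⟩⟩ <;> simp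
  cases c
  · refine ⟨fun i => ⟨fun w => f.1 (bas K V i :: w), shift_mem f.2 _⟩, ?_, ?_⟩
    · apply Subtype.ext; funext w
      rw [fin]
      simp only [sum_crd_fn f.2.1]
      rcases w with _ | ⟨u, w⟩
      · simp [conv, catSum, one0]
      · rw [onev, mul_zero, zero_add]
        exact (catSum_euler f.1 u w).symm
    · intro n hf i w hw
      exact hf _ (by simpa using hw)
  · have hlen : ∀ l r : List (Letter V), ∀ u v : Letter V,
      (l ++ u :: r).length = (l ++ v :: r).length := by intro l r u v; simp
    let h : Fn K V := fun w => (w.length : K)⁻¹ * f.1 w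
    have hh : h ∈ algSub K V .com := by
      refine ⟨fun l r p a x y => ?_, fun _ l r u v => ?_⟩
      · simp only [h, f.2.1 l r p a x y, List.length_append, List.length_cons]; ring
      · simp only [h, f.2.2 rfl l r u v, List.length_append, List.length_cons]; ring
    refine ⟨fun i => ⟨fun w => h (bas K V i :: w), shift_mem hh _⟩, ?_, ?_⟩
    · apply Subtype.ext; funext w
      rw [fin]
      simp only [sum_crd_fn hh.1]
      have := shSum_euler hh w
      rw [show conv .com (fun a b => match a with | [u] => h (u :: b) | _ => 0) w
        = w.length * h w from this]
      rcases w with _ | ⟨u, w⟩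
      · simp [one0]
      · rw [onev, mul_zero, zero_add]
        have : ((u :: w).length : K) ≠ 0 := by
          exact Nat.cast_ne_zero.mpr (by simp)
        simp only [h]
        field_simp
    · intro n hf i w hw
      show h (bas K V i :: w) = 0
      simp only [h]
      rw [hf _ (by simpa using hw), mul_zero]

theorem leibniz_one {c : Flavour} {d : ZMod 2} {D : Module.End K (Alg K V c)}
    (hD : ∀ f g : Alg K V c, D (f * g) = D f * g + f.twist d * D g) : D 1 = 0 := by
  have h := hD 1 1
  have t : (1 : Alg K V c).twist d = 1 := by
    apply Subtype.ext; funext w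
    show sgn K (d * wpar w) * (1 : Alg K V c).1 w = (1 : Alg K V c).1 w
    rcases w with _ | ⟨u, w⟩
    · simp [wpar, sgn_zero]
    · rw [show (1 : Alg K V c).1 (u :: w) = 0 from rfl, mul_zero]
  simp only [t, one_mul, mul_one] at h
  exact left_eq_add.mp h

theorem leibniz_decomp {c : Flavour} {d : ZMod 2} {D : Module.End K (Alg K V c)}
    (hD : ∀ f g : Alg K V c, D (f * g) = D f * g + f.twist d * D g)
    {f : Alg K V c} {g : Idx K V → Alg K V c}
    (hf : f = f.1 [] • 1 + ∑ i, Alg.gen c (crd K V i) * g i) :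
    D f = ∑ i, (D (Alg.gen c (crd K V i)) * g i
      + (Alg.gen c (crd K V i)).twist d * D (g i)) := by
  conv_lhs => rw [hf]
  rw [map_add, map_smul, leibniz_one hD, smul_zero, zero_add, map_sum]
  exact Finset.sum_congr rfl fun i _ => hD _ _

/-- A derivation is determined by its values on the generators. -/
theorem leibniz_unique {c : Flavour} {d : ZMod 2} {D : Module.End K (Alg K V c)}
    (hD : ∀ f g : Alg K V c, D (f * g) = D f * g + f.twist d * D g)
    (h0 : ∀ φ, D (Alg.gen c φ) = 0) : D = 0 := by
  have key : ∀ n, ∀ f, D f ∈ Alg.fil K V c n := by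
    intro n
    induction n with
    | zero => intro f w hw; exact absurd hw (Nat.not_lt_zero _)
    | succ n ih =>
      intro f
      obtain ⟨g, hg, -⟩ := exists_decomp f
      rw [leibniz_decomp hD hg]
      refine Submodule.sum_mem _ fun i _ => ?_
      rw [h0, zero_mul, zero_add, add_comm n 1]
      exact Alg.mul_fil (Alg.twist_fil d (Alg.gen_fil _)) (ih _)
  ext1 f
  apply Subtype.ext; funext w
  exact key (w.length + 1) f w (Nat.lt_succ_self _)

/-- A derivation lowers the order of vanishing by at most one. -/
theorem leibniz_fil {c : Flavour} {d : ZMod 2} {D : Module.End K (Alg K V c)}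
    (hD : ∀ f g : Alg K V c, D (f * g) = D f * g + f.twist d * D g) (n : ℕ) :
    ∀ f ∈ Alg.fil K V c (n + 1), D f ∈ Alg.fil K V c n := by
  induction n with
  | zero => intro f _ w hw; exact absurd hw (Nat.not_lt_zero _)
  | succ n ih =>
    intro f hf
    obtain ⟨g, hg, hg'⟩ := exists_decomp f
    rw [leibniz_decomp hD hg]
    refine Submodule.sum_mem _ fun i _ => add_mem ?_ ?_
    · rw [← zero_add (n + 1)]
      exact Alg.mul_fil (fun w hw => absurd hw (Nat.not_lt_zero _)) (hg' (n + 1) hf i)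
    · rw [add_comm n 1]
      exact Alg.mul_fil (Alg.twist_fil d (Alg.gen_fil _)) (ih _ (hg' (n + 1) hf i))

end Gen

/-! Construction of derivations with prescribed values on generators. -/

section Field

variable {ι : Type*} [Fintype ι]

/-- Replace the first letter: `∑ i, F i ⊗ f (e i, -)`. -/
def ctr (e : ι → Letter V) (F : ι → Fn K V) (f : Fn K V) (a b : List (Letter V)) : K :=
  ∑ i, F i a * f (e i :: b)

/-- Action of a vector field in the tensor case: substitution in every position, with Koszul sign. -/
def vfAss (e : ι → Letter V) (F : ι → Fn K V) (d : ZMod 2) : List (Letter V) → Fn K V → K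
  | [], f => catSum (ctr e F f) []
  | u :: w, f => catSum (ctr e F f) (u :: w)
      + sgn K (d * par u) * vfAss e F d w (fun w => f (u :: w))

/-- Action of the derivation with value `F i` on the generator dual to `e i`. -/
def vfFn (c : Flavour) (e : ι → Letter V) (F : ι → Fn K V) (d : ZMod 2) (f : Fn K V) : Fn K V :=
  match c with
  | .ass => fun w => vfAss e F d w f
  | .com => shSum (ctr e F f)

theorem ctr_parity (e : ι → Letter V) (F : ι → Fn K V) (d : ZMod 2)
    (hF : ∀ i w, wpar w ≠ d + par (e i) → F i w = 0) (t : ZMod 2) (f : Fn K V)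
    (hf : ∀ w, wpar w ≠ t → f w = 0) (a b : List (Letter V)) (h : wpar a + wpar b ≠ d + t) :
    ctr e F f a b = 0 := by
  refine Finset.sum_eq_zero fun i _ => ?_
  by_cases ha : wpar a = d + par (e i)
  · rw [hf (e i :: b), mul_zero]
    intro h'
    rw [wpar] at h'
    have h2 : par (e i) + par (e i) = 0 := CharTwo.add_self_eq_zero _
    exact h (by rw [ha, ← h']; ring)
  · rw [hF i a ha, zero_mul]

theorem ctr_length (e : ι → Letter V) (F : ι → Fn K V) (n : ℕ)
    (hF : ∀ i w, w.length < n → F i w = 0) (f : Fn K V) (a b : List (Letter V))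
    (h : a.length < n) : ctr e F f a b = 0 :=
  Finset.sum_eq_zero fun i _ => by rw [hF i a h, zero_mul]

theorem ctr_lin (e : ι → Letter V) (F : ι → Fn K V) (s : K) (f g : Fn K V) :
    ctr e F (fun w => s * f w + g w) = fun a b => s * ctr e F f a b + ctr e F g a b := by
  funext a b
  simp only [ctr, Finset.mul_sum, ← Finset.sum_add_distrib]
  exact Finset.sum_congr rfl fun i _ => by ring

theorem vfAss_lin (e : ι → Letter V) (F : ι → Fn K V) (d : ZMod 2) (s : K) (w : List (Letter V))
    (f g : Fn K V) :
    vfAss e F d w (fun w => s * f w + g w) = s * vfAss e F d w f + vfAss e F d w g := by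
  induction w generalizing f g with
  | nil => simp only [vfAss, ctr_lin, catSum_lin]
  | cons u w ih =>
    simp only [vfAss, ctr_lin, catSum_lin]
    rw [ih (fun w => f (u :: w)) (fun w => g (u :: w))]; ring

theorem vfFn_lin (c : Flavour) (e : ι → Letter V) (F : ι → Fn K V) (d : ZMod 2) (s : K)
    (f g : Fn K V) (w : List (Letter V)) :
    vfFn c e F d (fun w => s * f w + g w) w = s * vfFn c e F d f w + vfFn c e F d g w := by
  cases c
  · exact vfAss_lin e F d s w f g
  · simp only [vfFn, ctr_lin, shSum_lin]

theorem ctr_left_mem {c : Flavour} (e : ι → Letter V) {F : ι → Fn K V}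
    (hF : ∀ i, F i ∈ algSub K V c) (f : Fn K V) (b : List (Letter V)) :
    (fun a => ctr e F f a b) ∈ algSub K V c := by
  have : (fun a => ctr e F f a b) = ∑ i, f (e i :: b) • F i := by
    funext a; simp [ctr, Finset.sum_apply, mul_comm]
  rw [this]
  exact Submodule.sum_mem _ fun i _ => Submodule.smul_mem _ _ (hF i)

theorem ctr_right_mem {c : Flavour} (e : ι → Letter V) (F : ι → Fn K V) {f : Fn K V}
    (hf : f ∈ algSub K V c) (a : List (Letter V)) : ctr e F f a ∈ algSub K V c := by
  have : ctr e F f a = ∑ i, F i a • (fun b => f (e i :: b)) := by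
    funext b; simp [ctr, Finset.sum_apply]
  rw [this]
  exact Submodule.sum_mem _ fun i _ => Submodule.smul_mem _ _ (shift_mem hf (e i))

theorem vfFn_mem {c : Flavour} (e : ι → Letter V) {F : ι → Fn K V} (hF : ∀ i, F i ∈ algSub K V c)
    (d : ZMod 2) {f : Fn K V} (hf : f ∈ algSub K V c) : vfFn c e F d f ∈ algSub K V c := by
  cases c
  · refine ⟨fun l r p a x y => ?_, fun h => by cases h⟩
    have hc : ∀ f ∈ algSub K V .ass, catSum (ctr e F f) ∈ algSub K V .ass := fun f hf =>
      conv_mem (c := .ass) (ctr_left_mem e hF f) (ctr_right_mem e F hf)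
    show vfAss e F d _ f = a * vfAss e F d _ f + vfAss e F d _ f
    induction l generalizing f with
    | nil =>
      have h := (hc f hf).1 [] r p a x y
      simp only [List.nil_append] at h ⊢
      simp only [vfAss, h, par]
      have h' : (fun w => f (⟨p, a • x + y⟩ :: w))
          = fun w => a * f (⟨p, x⟩ :: w) + f (⟨p, y⟩ :: w) := by
        funext w; exact shift_lin hf p a x y w
      rw [h', vfAss_lin]; ring
    | cons u l ih =>
      have h := (hc f hf).1 (u :: l) r p a x y
      simp only [List.cons_append] at h ⊢
      simp only [vfAss, h]
      rw [ih (shift_mem hf u)]; ring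
  · exact conv_mem (c := .com) (ctr_left_mem e hF f) (ctr_right_mem e F hf)

/-- The derivation of parity `d` that sends a linear function `φ` to `∑ i, φ (e i) • F i`. -/
def vf {c : Flavour} (e : ι → Letter V) (F : ι → Alg K V c) (d : ZMod 2) :
    Module.End K (Alg K V c) where
  toFun f := ⟨vfFn c e (fun i => (F i).1) d f.1, vfFn_mem e (fun i => (F i).2) d f.2⟩
  map_add' f g := by
    apply Subtype.ext; funext w
    show vfFn c e _ d (fun w => f.1 w + g.1 w) w = vfFn c e _ d f.1 w + vfFn c e _ d g.1 w
    simpa using vfFn_lin c e (fun i => (F i).1) d 1 f.1 g.1 w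
  map_smul' s f := by
    apply Subtype.ext; funext w
    show vfFn c e _ d (fun w => s * f.1 w) w = s * vfFn c e _ d f.1 w
    have z := vfFn_lin c e (fun i => (F i).1) d (-1) 0 0 w
    have z' : vfFn c e (fun i => (F i).1) d (0 : Fn K V) w = 0 := by
      have e0 : (fun w : List (Letter V) => (-1 : K) * (0 : Fn K V) w + (0 : Fn K V) w) = 0 := by
        funext w; simp
      rw [e0] at z; linear_combination z
    have := vfFn_lin c e (fun i => (F i).1) d s f.1 0 w
    simpa [z'] using this

theorem vfAss_const (e : ι → Letter V) (F : ι → Fn K V) (d : ZMod 2) (w : List (Letter V))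
    {f : Fn K V} (hf : ∀ u w, f (u :: w) = 0) : vfAss e F d w f = 0 := by
  have h : ctr e F f = fun _ _ => 0 := by funext a b; simp [ctr, hf]
  have z : ∀ w : List (Letter V), catSum (fun _ _ => (0 : K)) w = 0 := conv_zero .ass
  induction w generalizing f with
  | nil => rw [vfAss, h, z]
  | cons u w ih =>
    rw [vfAss, h, z, ih (fun v w => hf u (v :: w)) (by funext a b; simp [ctr, hf])]; simp

theorem vf_gen {c : Flavour} (e : ι → Letter V) (F : ι → Alg K V c) (d : ZMod 2)
    (φ : ∀ p, V p →ₗ[K] K) :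
    vf e F d (Alg.gen c φ) = ∑ i, φ (e i).1 (e i).2 • F i := by
  have h : ctr e (fun i => (F i).1) (Alg.gen c φ).1
      = fun a b => (∑ i, φ (e i).1 (e i).2 • F i : Alg K V c).1 a * (1 : Alg K V c).1 b := by
    funext a b
    rw [AddSubmonoidClass.coe_finsetSum, Finset.sum_apply, Finset.sum_mul]
    refine Finset.sum_congr rfl fun i _ => ?_
    rcases b with _ | ⟨u, b⟩
    · show (F i).1 a * φ (e i).1 (e i).2 = φ (e i).1 (e i).2 * (F i).1 a * 1
      ring
    · show (F i).1 a * 0 = _ * 0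
      simp
  have h1 : conv c (ctr e (fun i => (F i).1) (Alg.gen c φ).1)
      = (∑ i, φ (e i).1 (e i).2 • F i : Alg K V c).1 := by
    rw [h]
    conv_rhs => rw [← mul_one (∑ i, φ (e i).1 (e i).2 • F i : Alg K V c)]
    rfl
  apply Subtype.ext; funext w
  rw [← h1]
  cases c
  · show vfAss e _ d w _ = catSum _ w
    rcases w with _ | ⟨u, w⟩
    · rfl
    · rw [vfAss, vfAss_const, mul_zero, add_zero]
      intro v w; rfl
  · rfl

theorem vfAss_leibniz (e : ι → Letter V) (F : ι → Fn K V) (d : ZMod 2) (w : List (Letter V))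
    (f g : Fn K V) :
    vfAss e F d w (catSum fun a b => f a * g b)
      = catSum (fun a b => vfAss e F d a f * g b) w
        + catSum (fun a b => sgn K (d * wpar a) * f a * vfAss e F d b g) w := by
  have add : ∀ (F G : List (Letter V) → List (Letter V) → K) (w : List (Letter V)),
      catSum (fun x y => F x y + G x y) w = catSum F w + catSum G w := conv_add .ass
  have smul : ∀ (a : K) (F : List (Letter V) → List (Letter V) → K) (w : List (Letter V)),
      catSum (fun x y => a * F x y) w = a * catSum F w := conv_smul .ass
  have sum : ∀ (F : ι → List (Letter V) → List (Letter V) → K) (w : List (Letter V)),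
      catSum (fun x y => ∑ i, F i x y) w = ∑ i, catSum (F i) w := conv_sum .ass Finset.univ
  have hC : ∀ (f g : Fn K V) (w : List (Letter V)),
      catSum (ctr e F (catSum fun a b => f a * g b)) w
        = catSum (fun a b => catSum (ctr e F f) a * g b) w + f [] * catSum (ctr e F g) w := by
    intro f g w
    have e1 : ctr e F (catSum fun a b => f a * g b)
        = fun a b => catSum (fun b₁ b₂ => ctr e F f a b₁ * g b₂) b + f [] * ctr e F g a b := by
      funext a b
      simp only [ctr, catSum, Finset.sum_mul, Finset.mul_sum, mul_add, Finset.sum_add_distrib, sum]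
      rw [add_comm]
      congr 1
      · refine Finset.sum_congr rfl fun i _ => ?_
        rw [← smul]; congr 1; funext x y; ring
      · exact Finset.sum_congr rfl fun i _ => by ring
    rw [e1, add, smul, ← catSum_assoc]
    congr 1
    congr 1; funext a b
    rw [mul_comm, ← smul]; congr 1; funext x y; ring
  induction w generalizing f g with
  | nil =>
    have := hC f g []
    simp only [vfAss, catSum] at this ⊢
    rw [this]; simp [wpar, sgn_zero]
  | cons u w ih =>
    rw [vfAss, hC]
    have e1 : (fun w => catSum (fun a b => f a * g b) (u :: w))
        = fun w => f [] * g (u :: w) + catSum (fun a b => f (u :: a) * g b) w := by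
      funext w; simp [catSum]
    rw [e1, vfAss_lin, ih]
    simp only [catSum]
    have e2 : (fun (a b : List (Letter V)) => vfAss e F d (u :: a) f * g b)
        = fun a b => catSum (ctr e F f) (u :: a) * g b
          + sgn K (d * par u) * (vfAss e F d a (fun w => f (u :: w)) * g b) := by
      funext a b; rw [vfAss]; ring
    have e3 : (fun (a b : List (Letter V)) =>
          sgn K (d * wpar (u :: a)) * f (u :: a) * vfAss e F d b g)
        = fun a b => sgn K (d * par u) *
          (sgn K (d * wpar a) * f (u :: a) * vfAss e F d b g) := by
      funext a b; simp only [wpar, mul_add, sgn_add]; ring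
    rw [e2, e3, add, smul, smul]
    simp only [vfAss, wpar, mul_zero, sgn_zero, one_mul]
    simp only [catSum]
    ring

theorem shSum_leibniz (e : ι → Letter V) (F : ι → Fn K V) (d : ZMod 2)
    (hF : ∀ i w, wpar w ≠ d + par (e i) → F i w = 0) (w : List (Letter V)) (f g : Fn K V) :
    shSum (ctr e F (shSum fun a b => f a * g b)) w
      = shSum (fun a b => shSum (ctr e F f) a * g b) w
        + shSum (fun a b => sgn K (d * wpar a) * f a * shSum (ctr e F g) b) w := by
  have add : ∀ (F G : List (Letter V) → List (Letter V) → K) (w : List (Letter V)),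
      shSum (fun x y => F x y + G x y) w = shSum F w + shSum G w := conv_add .com
  have smul : ∀ (a : K) (F : List (Letter V) → List (Letter V) → K) (w : List (Letter V)),
      shSum (fun x y => a * F x y) w = a * shSum F w := conv_smul .com
  have sum : ∀ (F : ι → List (Letter V) → List (Letter V) → K) (w : List (Letter V)),
      shSum (fun x y => ∑ i, F i x y) w = ∑ i, shSum (F i) w := conv_sum .com Finset.univ
  have e1 : ctr e F (shSum fun a b => f a * g b)
      = fun a b => shSum (fun b₁ b₂ => ctr e F f a b₁ * g b₂) b
        + shSum (fun b₁ b₂ => ∑ i, F i a * (sgn K (par (e i) * wpar b₁) * (f b₁ * g (e i :: b₂)))) b := by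
    funext a b
    simp only [ctr, shSum, Finset.sum_mul, sum, add, mul_add, Finset.sum_add_distrib]
    congr 1
    · refine Finset.sum_congr rfl fun i _ => ?_
      rw [← smul]; congr 1; funext x y; ring
    · refine Finset.sum_congr rfl fun i _ => ?_
      rw [← smul]
  rw [e1, add, ← shSum_assoc, ← shSum_assoc]
  congr 1
  · congr 1; funext a b
    rw [mul_comm, ← smul]; congr 1; funext x y; ring
  · have e2 : (fun (a b : List (Letter V)) => sgn K (d * wpar a) * f a * shSum (ctr e F g) b)
        = fun a b => shSum (fun b₁ b₂ => sgn K (d * wpar a) * f a * ctr e F g b₁ b₂) b := by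
      funext a b; rw [smul]
    rw [e2, ← shSum_assoc]
    congr 1; funext a b
    rw [← shSum_comm]
    congr 1; funext a₁ a₂
    simp only [ctr, Finset.mul_sum]
    refine Finset.sum_congr rfl fun i _ => ?_
    by_cases h : wpar a₂ = d + par (e i)
    · have hs := sgn_sq K (par (e i) * wpar a₁)
      rw [h, mul_add, sgn_add, mul_comm (wpar a₁) d, mul_comm (wpar a₁) (par (e i))]
      linear_combination (sgn K (d * wpar a₁) * F i a₂ * f a₁ * g (e i :: b)) * hs
    · rw [hF i a₂ h]; simp

theorem vfAss_parity (e : ι → Letter V) (F : ι → Fn K V) (d : ZMod 2)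
    (hF : ∀ i w, wpar w ≠ d + par (e i) → F i w = 0) (t : ZMod 2) (w : List (Letter V)) (f : Fn K V)
    (hf : ∀ w, wpar w ≠ t → f w = 0) (hw : wpar w ≠ d + t) : vfAss e F d w f = 0 := by
  have hc := conv_parity .ass (d + t) (ctr e F f) (ctr_parity e F d hF t f hf)
  induction w generalizing f t with
  | nil => exact hc [] hw
  | cons u w ih =>
    rw [vfAss, show catSum (ctr e F f) (u :: w) = 0 from hc _ hw]
    have hf' : ∀ w, wpar w ≠ t - par u → f (u :: w) = 0 := fun w h => hf _ fun h' => h (by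
      rw [← h', wpar]; ring)
    rw [ih (t - par u) (fun w => f (u :: w)) hf' (fun h => hw (by rw [wpar, h]; ring))
      (conv_parity .ass _ _ (ctr_parity e F d hF _ _ hf'))]
    simp

theorem vfAss_length (e : ι → Letter V) (F : ι → Fn K V) (d : ZMod 2) (n : ℕ)
    (hF : ∀ i w, w.length < n → F i w = 0) (w : List (Letter V)) (f : Fn K V)
    (hw : w.length < n) : vfAss e F d w f = 0 := by
  have hc : ∀ f, ∀ w : List (Letter V), w.length < n → catSum (ctr e F f) w = 0 := fun f w hw =>
    conv_length .ass n (ctr e F f) (fun a b h => ctr_length e F n hF f a b (by omega)) w hw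
  induction w generalizing f with
  | nil => exact hc f [] hw
  | cons u w ih =>
    rw [vfAss, hc f _ hw, ih _ (by simp only [List.length_cons] at hw; omega)]
    simp

theorem vf_fil {c : Flavour} (e : ι → Letter V) (F : ι → Alg K V c) (d : ZMod 2) (n : ℕ)
    (hF : ∀ i, F i ∈ Alg.fil K V c n) (f : Alg K V c) : vf e F d f ∈ Alg.fil K V c n := by
  intro w hw
  cases c
  · exact vfAss_length e _ d n hF w f.1 hw
  · exact conv_length .com n _ (fun a b h => ctr_length e _ n hF f.1 a b (by omega)) w hw

variable [∀ p, Module.Finite K (V p)] [CharZero K]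

theorem vf_leibniz {c : Flavour} (e : ι → Letter V) (F : ι → Alg K V c) (d : ZMod 2)
    (hF : ∀ i, Alg.IsHomog (d + par (e i)) (F i)) (f g : Alg K V c) :
    vf e F d (f * g) = vf e F d f * g + f.twist d * vf e F d g := by
  apply Subtype.ext; funext w
  cases c
  · exact vfAss_leibniz e _ d w f.1 g.1
  · exact shSum_leibniz e _ d hF w f.1 g.1

theorem vf_mem_der {c : Flavour} (e : ι → Letter V) (F : ι → Alg K V c) (d : ZMod 2)
    (hF : ∀ i, Alg.IsHomog (d + par (e i)) (F i)) : vf e F d ∈ Der K V c d := by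
  refine ⟨fun t f hf w hw => ?_, vf_leibniz e F d hF,
    fun n => ⟨n + 1, leibniz_fil (vf_leibniz e F d hF) n⟩⟩
  cases c
  · exact vfAss_parity e _ d hF t w f.1 hf hw
  · exact conv_parity .com (d + t) _ (ctr_parity e _ d hF t f.1 hf) w hw

end Field

/-! Inner products and cyclic derivations. -/

variable (K V) in
/-- An inner product on `V`: an even, supersymmetric (symmetric on the even part, alternating on
the odd part), nondegenerate bilinear form. -/
structure InnerProd where
  form : ∀ p q : ZMod 2, V p →ₗ[K] V q →ₗ[K] K
  even : ∀ p q x y, p ≠ q → form p q x y = 0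
  symm : ∀ p q x y, form p q x y = sgn K (p * q) * form q p y x
  nondeg : ∀ p x, (∀ q y, form p q x y = 0) → x = 0

/-- The linear form `⟨u, -⟩`, as a generator. -/
def InnerProd.lower (B : InnerProd K V) (c : Flavour) (u : Letter V) : Alg K V c :=
  Alg.gen c fun q => B.form u.1 q u.2

/-- The tensor in `ΠV* ⊗ T̂ΠV*` that corresponds to a derivation `D` of parity `d` under the
identification of `Der` with `Hom(ΠV*, T̂ΠV*) = ΠV ⊗ T̂ΠV*` and of `ΠV` with `ΠV*` through the inner
product. Its value at `u :: w` is the value of `± D ⟨u, -⟩` at `w`; the sign is the Koszul sign for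
moving `D` past `u`. -/
def InnerProd.tensor (B : InnerProd K V) {c : Flavour} (d : ZMod 2)
    (D : Module.End K (Alg K V c)) : Fn K V
  | [] => 0
  | u :: w => sgn K (d * par u) * (D (B.lower c u)).1 w

/-- Cyclic derivations of parity `d`: those whose tensor is invariant under the signed cyclic
rotation. -/
def CDer (c : Flavour) (B : InnerProd K V) (d : ZMod 2) :
    Submodule K (Module.End K (Alg K V c)) where
  carrier := {D | D ∈ Der K V c d ∧ ∀ (u : Letter V) (w : List (Letter V)),
    B.tensor d D (u :: w) = sgn K (par u * wpar w) * B.tensor d D (w ++ [u])}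
  add_mem' := by
    rintro D E ⟨h₁, h₂⟩ ⟨k₁, k₂⟩
    refine ⟨add_mem h₁ k₁, fun u w => ?_⟩
    have e : ∀ w, B.tensor d (D + E) w = B.tensor d D w + B.tensor d E w := by
      rintro (_ | ⟨v, w⟩)
      · simp [InnerProd.tensor]
      · show _ * ((D (B.lower c v)).1 w + (E (B.lower c v)).1 w) = _
        simp only [InnerProd.tensor]; ring
    rw [e, e, h₂, k₂]; ring
  zero_mem' := by
    refine ⟨zero_mem _, fun u w => ?_⟩
    have e : ∀ w, B.tensor d (0 : Module.End K (Alg K V c)) w = 0 := by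
      rintro (_ | ⟨v, w⟩)
      · rfl
      · show _ * (0 : K) = 0
        simp
    rw [e, e]; simp
  smul_mem' := by
    rintro a D ⟨h₁, h₂⟩
    refine ⟨Submodule.smul_mem _ _ h₁, fun u w => ?_⟩
    have e : ∀ w, B.tensor d (a • D) w = a * B.tensor d D w := by
      rintro (_ | ⟨v, w⟩)
      · simp [InnerProd.tensor]
      · show _ * (a * (D (B.lower c v)).1 w) = _
        simp only [InnerProd.tensor]; ring
    rw [e, e, h₂]; ring

/-- Cyclic derivations without constant term, that is, preserving the augmentation ideal. -/
def CDer0 (c : Flavour) (B : InnerProd K V) (d : ZMod 2) :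
    Submodule K (Module.End K (Alg K V c)) where
  carrier := {D | D ∈ CDer c B d ∧ ∀ f : Alg K V c, f ∈ Alg.fil K V c 1 → D f ∈ Alg.fil K V c 1}
  add_mem' := fun h k => ⟨add_mem h.1 k.1, fun f hf => add_mem (h.2 f hf) (k.2 f hf)⟩
  zero_mem' := ⟨zero_mem _, fun _ _ => zero_mem _⟩
  smul_mem' := fun a _ h =>
    ⟨Submodule.smul_mem _ a h.1, fun f hf => Submodule.smul_mem _ a (h.2 f hf)⟩

section Closure

theorem gen_val (c : Flavour) (φ : ∀ p, V p →ₗ[K] K) (u : Letter V) :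
    (Alg.gen c φ).1 [u] = φ u.1 u.2 := rfl

theorem gen_homog (c : Flavour) (φ : ∀ p, V p →ₗ[K] K) (t : ZMod 2)
    (h : ∀ p, p + 1 ≠ t → φ p = 0) : Alg.IsHomog t (Alg.gen c φ) := by
  intro w hw
  rcases w with _ | ⟨u, _ | ⟨v, w⟩⟩
  · rfl
  · rw [gen_val, h u.1]
    · rfl
    · intro h'; apply hw; simp [wpar, par, h']
  · rfl

theorem lower_homog (B : InnerProd K V) (c : Flavour) (u : Letter V) :
    Alg.IsHomog (par u) (B.lower c u) := by
  refine gen_homog c _ _ fun p hp => ?_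
  ext y
  exact B.even _ _ _ _ fun h => hp (by rw [par, h])

theorem end_to_front {f : Fn K V} (hf : f ∈ algSub K V .com) (u : Letter V) (w : List (Letter V)) :
    f (w ++ [u]) = sgn K (par u * wpar w) * f (u :: w) := by
  suffices h : ∀ l, f (l ++ (w ++ [u])) = sgn K (par u * wpar w) * f (l ++ u :: w) from h []
  induction w with
  | nil => intro l; simp [wpar, sgn_zero]
  | cons v w ih =>
    intro l
    have h1 := ih (l ++ [v])
    have h2 := hf.2 rfl l w v u
    simp only [List.append_assoc, List.cons_append, List.nil_append] at h1
    rw [List.cons_append, h1, h2, wpar, mul_add, sgn_add, mul_comm (par v) (par u)]; ring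

variable [∀ p, Module.Finite K (V p)]

theorem crd_homog (c : Flavour) (i : Idx K V) :
    Alg.IsHomog (par (bas K V i)) (Alg.gen c (crd K V i)) :=
  gen_homog c _ _ fun p hp => crd_parity i p fun h => hp (by rw [h]; rfl)

theorem sum_lower (B : InnerProd K V) (c : Flavour) (u : Letter V) :
    B.lower c u = ∑ i : Idx K V, crd K V i u.1 u.2 • B.lower c (bas K V i) := by
  have h := gen_expand (K := K) (V := V) c (fun q => B.form u.1 q u.2)
  have h' : ∀ i, B.lower c (bas K V i) = ∑ j : Idx K V,
      B.form (bas K V i).1 (bas K V j).1 (bas K V i).2 (bas K V j).2 • Alg.gen c (crd K V j) :=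
    fun i => gen_expand c _
  simp only [h', Finset.smul_sum]
  rw [InnerProd.lower, h, Finset.sum_comm]
  refine Finset.sum_congr rfl fun j _ => ?_
  simp only [smul_smul]
  rw [← Finset.sum_smul]
  congr 1
  exact (sum_crd (fun p => (B.form p (bas K V j).1).flip (bas K V j).2) u).symm

theorem form_swap (B : InnerProd K V) (u v : Letter V) :
    B.form u.1 v.1 u.2 v.2 = -sgn K (par v) * B.form v.1 u.1 v.2 u.2 := by
  by_cases h : u.1 = v.1
  · have hs : sgn K (u.1 * v.1) = -sgn K (par v) := by
      rw [h, par]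
      rcases zmod2_cases v.1 with h' | h' <;> rw [h']
      · simp [sgn]
      · have : (1 + 1 : ZMod 2) = 0 := by decide
        simp [sgn, this]
    rw [B.symm, hs]
  · rw [B.even _ _ _ _ h, B.even _ _ _ _ (Ne.symm h)]; simp

theorem sum_lower_swap (B : InnerProd K V) (c : Flavour) (v : Letter V) :
    ∑ i : Idx K V, B.form (bas K V i).1 v.1 (bas K V i).2 v.2 • Alg.gen c (crd K V i)
      = -sgn K (par v) • B.lower c v := by
  rw [InnerProd.lower, gen_expand c (fun q => B.form v.1 q v.2), Finset.smul_sum]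
  refine Finset.sum_congr rfl fun i _ => ?_
  rw [smul_smul, form_swap]

variable [CharZero K]

theorem der_eq {c : Flavour} {d : ZMod 2} {D E : Module.End K (Alg K V c)}
    (hD : ∀ f g : Alg K V c, D (f * g) = D f * g + f.twist d * D g)
    (hE : ∀ f g : Alg K V c, E (f * g) = E f * g + f.twist d * E g)
    (h : ∀ φ, D (Alg.gen c φ) = E (Alg.gen c φ)) : D = E := by
  rw [← sub_eq_zero]
  refine leibniz_unique (d := d) (fun f g => ?_) fun φ => ?_
  · simp only [LinearMap.sub_apply, hD, hE, sub_mul, mul_sub]; abel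
  · rw [LinearMap.sub_apply, h, sub_self]

theorem der_formula {c : Flavour} {d : ZMod 2} {D : Module.End K (Alg K V c)}
    (hD : D ∈ Der K V c d) :
    D = vf (bas K V) (fun i => D (Alg.gen c (crd K V i))) d := by
  refine der_eq (d := d) hD.2.1 (vf_leibniz _ _ _ fun i => hD.1 _ _ (crd_homog c i)) fun φ => ?_
  rw [vf_gen]
  conv_lhs => rw [gen_expand, map_sum]
  exact Finset.sum_congr rfl fun i _ => map_smul _ _ _

/-! Closure under the commutator: tensor case. The derivation is cyclic if and only if it kills the
inner product, viewed as a quadratic element. -/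

/-- The inner product as a quadratic element. -/
noncomputable def InnerProd.omega (B : InnerProd K V) : Alg K V .ass :=
  ∑ i : Idx K V, Alg.gen .ass (crd K V i) * B.lower .ass (bas K V i)

theorem catSum_last {F : List (Letter V) → List (Letter V) → K}
    (hF : ∀ a b, b.length ≠ 1 → F a b = 0) (w : List (Letter V)) (v : Letter V) :
    catSum F (w ++ [v]) = F w [v] := by
  induction w generalizing F with
  | nil => simp [catSum, hF]
  | cons u w ih =>
    rw [List.cons_append, catSum, ih fun a b h => hF _ _ h, hF _ _ (by simp), zero_add]

theorem mul_gen_last (f : Alg K V .ass) (φ : ∀ p, V p →ₗ[K] K) (w : List (Letter V))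
    (v : Letter V) : (f * Alg.gen .ass φ).1 (w ++ [v]) = f.1 w * φ v.1 v.2 := by
  refine catSum_last (F := fun a b => f.1 a * (Alg.gen .ass φ).1 b) (fun a b h => ?_) w v
  rcases b with _ | ⟨u, _ | ⟨u', b⟩⟩
  · show f.1 a * 0 = 0
    simp
  · exact absurd rfl h
  · show f.1 a * 0 = 0
    simp

theorem gen_mul_first (f : Alg K V .ass) (φ : ∀ p, V p →ₗ[K] K) (w : List (Letter V))
    (u : Letter V) : (Alg.gen .ass φ * f).1 (u :: w) = φ u.1 u.2 * f.1 w := by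
  have h := catSum_euler (K := K) (fun w => match w with | [] => 0 | v :: w => φ v.1 v.2 * f.1 w) u w
  refine Eq.trans ?_ h
  show catSum _ _ = catSum _ _
  congr 1; funext a b
  rcases a with _ | ⟨v, _ | ⟨v', a⟩⟩ <;> simp [Alg.gen]

theorem twist_gen (c : Flavour) (d : ZMod 2) (i : Idx K V) :
    (Alg.gen c (crd K V i)).twist d = sgn K (d * par (bas K V i)) • Alg.gen c (crd K V i) := by
  apply Subtype.ext; funext w
  show sgn K (d * wpar w) * (Alg.gen c (crd K V i)).1 w = sgn K _ * (Alg.gen c (crd K V i)).1 w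
  by_cases h : wpar w = par (bas K V i)
  · rw [h]
  · rw [crd_homog c i w h]; simp

theorem crd_sgn (d : ZMod 2) (i : Idx K V) (u : Letter V) :
    sgn K (d * par (bas K V i)) * crd K V i u.1 u.2 = sgn K (d * par u) * crd K V i u.1 u.2 := by
  by_cases h : u.1 = i.1
  · have : par (bas K V i) = par u := by rw [par, par, h]; rfl
    rw [this]
  · rw [crd_parity i u.1 h]; simp

theorem omega_apply (B : InnerProd K V) {d : ZMod 2} {D : Module.End K (Alg K V .ass)}
    (hD : D ∈ Der K V .ass d) (w : List (Letter V)) (v : Letter V) :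
    (D B.omega).1 (w ++ [v])
      = B.tensor d D (w ++ [v]) - sgn K (par v * wpar w) * B.tensor d D (v :: w) := by
  have e : D B.omega = ∑ i : Idx K V, D (Alg.gen .ass (crd K V i)) * B.lower .ass (bas K V i)
      + ∑ i : Idx K V, sgn K (d * par (bas K V i)) •
          (Alg.gen .ass (crd K V i) * D (B.lower .ass (bas K V i))) := by
    rw [InnerProd.omega, map_sum, ← Finset.sum_add_distrib]
    refine Finset.sum_congr rfl fun i _ => ?_
    rw [hD.2.1, twist_gen, smul_mul_assoc]
  have e1 : (∑ i : Idx K V, D (Alg.gen .ass (crd K V i)) * B.lower .ass (bas K V i)).1 (w ++ [v])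
      = - (sgn K (par v * wpar w) * B.tensor d D (v :: w)) := by
    rw [AddSubmonoidClass.coe_finsetSum, Finset.sum_apply]
    have : ∀ i : Idx K V, (D (Alg.gen .ass (crd K V i)) * B.lower .ass (bas K V i)).1 (w ++ [v])
        = (B.form (bas K V i).1 v.1 (bas K V i).2 v.2 • D (Alg.gen .ass (crd K V i))).1 w := by
      intro i
      rw [InnerProd.lower, mul_gen_last]
      exact mul_comm _ _
    simp only [this]
    rw [← Finset.sum_apply, ← AddSubmonoidClass.coe_finsetSum]
    have h2 : ∑ i : Idx K V, B.form (bas K V i).1 v.1 (bas K V i).2 v.2 •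
        D (Alg.gen .ass (crd K V i)) = -sgn K (par v) • D (B.lower .ass v) := by
      rw [← map_smul, ← sum_lower_swap, map_sum]
      exact Finset.sum_congr rfl fun i _ => (map_smul _ _ _).symm
    rw [h2]
    show -sgn K (par v) * (D (B.lower .ass v)).1 w
      = -(sgn K (par v * wpar w) * (sgn K (d * par v) * (D (B.lower .ass v)).1 w))
    by_cases h : wpar w = d + par v
    · rw [h, mul_add, sgn_add, mul_comm (par v) d]
      have hs := sgn_sq K (d * par v)
      have hv : par v * par v = par v := by rcases zmod2_cases (par v) with h | h <;> rw [h] <;> rfl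
      rw [hv]
      linear_combination (sgn K (par v) * (D (B.lower .ass v)).1 w) * hs
    · rw [hD.1 _ _ (lower_homog B .ass v) w h]; simp
  have e2 : ∀ u x, (∑ i : Idx K V, sgn K (d * par (bas K V i)) •
      (Alg.gen .ass (crd K V i) * D (B.lower .ass (bas K V i)))).1 (u :: x)
      = B.tensor d D (u :: x) := by
    intro u x
    rw [AddSubmonoidClass.coe_finsetSum, Finset.sum_apply]
    have : ∀ i : Idx K V, (sgn K (d * par (bas K V i)) •
        (Alg.gen .ass (crd K V i) * D (B.lower .ass (bas K V i)))).1 (u :: x)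
        = (sgn K (d * par u) • crd K V i u.1 u.2 • D (B.lower .ass (bas K V i))).1 x := by
      intro i
      show sgn K _ * (Alg.gen .ass (crd K V i) * D (B.lower .ass (bas K V i))).1 (u :: x)
        = sgn K _ * (crd K V i u.1 u.2 * (D (B.lower .ass (bas K V i))).1 x)
      rw [gen_mul_first, ← mul_assoc, crd_sgn, mul_assoc]
    simp only [this]
    rw [← Finset.sum_apply, ← AddSubmonoidClass.coe_finsetSum, ← Finset.smul_sum]
    have h2 : ∑ i : Idx K V, crd K V i u.1 u.2 • D (B.lower .ass (bas K V i))
        = D (B.lower .ass u) := by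
      conv_rhs => rw [sum_lower, map_sum]
      exact Finset.sum_congr rfl fun i _ => (map_smul _ _ _).symm
    rw [h2]; rfl
  have e2' : (∑ i : Idx K V, sgn K (d * par (bas K V i)) •
      (Alg.gen .ass (crd K V i) * D (B.lower .ass (bas K V i)))).1 (w ++ [v])
      = B.tensor d D (w ++ [v]) := by
    rcases w with _ | ⟨u, w⟩
    · exact e2 v []
    · exact e2 u (w ++ [v])
  rw [e]
  show (∑ i : Idx K V, D (Alg.gen .ass (crd K V i)) * B.lower .ass (bas K V i)).1 (w ++ [v])
    + (∑ i : Idx K V, sgn K (d * par (bas K V i)) •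
      (Alg.gen .ass (crd K V i) * D (B.lower .ass (bas K V i)))).1 (w ++ [v]) = _
  rw [e1, e2']; ring

theorem omega_nil (B : InnerProd K V) {d : ZMod 2} {D : Module.End K (Alg K V .ass)}
    (hD : D ∈ Der K V .ass d) : (D B.omega).1 [] = 0 := by
  have h : B.omega ∈ Alg.fil K V .ass (1 + 1) :=
    Submodule.sum_mem _ fun i _ => Alg.mul_fil (Alg.gen_fil _) (Alg.gen_fil _)
  exact leibniz_fil hD.2.1 1 _ h [] (by simp)

theorem cyclic_iff_omega (B : InnerProd K V) {d : ZMod 2} {D : Module.End K (Alg K V .ass)}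
    (hD : D ∈ Der K V .ass d) : D ∈ CDer .ass B d ↔ D B.omega = 0 := by
  constructor
  · rintro ⟨-, h⟩
    apply Subtype.ext; funext w
    rcases List.eq_nil_or_concat w with rfl | ⟨w, v, rfl⟩
    · exact omega_nil B hD
    · rw [List.concat_eq_append, omega_apply B hD, h v w, ← mul_assoc, sgn_sq, one_mul, sub_self]
      rfl
  · intro h
    refine ⟨hD, fun u w => ?_⟩
    have := omega_apply B hD w u
    rw [h] at this
    have hs := sgn_sq K (par u * wpar w)
    have h0 : (0 : Alg K V .ass).1 (w ++ [u]) = 0 := rfl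
    rw [h0] at this
    linear_combination (sgn K (par u * wpar w)) * this - B.tensor d D (u :: w) * hs

theorem cder_bracket_ass (B : InnerProd K V) {d e : ZMod 2} {D E : Module.End K (Alg K V .ass)}
    (hD : D ∈ CDer .ass B d) (hE : E ∈ CDer .ass B e) :
    D * E - sgn K (d * e) • (E * D) ∈ CDer .ass B (d + e) := by
  rw [cyclic_iff_omega B (der_bracket hD.1 hE.1)]
  have h1 := (cyclic_iff_omega B hD.1).1 hD
  have h2 := (cyclic_iff_omega B hE.1).1 hE
  simp [h1, h2]

/-! Closure under the commutator: symmetric case. -/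

/-- Insert `u` as first argument. -/
def Alg.shift {c : Flavour} (u : Letter V) (f : Alg K V c) : Alg K V c :=
  ⟨fun w => f.1 (u :: w), shift_mem f.2 u⟩

theorem shift_mul (u : Letter V) (f g : Alg K V .com) :
    (f * g).shift u = f.shift u * g + f.twist (par u) * g.shift u := by
  apply Subtype.ext; funext w
  have add : ∀ (F G : List (Letter V) → List (Letter V) → K) (w : List (Letter V)),
    shSum (fun x y => F x y + G x y) w = shSum F w + shSum G w := conv_add .com
  show shSum (fun a b => f.1 a * g.1 b) (u :: w) = shSum (fun a b => f.1 (u :: a) * g.1 b) w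
    + shSum (fun a b => sgn K (par u * wpar a) * f.1 a * g.1 (u :: b)) w
  rw [← add, shSum]
  congr 1; funext a b; ring

theorem shift_homog {c : Flavour} {t : ZMod 2} {f : Alg K V c} (hf : f.IsHomog t) (u : Letter V) :
    Alg.IsHomog (par u + t) (f.shift u) := by
  intro w hw
  refine hf (u :: w) fun h => hw ?_
  rw [← h, wpar, ← add_assoc, CharTwo.add_self_eq_zero, zero_add]

theorem twist_homog {c : Flavour} {t : ZMod 2} {f : Alg K V c} (hf : f.IsHomog t) (s : ZMod 2) :
    f.twist s = sgn K (s * t) • f := by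
  apply Subtype.ext; funext w
  show sgn K (s * wpar w) * f.1 w = sgn K (s * t) * f.1 w
  by_cases h : wpar w = t
  · rw [h]
  · rw [hf w h]; simp

theorem shift_sum (u : Letter V) (f : Idx K V → Alg K V .com) :
    (∑ i, f i).shift u = ∑ i, (f i).shift u := by
  apply Subtype.ext; funext w
  show (∑ i, f i : Alg K V .com).1 (u :: w) = (∑ i, (f i).shift u : Alg K V .com).1 w
  rw [AddSubmonoidClass.coe_finsetSum, Finset.sum_apply, AddSubmonoidClass.coe_finsetSum,
    Finset.sum_apply]
  rfl

theorem vf_com_apply (e : Idx K V → Letter V) (F : Idx K V → Alg K V .com) (d : ZMod 2)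
    (f : Alg K V .com) : vf e F d f = ∑ i, F i * f.shift (e i) := by
  apply Subtype.ext; funext w
  rw [AddSubmonoidClass.coe_finsetSum, Finset.sum_apply]
  exact conv_sum .com Finset.univ (fun i a b => (F i).1 a * f.1 (e i :: b)) w

theorem cder_shift (B : InnerProd K V) {d : ZMod 2} {D : Module.End K (Alg K V .com)}
    (hD : D ∈ CDer .com B d) (u v : Letter V) :
    (D (B.lower .com u)).shift v
      = sgn K (d * par u + d * par v + par u * par v) • (D (B.lower .com v)).shift u := by
  apply Subtype.ext; funext w
  show (D (B.lower .com u)).1 (v :: w) = _ * (D (B.lower .com v)).1 (u :: w)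
  have h := hD.2 u (v :: w)
  rw [List.cons_append] at h
  simp only [InnerProd.tensor] at h
  rw [end_to_front (D (B.lower .com v)).2, wpar, mul_add, sgn_add] at h
  have s1 := sgn_sq K (d * par u)
  have s2 := sgn_sq K (par u * wpar w)
  rw [sgn_add, sgn_add]
  linear_combination sgn K (d * par u) * h - (D (B.lower .com u)).1 (v :: w) * s1
    + sgn K (d * par u) * sgn K (d * par v) * sgn K (par u * par v)
      * (D (B.lower .com v)).1 (u :: w) * s2

theorem mem_cder_of_symm (B : InnerProd K V) {d : ZMod 2} {D : Module.End K (Alg K V .com)}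
    (hD : D ∈ Der K V .com d) (H : Alg K V .com)
    (h : ∀ u, H.shift u = sgn K (d * par u) • D (B.lower .com u)) : D ∈ CDer .com B d := by
  have hH : ∀ u w, B.tensor d D (u :: w) = H.1 (u :: w) := fun u w =>
    (congrFun (congrArg Subtype.val (h u)) w).symm
  refine ⟨hD, fun u w => ?_⟩
  have : B.tensor d D (w ++ [u]) = H.1 (w ++ [u]) := by
    rcases w with _ | ⟨v, w⟩
    · exact hH u []
    · exact hH v (w ++ [u])
  rw [this, hH, end_to_front H.2, ← mul_assoc, sgn_sq, one_mul]

theorem cder_bracket_com (B : InnerProd K V) {d e : ZMod 2} {D E : Module.End K (Alg K V .com)}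
    (hD : D ∈ CDer .com B d) (hE : E ∈ CDer .com B e) :
    D * E - sgn K (d * e) • (E * D) ∈ CDer .com B (d + e) := by
  refine mem_cder_of_symm B (der_bracket hD.1 hE.1)
    (∑ i : Idx K V, sgn K (e * par (bas K V i)) •
      (D (Alg.gen .com (crd K V i)) * E (B.lower .com (bas K V i)))) fun u => ?_
  have hf : ∀ {d : ZMod 2} {D : Module.End K (Alg K V .com)}, D ∈ CDer .com B d → ∀ f,
      D f = ∑ i : Idx K V, D (Alg.gen .com (crd K V i)) * f.shift (bas K V i) := by
    intro d D hD f
    conv_lhs => rw [der_formula hD.1]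
    rw [vf_com_apply]
  have sm : ∀ (a : K) (f : Alg K V .com), (a • f).shift u = a • f.shift u := fun a f => rfl
  rw [shift_sum]
  simp only [sm, shift_mul, smul_add, Finset.sum_add_distrib]
  rw [LinearMap.sub_apply, LinearMap.smul_apply, Module.End.mul_apply, Module.End.mul_apply,
    hf hD (E _), hf hE (D _), smul_sub, sub_eq_add_neg, add_comm]
  congr 1
  · rw [Finset.smul_sum]
    refine Finset.sum_congr rfl fun i _ => ?_
    rw [twist_homog (hD.1.1 _ _ (crd_homog .com i)), cder_shift B hE u (bas K V i),
      smul_mul_assoc, mul_smul_comm, smul_smul, smul_smul, ← sgn_add, ← sgn_add]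
    congr 2
    have key : ∀ d e s t : ZMod 2,
        e * t + s * (d + t) = (d + e) * s + (e * s + e * t + s * t) := by decide
    exact key _ _ _ _
  · have h1 : ∀ i : Idx K V, E (B.lower .com (bas K V i)) = ∑ j : Idx K V,
        B.form (bas K V i).1 (bas K V j).1 (bas K V i).2 (bas K V j).2
          • E (Alg.gen .com (crd K V j)) := by
      intro i
      rw [InnerProd.lower]
      conv_lhs => rw [gen_expand, map_sum]
      exact Finset.sum_congr rfl fun i _ => map_smul _ _ _
    have h2 : ∀ j : Idx K V, ∑ i : Idx K V, (sgn K (e * par (bas K V i)) *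
        B.form (bas K V i).1 (bas K V j).1 (bas K V i).2 (bas K V j).2)
          • (D (Alg.gen .com (crd K V i))).shift u
        = (sgn K (e * par (bas K V j)) * -sgn K (par (bas K V j)))
          • (D (B.lower .com (bas K V j))).shift u := by
      intro j
      rw [mul_smul, ← sm, ← map_smul, ← sum_lower_swap, map_sum, shift_sum, Finset.smul_sum]
      refine Finset.sum_congr rfl fun i _ => ?_
      rw [map_smul, sm, smul_smul]
      congr 1
      by_cases h : (bas K V i).1 = (bas K V j).1
      · rw [show par (bas K V i) = par (bas K V j) by rw [par, par, h]]
      · rw [B.even _ _ _ _ h]; simp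
    simp only [h1, Finset.mul_sum, Finset.smul_sum, mul_smul_comm, smul_smul]
    rw [Finset.sum_comm, ← Finset.sum_neg_distrib]
    refine Finset.sum_congr rfl fun j _ => ?_
    simp only [← smul_mul_assoc]
    rw [← Finset.sum_mul, h2, cder_shift B hD (bas K V j) u]
    have hc := Alg.mul_comm_sgn
      (shift_homog (hD.1.1 _ _ (lower_homog B .com u)) (bas K V j))
      (hE.1.1 _ _ (crd_homog .com j))
    rw [smul_smul, smul_mul_assoc, hc, smul_smul, smul_mul_assoc, ← neg_smul]
    congr 1
    have key : ∀ d e s t : ZMod 2,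
        e * t + t + (d * t + d * s + t * s) + (t + (d + s)) * (e + t) = (d + e) * s + d * e := by
      decide
    rw [← sgn_add, ← key d e (par u) (par (bas K V j))]
    simp only [sgn_add]
    ring

end Closure

section Closed

variable [∀ p, Module.Finite K (V p)] [CharZero K]

theorem cder_bracket {c : Flavour} (B : InnerProd K V) {d e : ZMod 2}
    {D E : Module.End K (Alg K V c)} (hD : D ∈ CDer c B d) (hE : E ∈ CDer c B e) :
    D * E - sgn K (d * e) • (E * D) ∈ CDer c B (d + e) := by
  cases c
  · exact cder_bracket_ass B hD hE
  · exact cder_bracket_com B hD hE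

theorem cder0_bracket {c : Flavour} (B : InnerProd K V) {d e : ZMod 2}
    {D E : Module.End K (Alg K V c)} (hD : D ∈ CDer0 c B d) (hE : E ∈ CDer0 c B e) :
    D * E - sgn K (d * e) • (E * D) ∈ CDer0 c B (d + e) :=
  ⟨cder_bracket B hD.1 hE.1, fun f hf => sub_mem (hD.2 _ (hE.2 f hf))
    (Submodule.smul_mem _ _ (hE.2 _ (hD.2 f hf)))⟩

end Closed

/-! Direct sums and trivial extensions. -/

section Ext

variable {W : ZMod 2 → Type*} [∀ p, AddCommGroup (W p)] [∀ p, Module K (W p)]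

/-- The direct sum of superspaces. -/
abbrev DSum (V W : ZMod 2 → Type*) : ZMod 2 → Type _ := fun p => V p × W p

/-- The orthogonal direct sum of inner product spaces. -/
def InnerProd.dsum (B : InnerProd K V) (C : InnerProd K W) : InnerProd K (DSum V W) where
  form p q := (B.form p q).compl₁₂ (LinearMap.fst K (V p) (W p)) (LinearMap.fst K (V q) (W q))
    + (C.form p q).compl₁₂ (LinearMap.snd K (V p) (W p)) (LinearMap.snd K (V q) (W q))
  even p q x y h := by simp [B.even p q _ _ h, C.even p q _ _ h]
  symm p q x y := by
    simp only [LinearMap.add_apply, LinearMap.compl₁₂_apply, LinearMap.fst_apply,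
      LinearMap.snd_apply]
    rw [B.symm, C.symm]; ring
  nondeg p x h := by
    refine Prod.ext (B.nondeg p x.1 fun q y => ?_) (C.nondeg p x.2 fun q y => ?_)
    · simpa using h q (y, 0)
    · simpa using h q (0, y)

/-- Projection to the first summand. -/
def prL (u : Letter (DSum V W)) : Letter V := ⟨u.1, u.2.1⟩

variable (W) in
/-- Inclusion of the first summand. -/
def inL (u : Letter V) : Letter (DSum V W) := ⟨u.1, (u.2, 0)⟩

theorem wpar_map (w : List (Letter (DSum V W))) : wpar (w.map prL) = wpar w := by
  induction w with
  | nil => rfl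
  | cons u w ih => rw [List.map_cons, wpar, wpar, ih]; rfl

variable (W) in
/-- The algebra map `T̂ΠV* → T̂Π(V ⊕ W)*` (or the same with `Ŝ`) induced by the projection to `V`. -/
def Alg.pull {c : Flavour} (f : Alg K V c) : Alg K (DSum V W) c :=
  ⟨fun w => f.1 (w.map prL), by
    refine ⟨fun l r p a x y => ?_, fun h l r u v => ?_⟩
    · simpa [prL] using f.2.1 (l.map prL) (r.map prL) p a x.1 y.1
    · simp only [List.map_append, List.map_cons]
      exact f.2.2 h (l.map prL) (r.map prL) (prL u) (prL v)⟩

variable [∀ p, Module.Finite K (V p)]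

variable (W) in
/-- The trivial extension of a derivation: it sends a linear form `φ` on `Π(V ⊕ W)` to the image
of `D (φ|V)`; thus it agrees with `D` on `ΠV*` and vanishes on `ΠW*`. See `extDer_gen`. -/
noncomputable def extDer {c : Flavour} (d : ZMod 2) (D : Module.End K (Alg K V c)) :
    Module.End K (Alg K (DSum V W) c) :=
  vf (fun i : Idx K V => inL W (bas K V i)) (fun i => Alg.pull W (D (Alg.gen c (crd K V i)))) d

theorem pull_lin {c : Flavour} (φ : Idx K V → K) (f : Idx K V → Alg K V c) :
    ∑ i, φ i • Alg.pull W (f i) = Alg.pull W (∑ i, φ i • f i) := by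
  apply Subtype.ext; funext w
  show _ = (∑ i, φ i • f i : Alg K V c).1 (w.map prL)
  rw [AddSubmonoidClass.coe_finsetSum, Finset.sum_apply, AddSubmonoidClass.coe_finsetSum,
    Finset.sum_apply]
  rfl

/-- The extension agrees with `D` on `ΠV*` and vanishes on `ΠW*`. -/
theorem extDer_gen {c : Flavour} (d : ZMod 2) (D : Module.End K (Alg K V c))
    (φ : ∀ p, DSum V W p →ₗ[K] K) :
    extDer W d D (Alg.gen c φ)
      = Alg.pull W (D (Alg.gen c fun p => φ p ∘ₗ LinearMap.inl K (V p) (W p))) := by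
  rw [extDer, vf_gen, pull_lin, gen_expand c fun p => φ p ∘ₗ LinearMap.inl K (V p) (W p), map_sum]
  congr 1
  exact Finset.sum_congr rfl fun i _ => (map_smul _ _ _).symm

variable [CharZero K] [∀ p, Module.Finite K (W p)]

theorem extDer_leibniz {c : Flavour} {d : ZMod 2} {D : Module.End K (Alg K V c)}
    (hD : D ∈ Der K V c d) : extDer W d D ∈ Der K (DSum V W) c d := by
  refine vf_mem_der _ _ d fun i w hw => ?_
  show (D (Alg.gen c (crd K V i))).1 (w.map prL) = 0
  refine hD.1 _ _ (crd_homog c i) _ ?_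
  rw [wpar_map]; exact hw

theorem extDer_lower {c : Flavour} (B : InnerProd K V) (C : InnerProd K W) (d : ZMod 2)
    (D : Module.End K (Alg K V c)) (u : Letter (DSum V W)) :
    extDer W d D ((B.dsum C).lower c u) = Alg.pull W (D (B.lower c (prL u))) := by
  rw [InnerProd.lower, extDer_gen, InnerProd.lower]
  congr 3
  funext p
  ext x
  simp [InnerProd.dsum, prL]
  rfl

theorem extDer_mem {c : Flavour} {B : InnerProd K V} {C : InnerProd K W} {d : ZMod 2}
    {D : Module.End K (Alg K V c)} (hD : D ∈ CDer c B d) : extDer W d D ∈ CDer c (B.dsum C) d := by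
  have e : ∀ w, (B.dsum C).tensor d (extDer W d D) w = B.tensor d D (w.map prL) := by
    rintro (_ | ⟨u, w⟩)
    · rfl
    · show _ * (extDer W d D ((B.dsum C).lower c u)).1 w = _
      rw [extDer_lower]; rfl
  refine ⟨extDer_leibniz hD.1, fun u w => ?_⟩
  rw [e, e, List.map_cons, hD.2, List.map_append, wpar_map]; rfl

theorem conv_map (c : Flavour) (F : List (Letter V) → List (Letter V) → K)
    (w : List (Letter (DSum V W))) :
    conv c (fun a b => F (a.map prL) (b.map prL)) w = conv c F (w.map prL) := by
  cases c
  · show catSum _ w = catSum F _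
    induction w generalizing F with
    | nil => rfl
    | cons u w ih =>
      simp only [List.map_cons, catSum]
      rw [← ih fun a b => F (prL u :: a) b]; rfl
  · show shSum _ w = shSum F _
    induction w generalizing F with
    | nil => rfl
    | cons u w ih =>
      simp only [List.map_cons, shSum]
      rw [← ih]
      congr 1; funext a b
      rw [wpar_map]; rfl

theorem extDer_pull {c : Flavour} {d : ZMod 2} {D : Module.End K (Alg K V c)}
    (hD : D ∈ Der K V c d) (f : Alg K V c) : extDer W d D (Alg.pull W f) = Alg.pull W (D f) := by
  conv_rhs => rw [der_formula hD]
  apply Subtype.ext; funext w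
  have hc : ∀ (f : Fn K V), ctr (fun i : Idx K V => inL W (bas K V i))
      (fun i => (Alg.pull W (D (Alg.gen c (crd K V i)))).1) (fun w => f (w.map prL))
      = fun a b => ctr (bas K V) (fun i => (D (Alg.gen c (crd K V i))).1) f (a.map prL)
        (b.map prL) := by
    intro f; rfl
  cases c
  · show vfAss _ _ d w _ = vfAss _ _ d (w.map prL) f.1
    suffices h : ∀ f : Fn K V, vfAss (fun i : Idx K V => inL W (bas K V i))
        (fun i => (Alg.pull W (D (Alg.gen .ass (crd K V i)))).1) d w (fun w => f (w.map prL))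
        = vfAss (bas K V) (fun i => (D (Alg.gen .ass (crd K V i))).1) d (w.map prL) f from h f.1
    induction w with
    | nil => intro f; rfl
    | cons u w ih =>
      intro f
      rw [vfAss, hc, List.map_cons, vfAss, ← ih, ← List.map_cons]
      congr 1
      exact conv_map (K := K) .ass _ (u :: w)
  · show shSum _ w = shSum _ (w.map prL)
    exact conv_map (K := K) .com
      (ctr (bas K V) (fun i => (D (Alg.gen .com (crd K V i))).1) f.1) w

theorem extDer_add {c : Flavour} {d : ZMod 2} {D E : Module.End K (Alg K V c)}
    (hD : D ∈ Der K V c d) (hE : E ∈ Der K V c d) :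
    extDer W d (D + E) = extDer W d D + extDer W d E := by
  refine der_eq (extDer_leibniz (add_mem hD hE)).2.1
    (add_mem (extDer_leibniz hD) (extDer_leibniz hE)).2.1 fun φ => ?_
  rw [LinearMap.add_apply, extDer_gen, extDer_gen, extDer_gen]; rfl

theorem extDer_smul {c : Flavour} {d : ZMod 2} (a : K) {D : Module.End K (Alg K V c)}
    (hD : D ∈ Der K V c d) : extDer W d (a • D) = a • extDer W d D := by
  refine der_eq (extDer_leibniz (Submodule.smul_mem _ a hD)).2.1
    (Submodule.smul_mem _ a (extDer_leibniz hD)).2.1 fun φ => ?_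
  rw [LinearMap.smul_apply, extDer_gen, extDer_gen]; rfl

theorem extDer_bracket {c : Flavour} {d e : ZMod 2} {D E : Module.End K (Alg K V c)}
    (hD : D ∈ Der K V c d) (hE : E ∈ Der K V c e) :
    extDer W (d + e) (D * E - sgn K (d * e) • (E * D)) = extDer W d D * extDer W e E
      - sgn K (d * e) • (extDer W e E * extDer W d D) := by
  refine der_eq (d := d + e) (extDer_leibniz (der_bracket hD hE)).2.1
    (der_bracket (extDer_leibniz hD) (extDer_leibniz hE)).2.1 fun φ => ?_
  rw [extDer_gen]
  simp only [LinearMap.sub_apply, LinearMap.smul_apply, Module.End.mul_apply, extDer_gen,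
    extDer_pull hD, extDer_pull hE]
  rfl

end Ext

end Algebra

/-! Chevalley-Eilenberg complexes. -/

section CE

variable {K : Type*} [Field K]

/-- A Lie superalgebra of operators on a filtered space, with the supercommutator as bracket. The
operators lower the filtration by at most one. Neighbourhoods of zero in the Lie superalgebra are the
sets of operators with image in a given step of the filtration. -/
structure OpLie (K M : Type*) [Field K] [AddCommGroup M] [Module K M] where
  part : ZMod 2 → Submodule K (Module.End K M)
  bracket_mem : ∀ {p q : ZMod 2} {x y : Module.End K M}, x ∈ part p → y ∈ part q →
    x * y - sgn K (p * q) • (y * x) ∈ part (p + q)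
  fil : ℕ → Submodule K M
  fil_succ : ∀ n, fil (n + 1) ≤ fil n
  fil_lower : ∀ {p : ZMod 2} {x : Module.End K M}, x ∈ part p → ∀ n, ∀ m ∈ fil (n + 1), x m ∈ fil n

variable {M : Type*} [AddCommGroup M] [Module K M] {N : Type*} [AddCommGroup N] [Module K N]
  {P : Type*} [AddCommGroup P] [Module K P]

namespace OpLie

/-- Homogeneous elements. -/
abbrev El (g : OpLie K M) : Type _ := Letter fun p => ↥(g.part p)

/-- The supercommutator. -/
def bracket (g : OpLie K M) {p q : ZMod 2} (x : g.part p) (y : g.part q) : g.part (p + q) :=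
  ⟨x.1 * y.1 - sgn K (p * q) • (y.1 * x.1), g.bracket_mem x.2 y.2⟩

/-- The bracket as an odd supersymmetric operation on `Πg`: `(Πx, Πy) ↦ (-1)^|x| Π[x, y]`. -/
def quad (g : OpLie K M) (x y : g.El) : g.El := ⟨x.1 + y.1, sgn K x.1 • g.bracket x.2 y.2⟩

/-- The operator `x` lies in the `n`-th basic neighbourhood of zero. -/
def Small (g : OpLie K M) (n : ℕ) (x : g.El) : Prop := ∀ m : M, x.2.1 m ∈ g.fil n

/-- `CE^n(g) = S^n(Πg*)`: supersymmetric `n`-linear forms on `Πg` that are continuous, that is,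
vanish as soon as one argument lies in some fixed neighbourhood of zero. -/
def cochains (g : OpLie K M) (n : ℕ) : Submodule K (Fn K fun p => ↥(g.part p)) where
  carrier := {ω | ω ∈ algSub K (fun p => ↥(g.part p)) .com ∧ (∀ w, w.length ≠ n → ω w = 0) ∧
    ∃ k, ∀ w, (∃ x ∈ w, g.Small k x) → ω w = 0}
  add_mem' := by
    rintro ω η ⟨h₁, h₂, a, h₃⟩ ⟨k₁, k₂, b, k₃⟩
    refine ⟨add_mem h₁ k₁, fun w hw => ?_, max a b, fun w hw => ?_⟩
    · show ω w + η w = 0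
      rw [h₂ w hw, k₂ w hw, add_zero]
    · have mono : Antitone g.fil := antitone_nat_of_succ_le g.fil_succ
      obtain ⟨x, hx, hs⟩ := hw
      show ω w + η w = 0
      rw [h₃ w ⟨x, hx, fun m => mono (le_max_left a b) (hs m)⟩,
        k₃ w ⟨x, hx, fun m => mono (le_max_right a b) (hs m)⟩, add_zero]
  zero_mem' := ⟨zero_mem _, fun _ _ => rfl, 0, fun _ _ => rfl⟩
  smul_mem' := by
    rintro s ω ⟨h₁, h₂, a, h₃⟩
    refine ⟨Submodule.smul_mem _ _ h₁, fun w hw => ?_, a, fun w hw => ?_⟩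
    · show s * ω w = 0
      rw [h₂ w hw, mul_zero]
    · show s * ω w = 0
      rw [h₃ w hw, mul_zero]

/-- Apply `ω` after bracketing the two letters of the first word. -/
def insertBracket (g : OpLie K M) (ω : Fn K fun p => ↥(g.part p)) : List g.El → List g.El → K
  | [x, y], b => ω (g.quad x y :: b)
  | _, _ => 0

end OpLie

theorem letter_ext (g : OpLie K M) {p q : ZMod 2} (h : p = q) (x : g.part p) (y : g.part q)
    (hxy : x.1 = y.1) : (⟨p, x⟩ : g.El) = ⟨q, y⟩ := by
  subst h
  rw [Subtype.ext hxy]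

theorem quad_left (g : OpLie K M) {ω : Fn K fun p => ↥(g.part p)} (hω : SlotLinear ω)
    (p : ZMod 2) (a : K) (x x' : g.part p) (y : g.El) (b : List g.El) :
    ω (g.quad ⟨p, a • x + x'⟩ y :: b) = a * ω (g.quad ⟨p, x⟩ y :: b) + ω (g.quad ⟨p, x'⟩ y :: b) := by
  have h := hω [] b (p + y.1) a (sgn K p • g.bracket x y.2) (sgn K p • g.bracket x' y.2)
  simp only [List.nil_append] at h
  rw [OpLie.quad, OpLie.quad, OpLie.quad, ← h]
  congr 3
  apply Subtype.ext
  simp only [OpLie.bracket, Submodule.coe_add, Submodule.coe_smul, add_mul, mul_add,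
    smul_mul_assoc, mul_smul_comm, smul_sub, smul_add, smul_smul]
  rw [mul_comm (sgn K (p * y.1)) a, mul_comm a (sgn K p)]
  simp only [mul_assoc, mul_comm a]
  abel

theorem quad_right (g : OpLie K M) {ω : Fn K fun p => ↥(g.part p)} (hω : SlotLinear ω)
    (p : ZMod 2) (a : K) (x : g.El) (y y' : g.part p) (b : List g.El) :
    ω (g.quad x ⟨p, a • y + y'⟩ :: b) = a * ω (g.quad x ⟨p, y⟩ :: b) + ω (g.quad x ⟨p, y'⟩ :: b) := by
  have h := hω [] b (x.1 + p) a (sgn K x.1 • g.bracket x.2 y) (sgn K x.1 • g.bracket x.2 y')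
  simp only [List.nil_append] at h
  rw [OpLie.quad, OpLie.quad, OpLie.quad, ← h]
  congr 3
  apply Subtype.ext
  simp only [OpLie.bracket, Submodule.coe_add, Submodule.coe_smul, add_mul, mul_add,
    smul_mul_assoc, mul_smul_comm, smul_sub, smul_add, smul_smul]
  simp only [mul_assoc, mul_comm a]
  abel

theorem quad_swap (g : OpLie K M) {ω : Fn K fun p => ↥(g.part p)} (hω : SlotLinear ω)
    (x y : g.El) (b : List g.El) :
    ω (g.quad x y :: b) = sgn K (par x * par y) * ω (g.quad y x :: b) := by
  have h := slot_smul hω [] b (y.1 + x.1) (sgn K (par x * par y)) (sgn K y.1 • g.bracket y.2 x.2)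
  simp only [List.nil_append] at h
  rw [OpLie.quad, OpLie.quad, ← h]
  congr 2
  apply letter_ext g (add_comm _ _)
  simp only [OpLie.bracket, Submodule.coe_smul, smul_sub, smul_smul]
  rw [mul_comm y.1 x.1]
  have k1 : sgn K x.1 = -(sgn K (par x * par y) * sgn K y.1 * sgn K (x.1 * y.1)) := by
    rw [par, par]
    have h2 : (1 + 1 : ZMod 2) = 0 := by decide
    rcases zmod2_cases x.1 with h | h <;> rcases zmod2_cases y.1 with h' | h' <;> rw [h, h'] <;>
      simp [sgn, h2]
  have k2 : sgn K x.1 * sgn K (x.1 * y.1) = -(sgn K (par x * par y) * sgn K y.1) := by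
    rw [par, par]
    have h2 : (1 + 1 : ZMod 2) = 0 := by decide
    rcases zmod2_cases x.1 with h | h <;> rcases zmod2_cases y.1 with h' | h' <;> rw [h, h'] <;>
      simp [sgn, h2]
  rw [k2, k1, neg_smul, neg_smul]
  abel

theorem insertBracket_left (g : OpLie K M) {ω : Fn K fun p => ↥(g.part p)}
    (hω : ω ∈ algSub K (fun p => ↥(g.part p)) .com) (b : List g.El) :
    (fun a => g.insertBracket ω a b) ∈ algSub K (fun p => ↥(g.part p)) .com := by
  refine ⟨fun l r p a x y => ?_, fun _ l r u v => ?_⟩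
  · rcases l with _ | ⟨l₁, _ | ⟨l₂, l⟩⟩
    · rcases r with _ | ⟨r₁, _ | ⟨r₂, r⟩⟩
      · simp [OpLie.insertBracket]
      · exact quad_left g hω.1 p a x y r₁ b
      · simp [OpLie.insertBracket]
    · rcases r with _ | ⟨r₁, r⟩
      · exact quad_right g hω.1 p a l₁ x y b
      · simp [OpLie.insertBracket]
    · simp [OpLie.insertBracket]
  · rcases l with _ | ⟨l₁, l⟩
    · rcases r with _ | ⟨r₁, r⟩
      · exact quad_swap g hω.1 u v b
      · simp [OpLie.insertBracket]
    · rcases l with _ | ⟨l₂, l⟩ <;> simp [OpLie.insertBracket]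

theorem insertBracket_right (g : OpLie K M) {ω : Fn K fun p => ↥(g.part p)}
    (hω : ω ∈ algSub K (fun p => ↥(g.part p)) .com) (a : List g.El) :
    g.insertBracket ω a ∈ algSub K (fun p => ↥(g.part p)) .com := by
  rcases a with _ | ⟨x, _ | ⟨y, _ | ⟨z, a⟩⟩⟩
  · exact zero_mem _
  · exact zero_mem _
  · exact shift_mem hω (g.quad x y)
  · exact zero_mem _

theorem shSum_contains {V : ZMod 2 → Type*} (P : Letter V → Prop)
    (F : List (Letter V) → List (Letter V) → K)
    (hF : ∀ a b, (∃ x ∈ a ++ b, P x) → F a b = 0) (w : List (Letter V)) (hw : ∃ x ∈ w, P x) :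
    shSum F w = 0 := by
  induction w generalizing F with
  | nil => simp at hw
  | cons u w ih =>
    rw [shSum]
    obtain ⟨x, hx, hP⟩ := hw
    rcases List.mem_cons.1 hx with rfl | hx
    · have : (fun (a b : List (Letter V)) => F (x :: a) b + sgn K (par x * wpar a) * F a (x :: b))
          = fun _ _ => 0 := by
        funext a b
        rw [hF (x :: a) b ⟨x, by simp, hP⟩, hF a (x :: b) ⟨x, by simp, hP⟩]; simp
      rw [this]
      exact conv_zero .com w
    · refine ih _ (fun a b h => ?_) ⟨x, hx, hP⟩
      obtain ⟨y, hy, hPy⟩ := h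
      rw [hF (u :: a) b ⟨y, by simp at hy ⊢; tauto, hPy⟩,
        hF a (u :: b) ⟨y, by simp at hy ⊢; tauto, hPy⟩]
      simp

theorem shSum_degree {V : ZMod 2 → Type*} (n : ℕ)
    (F : List (Letter V) → List (Letter V) → K)
    (hF : ∀ a b, a.length + b.length ≠ n → F a b = 0) (w : List (Letter V)) (hw : w.length ≠ n) :
    shSum F w = 0 := by
  induction w generalizing F n with
  | nil => exact hF [] [] (by simpa using hw)
  | cons u w ih =>
    rw [shSum]
    rcases n with _ | n
    · have : (fun (a b : List (Letter V)) => F (u :: a) b + sgn K (par u * wpar a) * F a (u :: b))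
          = fun _ _ => 0 := by
        funext a b
        rw [hF (u :: a) b (by simp), hF a (u :: b) (by simp)]; simp
      rw [this]
      exact conv_zero .com w
    · refine ih n _ (fun a b h => ?_) (by simpa using hw)
      rw [hF (u :: a) b (by simp only [List.length_cons]; omega),
        hF a (u :: b) (by simp only [List.length_cons]; omega)]
      simp

theorem small_quad (g : OpLie K M) (n : ℕ) (x y : g.El) (h : g.Small (n + 1) x ∨ g.Small (n + 1) y) :
    g.Small n (g.quad x y) := by
  intro m
  show sgn K x.1 • (x.2.1 (y.2.1 m) - sgn K (x.1 * y.1) • y.2.1 (x.2.1 m)) ∈ g.fil n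
  refine Submodule.smul_mem _ _ (sub_mem ?_ (Submodule.smul_mem _ _ ?_))
  · rcases h with h | h
    · exact g.fil_succ n (h _)
    · exact g.fil_lower x.2.2 n _ (h _)
  · rcases h with h | h
    · exact g.fil_lower y.2.2 n _ (h _)
    · exact g.fil_succ n (h _)

namespace OpLie

/-- The Chevalley-Eilenberg differential `(dω)(x₁, …, xₙ₊₁) = ∑_{i < j} ± ω([xᵢ, xⱼ], …)`, the sum
over all unshuffles of the arguments into a pair and its complement. -/
def diff (g : OpLie K M) (n : ℕ) : g.cochains n →ₗ[K] g.cochains (n + 1) where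
  toFun ω := ⟨shSum (g.insertBracket ω.1), by
    obtain ⟨ω, h₁, h₂, k, h₃⟩ := ω
    refine ⟨conv_mem (c := .com) (insertBracket_left g h₁) (insertBracket_right g h₁), ?_,
      k + 1, fun w hw => ?_⟩
    · refine shSum_degree (n + 1) _ fun a b h => ?_
      rcases a with _ | ⟨x, _ | ⟨y, _ | ⟨z, a⟩⟩⟩
      · rfl
      · rfl
      · refine h₂ _ fun h' => h ?_
        simp only [List.length_cons, List.length_nil] at h' ⊢; omega
      · rfl
    · refine shSum_contains (g.Small (k + 1)) _ (fun a b h => ?_) w hw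
      rcases a with _ | ⟨x, _ | ⟨y, _ | ⟨z, a⟩⟩⟩
      · rfl
      · rfl
      · obtain ⟨z, hz, hs⟩ := h
        simp only [List.cons_append, List.nil_append, List.mem_cons] at hz
        refine h₃ _ ?_
        rcases hz with rfl | rfl | hz
        · exact ⟨_, List.mem_cons_self, small_quad g k _ _ (Or.inl hs)⟩
        · exact ⟨_, List.mem_cons_self, small_quad g k _ _ (Or.inr hs)⟩
        · exact ⟨z, List.mem_cons_of_mem _ hz, fun m => g.fil_succ k (hs m)⟩
      · rfl⟩
  map_add' ω η := by
    apply Subtype.ext; funext w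
    show shSum (g.insertBracket (ω.1 + η.1)) w = shSum _ w + shSum _ w
    have add : ∀ (F G : List g.El → List g.El → K) (w : List g.El),
      shSum (fun x y => F x y + G x y) w = shSum F w + shSum G w := conv_add .com
    rw [← add]
    congr 1; funext a b
    rcases a with _ | ⟨x, _ | ⟨y, _ | ⟨z, a⟩⟩⟩ <;> simp [insertBracket]
  map_smul' s ω := by
    apply Subtype.ext; funext w
    show shSum (g.insertBracket (s • ω.1)) w = s * shSum _ w
    have smul : ∀ (a : K) (F : List g.El → List g.El → K) (w : List g.El),
      shSum (fun x y => a * F x y) w = a * shSum F w := conv_smul .com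
    rw [← smul]
    congr 1; funext a b
    rcases a with _ | ⟨x, _ | ⟨y, _ | ⟨z, a⟩⟩⟩ <;> simp [insertBracket]

/-- `CE_n(g)`, the linear dual of `CE^n(g)`; as a formal space this is `Ŝ^n(Πg)`. -/
abbrev chains (g : OpLie K M) (n : ℕ) : Type _ := Module.Dual K (g.cochains n)

/-- The Chevalley-Eilenberg boundary `CE_{n+1}(g) → CE_n(g)`. -/
def boundary (g : OpLie K M) (n : ℕ) : g.chains (n + 1) →ₗ[K] g.chains n := (g.diff n).dualMap

/-- Continuous even homomorphisms of Lie superalgebras. -/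
structure Hom (g : OpLie K M) (h : OpLie K N) where
  map : ∀ p, g.part p →ₗ[K] h.part p
  map_bracket : ∀ p q (x : g.part p) (y : g.part q),
    map (p + q) (g.bracket x y) = h.bracket (map p x) (map q y)
  cont : ∀ n, ∃ k, ∀ x : g.El, g.Small k x → h.Small n ⟨x.1, map x.1 x.2⟩

/-- Composition. -/
def Hom.comp {g : OpLie K M} {h : OpLie K N} {k : OpLie K P} (ψ : h.Hom k) (φ : g.Hom h) :
    g.Hom k where
  map p := ψ.map p ∘ₗ φ.map p
  map_bracket p q x y := by simp [φ.map_bracket, ψ.map_bracket]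
  cont n := by
    obtain ⟨a, ha⟩ := ψ.cont n
    obtain ⟨b, hb⟩ := φ.cont a
    exact ⟨b, fun x hx => ha _ (hb x hx)⟩

/-- Action on homogeneous elements. -/
def Hom.el {g : OpLie K M} {h : OpLie K N} (φ : g.Hom h) (x : g.El) : h.El := ⟨x.1, φ.map x.1 x.2⟩

/-- The induced map on cochains. -/
def Hom.pullback {g : OpLie K M} {h : OpLie K N} (φ : g.Hom h) (n : ℕ) :
    h.cochains n →ₗ[K] g.cochains n where
  toFun ω := ⟨fun w => ω.1 (w.map φ.el), by
    obtain ⟨ω, h₁, h₂, k, h₃⟩ := ω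
    refine ⟨⟨fun l r p a x y => ?_, fun _ l r u v => ?_⟩, fun w hw => h₂ _ (by simpa using hw), ?_⟩
    · have := h₁.1 (l.map φ.el) (r.map φ.el) p a (φ.map p x) (φ.map p y)
      simpa [Hom.el] using this
    · have := h₁.2 rfl (l.map φ.el) (r.map φ.el) (φ.el u) (φ.el v)
      simp only [List.map_append, List.map_cons]
      exact this
    · obtain ⟨j, hj⟩ := φ.cont k
      refine ⟨j, fun w ⟨x, hx, hs⟩ => h₃ _ ⟨φ.el x, List.mem_map_of_mem hx, hj x hs⟩⟩⟩
  map_add' _ _ := rfl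
  map_smul' _ _ := rfl

/-- The induced map on chains. -/
def Hom.push {g : OpLie K M} {h : OpLie K N} (φ : g.Hom h) (n : ℕ) : g.chains n →ₗ[K] h.chains n :=
  (φ.pullback n).dualMap

end OpLie

end CE

section Main

variable {K : Type*} [Field K] [CharZero K]
  {V : ZMod 2 → Type*} [∀ p, AddCommGroup (V p)] [∀ p, Module K (V p)] [∀ p, Module.Finite K (V p)]
  {W : ZMod 2 → Type*} [∀ p, AddCommGroup (W p)] [∀ p, Module K (W p)] [∀ p, Module.Finite K (W p)]

/-- The formal Lie superalgebra `CDer` of cyclic derivations of `T̂ΠV*` or `ŜΠV*`. -/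
def cyc (c : Flavour) (B : InnerProd K V) : OpLie K (Alg K V c) where
  part := CDer c B
  bracket_mem := cder_bracket B
  fil := Alg.fil K V c
  fil_succ _ _ hf w hw := hf w (Nat.lt_succ_of_lt hw)
  fil_lower hx n := leibniz_fil hx.1.2.1 n

/-- The formal Lie superalgebra `CDer⁰` of cyclic derivations without constant term. -/
def cyc0 (c : Flavour) (B : InnerProd K V) : OpLie K (Alg K V c) where
  part := CDer0 c B
  bracket_mem := cder0_bracket B
  fil := Alg.fil K V c
  fil_succ _ _ hf w hw := hf w (Nat.lt_succ_of_lt hw)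
  fil_lower hx n := leibniz_fil hx.1.1.2.1 n

/-- The inclusion of `CDer⁰` in `CDer`. -/
def incl (c : Flavour) (B : InnerProd K V) : (cyc0 c B).Hom (cyc c B) where
  map p := Submodule.inclusion fun _ h => h.1
  map_bracket _ _ _ _ := rfl
  cont n := ⟨n, fun _ h => h⟩

/-- The stabilization map, extension of cyclic derivations of the algebra of `V` to that of
`V ⊕ W` by zero on `W`. -/
noncomputable def stab (c : Flavour) (B : InnerProd K V) (C : InnerProd K W) :
    (cyc c B).Hom (cyc c (B.dsum C)) where
  map p :=
    { toFun := fun D => ⟨extDer W p D.1, extDer_mem D.2⟩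
      map_add' := fun D E => Subtype.ext (extDer_add D.2.1 E.2.1)
      map_smul' := fun a D => Subtype.ext (extDer_smul a D.2.1) }
  map_bracket _ _ D E := Subtype.ext (extDer_bracket D.2.1 E.2.1)
  cont n := ⟨n, fun D hD => vf_fil _ _ _ n (fun _ w hw => hD _ _ (by simpa using hw))⟩

end Main

end CurvedStab

/-! Write `g` for the cyclic derivations attached to `V ⊕ W` and `h` for those attached to `V`
without constant term. Chains are the full linear duals of cochains, so it is enough to prove the
dual statement: every cocycle of `g` of degree `n + 1` becomes a coboundary after restriction to `h`
(`stab_cocycle_exact`). The passage back to chains uses that the range of a dual map is the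
annihilator of the kernel.

Choose `x ≠ 0` in `W 0`, let `e` be the corresponding even vector of `V ⊕ W`, and let `ξ` be a
linear form with `ξ(e) = 1`. The derivation `y = ∂/∂e` is constant, hence cyclic, and it is odd with
`[y, y] = 0`. It lies in `g` because constant terms are allowed there. It commutes with the image of
`h`, since extended derivations do not involve the coordinates of `W`.

Between `h` and `g` lies the subalgebra `g'` of cyclic derivations all of whose values vanish on
words in the single letter `e` (`lineLie`). It contains the image of `h` precisely because elements
of `h` have no constant term. The point of `g'` is that `q = ad y` is contractible on it: there is
an odd operator `σ` with `qσ + σq = 1` (`lineHomotopy_spec`). In terms of cyclic tensors, `q`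
inserts `e` and `σ` multiplies by `ξ`. In the symmetric case this is the Koszul homotopy. In the
tensor case the anticommutator of insertion and multiplication counts the letters off the line, and
one divides by that number first; the number is nonzero on tensors that vanish along the line.

The conclusion is a zigzag (`exact_of_contraction`). Let `ω` be a cocycle of `g`, let `ω_k` be the
restriction to `g'` of `ω` with `y` inserted `k` times, and let `Q` be the action of `q` on cochains
of `g'`. Cartan's formula gives `d ω_{k+1} = -(k+1) Q ω_k` (`dFn_inner_iter`). Contractibility gives
`ker Q = im Q` in positive degree (`OddOp.exact`), and `Q` anticommutes with `d`. Starting from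
`ω_{n+1}`, of degree zero and hence closed, and descending in `k`, one finds `ω_k = (k+1)⁻¹ dκ + Q
κ'` at every stage. For `k = 0` this reads `ω|g' = dκ + Q κ'`, and the last term restricts to zero
on `h` because `q` kills the image of `h`. -/

namespace CurvedStab

/-! ### Operators on letters extended as derivations to forms. -/

section DerExtension

variable {K : Type*} [Field K] {V : ZMod 2 → Type*}

/-- The derivation of the algebra of forms induced by a map `a` of letters of parity `t`:
the sum over all ways to apply `a` to one letter, with Koszul sign. -/
def derExt (t : ZMod 2) (a : Letter V → Letter V) : List (Letter V) → Fn K V → K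
  | [], _ => 0
  | x :: w, f => f (a x :: w) + sgn K (t * par x) * derExt t a w (fun w => f (x :: w))

theorem derExt_lin (t : ZMod 2) (a : Letter V → Letter V) (s : K) (w : List (Letter V)) (f g : Fn K V) :
    derExt t a w (fun w => s * f w + g w) = s * derExt t a w f + derExt t a w g := by
  induction w generalizing f g with
  | nil => simp [derExt]
  | cons u w ih =>
    simp only [derExt]
    rw [ih (fun w => f (u :: w)) (fun w => g (u :: w))]; ring

theorem derExt_add (t : ZMod 2) (a : Letter V → Letter V) (w : List (Letter V)) (f g : Fn K V) :
    derExt t a w (fun w => f w + g w) = derExt t a w f + derExt t a w g := by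
  simpa using derExt_lin t a 1 w f g

theorem derExt_zero (t : ZMod 2) (a : Letter V → Letter V) (w : List (Letter V)) :
    derExt t a w (fun _ => (0 : K)) = 0 := by
  simpa using derExt_lin t a (-1 : K) w (fun _ => 0) (fun _ => 0)

theorem derExt_smul (t : ZMod 2) (a : Letter V → Letter V) (s : K) (w : List (Letter V)) (f : Fn K V) :
    derExt t a w (fun w => s * f w) = s * derExt t a w f := by
  simpa [derExt_zero] using derExt_lin t a s w f (fun _ => 0)

/-- The map `a` changes the parity by `t`. -/
def HasParity (t : ZMod 2) (a : Letter V → Letter V) : Prop := ∀ x, par (a x) = par x + t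

theorem sgn_succ (p : ZMod 2) : sgn K (p + 1) = -sgn K p := by
  have h2 : (1 + 1 : ZMod 2) = 0 := by decide
  rcases zmod2_cases p with h | h <;> rw [h] <;> simp [sgn, h2]

/-- Every summand evaluates the form on a word of parity `wpar w + t`, so the sign factors out with
that shifted parity. -/
theorem derExt_sgn {t : ZMod 2} {a : Letter V → Letter V} (ha : HasParity t a) (s : ZMod 2) (w : List (Letter V))
    (f : Fn K V) :
    derExt t a w (fun w => sgn K (s * wpar w) * f w)
      = sgn K (s * (wpar w + t)) * derExt t a w f := by
  induction w generalizing f with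
  | nil => simp [derExt]
  | cons u w ih =>
    simp only [derExt]
    have e : (fun w => sgn K (s * wpar (u :: w)) * f (u :: w))
        = fun w => sgn K (s * wpar w) * (sgn K (s * par u) * f (u :: w)) := by
      funext w; rw [wpar, mul_add, sgn_add]; ring
    rw [e, ih, derExt_smul]
    simp only [wpar, ha u, mul_add, sgn_add]; ring

/-- Two odd derivations anticommute up to the derivation induced by the anticommutator. -/
theorem derExt_anticomm {a b : Letter V → Letter V} (ha : HasParity 1 a) (hb : HasParity 1 b)
    (P : Fn K V → Prop) (hP : ∀ f, P f → ∀ u, P (fun w => f (u :: w)))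
    (h : ∀ f, P f → ∀ u w, f (a (b u) :: w) + f (b (a u) :: w) = f (u :: w))
    (w : List (Letter V)) (f : Fn K V) (hf : P f) :
    derExt 1 a w (fun w => derExt 1 b w f) + derExt 1 b w (fun w => derExt 1 a w f)
      = w.length * f w := by
  induction w generalizing f with
  | nil => simp [derExt]
  | cons u w ih =>
    have ih' := ih _ (hP f hf u)
    -- Terms in which one operator hits `u` and the other hits `w` occur in both orders with
    -- opposite signs and cancel. What remains is `ab + ba` on `u`, and the induction hypothesis on
    -- `w`.
    simp only [derExt, derExt_add, derExt_smul, ha u, hb u, sgn_succ, one_mul]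
    have hs := sgn_sq K (par u)
    push_cast [List.length_cons]
    have e := h f hf u w
    have ih'' : derExt 1 a w (fun w => derExt 1 b w fun w => f (u :: w))
      + derExt 1 b w (fun w => derExt 1 a w fun w => f (u :: w)) = w.length * f (u :: w) := ih'
    linear_combination e + ih'' + (derExt 1 a w (fun w => derExt 1 b w fun w => f (u :: w))
      + derExt 1 b w (fun w => derExt 1 a w fun w => f (u :: w))) * hs

/-- A derivation applied to a sum over unshuffles. -/
theorem derExt_shSum {t : ZMod 2} {a : Letter V → Letter V} (ha : HasParity t a)
    (F : List (Letter V) → List (Letter V) → K) (w : List (Letter V)) :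
    derExt t a w (shSum F) = shSum (fun x y => derExt t a x (fun x => F x y)
      + sgn K (t * wpar x) * derExt t a y (F x)) w := by
  have add : ∀ (F G : List (Letter V) → List (Letter V) → K) (w : List (Letter V)),
      shSum (fun x y => F x y + G x y) w = shSum F w + shSum G w := conv_add .com
  have smul : ∀ (a : K) (F : List (Letter V) → List (Letter V) → K) (w : List (Letter V)),
      shSum (fun x y => a * F x y) w = a * shSum F w := conv_smul .com
  induction w generalizing F with
  | nil => simp [derExt, shSum]
  | cons u w ih =>
    simp only [derExt, shSum]
    rw [ih, ← smul, ← add]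
    congr 1; funext x y
    -- Acting on `x` changes the Koszul sign of moving `u` past `x`. The extra factor is exactly the
    -- one produced when the operator has to pass `u` in the undivided word.
    have k1 : derExt t a x (fun x => F (u :: x) y + sgn K (par u * wpar x) * F x (u :: y))
        = derExt t a x (fun x => F (u :: x) y)
          + sgn K (par u * (wpar x + t)) * derExt t a x (fun x => F x (u :: y)) := by
      rw [derExt_add, derExt_sgn ha (par u) x (fun x => F x (u :: y))]
    have k2 : derExt t a y (fun y => F (u :: x) y + sgn K (par u * wpar x) * F x (u :: y))
        = derExt t a y (F (u :: x)) + sgn K (par u * wpar x) * derExt t a y (fun y => F x (u :: y)) := by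
      rw [derExt_add, derExt_smul]
    rw [k1, k2, ha u]
    simp only [wpar, mul_add, add_mul, sgn_add]
    have hs := sgn_sq K (t * par u)
    rw [mul_comm (par u) t]
    linear_combination (sgn K (par u * wpar x) * derExt t a x (fun x => F x (u :: y))) * hs

variable [∀ p, AddCommGroup (V p)] [∀ p, Module K (V p)]

/-- A sum over the choices of one letter. -/
theorem shSum_single {t : ZMod 2} {a : Letter V → Letter V} (ha : HasParity t a) (w : List (Letter V)) {f : Fn K V}
    (hf : SuperSymm f) :
    shSum (fun x y => match x with | [u] => f (a u :: y) | _ => 0) w = derExt t a w f := by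
  have unit : ∀ (g : Fn K V) (w : List (Letter V)),
      shSum (fun a b => match a with | [] => g b | _ => 0) w = g w := by
    intro g w
    induction w generalizing g with
    | nil => simp [shSum]
    | cons u w ih =>
      simp only [shSum]
      rw [← ih (fun w => g (u :: w))]
      congr 1; funext a b
      rcases a with _ | ⟨v, a⟩ <;> simp [wpar, sgn_zero]
  have add : ∀ (F G : List (Letter V) → List (Letter V) → K) (w : List (Letter V)),
      shSum (fun x y => F x y + G x y) w = shSum F w + shSum G w := conv_add .com
  have smul : ∀ (a : K) (F : List (Letter V) → List (Letter V) → K) (w : List (Letter V)),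
      shSum (fun x y => a * F x y) w = a * shSum F w := conv_smul .com
  induction w generalizing f with
  | nil => simp [shSum, derExt]
  | cons u w ih =>
    simp only [shSum, derExt]
    rw [← ih (f := fun w => f (u :: w)) (fun l r => hf (u :: l) r), ← smul,
      ← unit (fun b => f (a u :: b)) w, ← add]
    congr 1; funext x y
    rcases x with _ | ⟨v, _ | ⟨v', x⟩⟩
    · simp
    -- Here `u` stays in the complement of the chosen letter `v`; supersymmetry brings `u` back in
    -- front of `a v`.
    · have h := hf [] y (a v) u
      simp only [List.nil_append] at h
      simp only [wpar, add_zero, zero_add, h, ha v, add_mul, sgn_add]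
      have hs := sgn_sq K (par u * par v)
      rw [mul_comm (par v) (par u)]
      linear_combination (sgn K (t * par u) * f (u :: a v :: y)) * hs
    · simp

/-- Letters form a sigma type without addition, so linearity of `a` enters as `hl`, through the
values of slot-linear forms. -/
theorem derExt_mem {t : ZMod 2} {a : Letter V → Letter V} (ha : HasParity t a)
    (hl : ∀ f : Fn K V, SlotLinear f → ∀ (p : ZMod 2) (s : K) (x y : V p) (w : List (Letter V)),
      f (a ⟨p, s • x + y⟩ :: w) = s * f (a ⟨p, x⟩ :: w) + f (a ⟨p, y⟩ :: w))
    {f : Fn K V} (hf : f ∈ algSub K V .com) : (fun w => derExt t a w f) ∈ algSub K V .com := by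
  refine ⟨fun l r p s x y => ?_, fun _ l r u v => ?_⟩
  · show derExt t a _ f = s * derExt t a _ f + derExt t a _ f
    induction l generalizing f with
    | nil =>
      simp only [List.nil_append, derExt]
      have e : (fun w => f (⟨p, s • x + y⟩ :: w))
          = fun w => s * f (⟨p, x⟩ :: w) + f (⟨p, y⟩ :: w) := by
        funext w; exact shift_lin hf p s x y w
      rw [e, derExt_lin, hl f hf.1]
      simp only [par]; ring
    | cons u l ih =>
      have h := hf.1 (a u :: l) r p s x y
      simp only [List.cons_append] at h ⊢
      simp only [derExt]
      rw [ih (shift_mem hf u), h]; ring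
  · show derExt t a _ f = _ * derExt t a _ f
    induction l generalizing f with
    | nil =>
      simp only [List.nil_append, derExt]
      have h1 := hf.2 rfl [] r (a u) v
      have h2 := hf.2 rfl [] r u (a v)
      have h3 : (fun w => f (u :: v :: w)) = fun w => sgn K (par u * par v) * f (v :: u :: w) := by
        funext w; exact hf.2 rfl [] w u v
      simp only [List.nil_append] at h1 h2
      rw [h3, derExt_smul, h1, h2, ha, ha]
      simp only [mul_add, add_mul, sgn_add]
      have hs := sgn_sq K (t * par u)
      rw [mul_comm (par u) t]
      linear_combination (sgn K (par u * par v) * f (a v :: u :: r)) * hs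
    | cons t l ih =>
      have h := hf.2 rfl (a t :: l) r u v
      simp only [List.cons_append] at h ⊢
      simp only [derExt]
      rw [ih (shift_mem hf t), h]; ring

end DerExtension

/-! ### Naturality of unshuffle sums and of derivations under parity-preserving maps of letters. -/

section Restriction

variable {K : Type*} [Field K] {V V' : ZMod 2 → Type*}

theorem wpar_map_letter (e : Letter V → Letter V') (he : ∀ x, (e x).1 = x.1)
    (w : List (Letter V)) : wpar (w.map e) = wpar w := by
  induction w with
  | nil => rfl
  | cons u w ih => simp only [List.map_cons, wpar, ih, par, he]

theorem shSum_map (e : Letter V → Letter V') (he : ∀ x, (e x).1 = x.1)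
    (F : List (Letter V') → List (Letter V') → K) (w : List (Letter V)) :
    shSum F (w.map e) = shSum (fun a b => F (a.map e) (b.map e)) w := by
  induction w generalizing F with
  | nil => rfl
  | cons u w ih =>
    simp only [List.map_cons, shSum, ih, wpar_map_letter e he, par, he]

/-- Used to compare the adjoint action on cochains of a Lie superalgebra with the action on cochains
of a stable subalgebra. -/
theorem derExt_map (e : Letter V → Letter V') (he : ∀ x, (e x).1 = x.1)
    (a : Letter V → Letter V) (b : Letter V' → Letter V') (t : ZMod 2) (h : ∀ x, e (a x) = b (e x))
    (f : Fn K V') (w : List (Letter V)) :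
    derExt t b (w.map e) f = derExt t a w (fun w => f (w.map e)) := by
  induction w generalizing f with
  | nil => rfl
  | cons u w ih =>
    simp only [List.map_cons, derExt, ih, h, par, he]

end Restriction

/-! ### Cartan calculus on Chevalley–Eilenberg cochains. -/

section Zigzag

variable {K : Type*} [Field K] {M : Type*} [AddCommGroup M] [Module K M]
  {N : Type*} [AddCommGroup N] [Module K N]

namespace OpLie

/-- The Chevalley-Eilenberg differential on functions of words. -/
def dFn (g : OpLie K M) (ω : Fn K fun p => ↥(g.part p)) : Fn K fun p => ↥(g.part p) :=
  shSum (g.insertBracket ω)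

theorem insertBracket_lin (g : OpLie K M) (s : K) (ω η : Fn K fun p => ↥(g.part p))
    (a b : List g.El) : g.insertBracket (s • ω + η) a b
      = s * g.insertBracket ω a b + g.insertBracket η a b := by
  rcases a with _ | ⟨x, _ | ⟨y, _ | ⟨z, a⟩⟩⟩ <;> simp [insertBracket]

theorem dFn_lin (g : OpLie K M) (s : K) (ω η : Fn K fun p => ↥(g.part p)) :
    g.dFn (s • ω + η) = s • g.dFn ω + g.dFn η := by
  funext w
  show shSum _ w = s * shSum _ w + shSum _ w
  rw [← shSum_lin]
  congr 1; funext a b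
  exact g.insertBracket_lin s ω η a b

theorem dFn_mem (g : OpLie K M) {n : ℕ} {ω : Fn K fun p => ↥(g.part p)} (h : ω ∈ g.cochains n) :
    g.dFn ω ∈ g.cochains (n + 1) := (g.diff n ⟨ω, h⟩).2

/-- A continuous parity reversing linear operator. -/
structure OddOp (g : OpLie K M) where
  map : ∀ p, g.part p →ₗ[K] g.part (1 + p)
  cont : ∀ n, ∃ k, ∀ x : g.El, g.Small k x → g.Small n ⟨1 + x.1, map x.1 x.2⟩

/-- Action on homogeneous elements. -/
def OddOp.el {g : OpLie K M} (a : g.OddOp) (x : g.El) : g.El := ⟨1 + x.1, a.map x.1 x.2⟩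

theorem OddOp.isOdd {g : OpLie K M} (a : g.OddOp) : HasParity 1 a.el := fun x => by
  simp only [par, OddOp.el]; ring

/-- The induced operator on cochains. -/
def OddOp.ext {g : OpLie K M} (a : g.OddOp) (ω : Fn K fun p => ↥(g.part p)) :
    Fn K fun p => ↥(g.part p) := fun w => derExt 1 a.el w ω

theorem OddOp.ext_lin {g : OpLie K M} (a : g.OddOp) (s : K) (ω η : Fn K fun p => ↥(g.part p)) :
    a.ext (s • ω + η) = s • a.ext ω + a.ext η := by
  funext w; exact derExt_lin 1 a.el s w ω η

theorem derExt_degree {V : ZMod 2 → Type*} (t : ZMod 2) (a : Letter V → Letter V) (n : ℕ) (w : List (Letter V))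
    (f : Fn K V) (hf : ∀ w, w.length ≠ n → f w = 0) (hw : w.length ≠ n) : derExt t a w f = 0 := by
  induction w generalizing n f with
  | nil => rfl
  | cons u w ih =>
    rw [derExt, hf _ (by simpa using hw)]
    rcases n with _ | n
    · have : (fun w => f (u :: w)) = fun _ => 0 := by funext w; exact hf _ (by simp)
      rw [this, derExt_zero]; simp
    · rw [ih n _ (fun w h => hf _ (by simpa using h)) (by simpa using hw)]; simp

/-- Continuity of the induced operator: in each summand the small letter of the word either survives
or is replaced by its image, so both must be small enough for `f`. This is why two predicates
appear. -/
theorem derExt_contains {V : ZMod 2 → Type*} (t : ZMod 2) (a : Letter V → Letter V) (P Q : Letter V → Prop)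
    (hPQ : ∀ x, P x → Q x) (ha : ∀ x, P x → Q (a x)) (w : List (Letter V))
    (f : Fn K V) (hf : ∀ w, (∃ x ∈ w, Q x) → f w = 0) (hw : ∃ x ∈ w, P x) :
    derExt t a w f = 0 := by
  induction w generalizing f with
  | nil => rfl
  | cons u w ih =>
    obtain ⟨x, hx, hP⟩ := hw
    rw [derExt]
    rcases List.mem_cons.1 hx with rfl | hx
    · have : (fun w => f (x :: w)) = fun _ => 0 := by
        funext w; exact hf _ ⟨x, List.mem_cons_self, hPQ x hP⟩
      rw [hf _ ⟨a x, List.mem_cons_self, ha x hP⟩, this, derExt_zero]; simp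
    · rw [hf _ ⟨x, List.mem_cons_of_mem _ hx, hPQ x hP⟩, ih _ (fun w h => hf _ ?_) ⟨x, hx, hP⟩]
      · simp
      · obtain ⟨y, hy, hQ⟩ := h
        exact ⟨y, List.mem_cons_of_mem _ hy, hQ⟩

theorem fil_anti (g : OpLie K M) : Antitone g.fil := antitone_nat_of_succ_le g.fil_succ

theorem OddOp.ext_mem {g : OpLie K M} (a : g.OddOp) {n : ℕ} {ω : Fn K fun p => ↥(g.part p)}
    (h : ω ∈ g.cochains n) : a.ext ω ∈ g.cochains n := by
  obtain ⟨h₁, h₂, k, h₃⟩ := h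
  obtain ⟨j, hj⟩ := a.cont k
  refine ⟨derExt_mem a.isOdd (fun f hf p s x y w => ?_) h₁,
    fun w hw => derExt_degree _ _ n w ω h₂ hw, max j k, fun w hw => ?_⟩
  · have := hf [] w (1 + p) s (a.map p x) (a.map p y)
    simpa [OddOp.el] using this
  · refine derExt_contains 1 a.el (g.Small (max j k)) (g.Small k) (fun x hx m => ?_)
      (fun x hx => hj x fun m => ?_) w ω h₃ hw
    · exact g.fil_anti (le_max_right j k) (hx m)
    · exact g.fil_anti (le_max_left j k) (hx m)

/-- A slot-linear form takes equal letters combined linearly to the combination of the values. -/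
theorem slot_comb (g : OpLie K M) {ω : Fn K fun p => ↥(g.part p)} (hω : SlotLinear ω)
    {p q r : ZMod 2} (hp : p = r) (hq : q = r) (s : K) (x : g.part p) (y : g.part q)
    (z : g.part r) (h : s • x.1 + y.1 = z.1) (w : List g.El) :
    s * ω (⟨p, x⟩ :: w) + ω (⟨q, y⟩ :: w) = ω (⟨r, z⟩ :: w) := by
  subst hp hq
  have := hω [] w q s x y
  simp only [List.nil_append] at this
  rw [← this, show s • x + y = z from Subtype.ext h]

/-- The map `a` of letters of parity `t` is a derivation of the odd bracket. -/
def IsDer (g : OpLie K M) (t : ZMod 2) (a : g.El → g.El) : Prop :=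
  ∀ x y : g.El, (g.quad (a x) y).2.1 + sgn K (t * par x) • (g.quad x (a y)).2.1
    = sgn K t • (a (g.quad x y)).2.1

/-- The action on an unshuffle splits into the action on the bracketed pair, where the derivation
property applies, and the action on the complement, where it passes the odd bracket with sign `sgn K
t`. -/
theorem IsDer.comm {g : OpLie K M} {t : ZMod 2} {a : g.El → g.El} (ha : g.IsDer t a)
    (hp : HasParity t a) {ω : Fn K fun p => ↥(g.part p)}
    (hω : ω ∈ algSub K (fun p => ↥(g.part p)) .com) (w : List g.El) :
    derExt t a w (g.dFn ω) = sgn K t * g.dFn (fun w => derExt t a w ω) w := by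
  have add : ∀ (F G : List g.El → List g.El → K) (w : List g.El),
      shSum (fun x y => F x y + G x y) w = shSum F w + shSum G w := conv_add .com
  have smul : ∀ (a : K) (F : List g.El → List g.El → K) (w : List g.El),
      shSum (fun x y => a * F x y) w = a * shSum F w := conv_smul .com
  rw [dFn, dFn, derExt_shSum hp, ← smul]
  congr 1
  funext x b
  rcases x with _ | ⟨x, _ | ⟨y, _ | ⟨z, l⟩⟩⟩
  · have : g.insertBracket ω [] = fun _ => 0 := rfl
    rw [this, derExt_zero]; simp [insertBracket, derExt]
  · have : g.insertBracket ω [x] = fun _ => 0 := rfl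
    rw [this, derExt_zero]; simp [insertBracket, derExt]
  · have e1 : g.insertBracket ω [x, y] = fun b => ω (g.quad x y :: b) := rfl
    have e2 : g.insertBracket (fun w => derExt t a w ω) [x, y] b = ω (a (g.quad x y) :: b)
        + sgn K (t * par (g.quad x y)) * derExt t a b (fun b => ω (g.quad x y :: b)) := rfl
    have e3 : derExt t a [x, y] (fun x => g.insertBracket ω x b)
        = ω (g.quad (a x) y :: b) + sgn K (t * par x) * ω (g.quad x (a y) :: b) := by
      simp [derExt, insertBracket]
    have h2 : (1 + 1 : ZMod 2) = 0 := by decide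
    have e4 : par (g.quad x y) = par x + par y + 1 := by
      simp only [par, quad]; linear_combination -h2
    have hx : ∀ x, (a x).1 = x.1 + t := fun x => by
      have := hp x
      simp only [par] at this
      linear_combination this
    -- The parity labels of the three brackets agree only up to a rewriting in `ZMod 2`, so the
    -- identity of operators supplied by `ha` is transported to values of `ω`.
    have e5 := g.slot_comb hω.1 (p := (g.quad x (a y)).1) (q := (g.quad (a x) y).1)
      (r := (a (g.quad x y)).1) (by rw [hx]; simp only [quad, hx]; ring)
      (by rw [hx]; simp only [quad, hx]; ring) (sgn K (t * par x)) (g.quad x (a y)).2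
      (g.quad (a x) y).2 (sgn K t • (a (g.quad x y)).2)
      (by rw [add_comm, ha x y]; rfl) b
    have e6 := slot_smul hω.1 [] b (a (g.quad x y)).1 (sgn K t) (a (g.quad x y)).2
    simp only [List.nil_append] at e6
    rw [e6] at e5
    have e5' : sgn K (t * par x) * ω (g.quad x (a y) :: b) + ω (g.quad (a x) y :: b)
      = sgn K t * ω (a (g.quad x y) :: b) := e5
    rw [e1, e2, e3, e4]
    simp only [wpar, add_zero, mul_add, mul_one, sgn_add]
    have hs := sgn_sq K t
    linear_combination e5' - (sgn K (t * par x) * sgn K (t * par y)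
      * derExt t a b (fun b => ω (g.quad x y :: b))) * hs
  · have e1 : g.insertBracket ω (x :: y :: z :: l) = fun _ => 0 := rfl
    rw [e1, derExt_zero]
    simp [insertBracket, derExt, derExt_zero]

theorem quad_parity (g : OpLie K M) (u : g.El) : HasParity (par u + 1) (g.quad u) := fun x => by
  have h2 : (1 + 1 : ZMod 2) = 0 := by decide
  simp only [par, quad]; linear_combination -h2

/-- The super Jacobi identity for the commutator of operators, as an odd bracket. -/
theorem jacobi_op (p q r : ZMod 2) (x y z : Module.End K M) :
    sgn K (p + q) • ((sgn K p • (x * y - sgn K (p * q) • (y * x))) * z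
        - sgn K ((p + q) * r) • (z * (sgn K p • (x * y - sgn K (p * q) • (y * x)))))
      + sgn K (p * (q + 1)) • (sgn K q • (y * (sgn K p • (x * z - sgn K (p * r) • (z * x)))
        - sgn K (q * (p + r)) • ((sgn K p • (x * z - sgn K (p * r) • (z * x))) * y)))
      = sgn K p • (sgn K p • (x * (sgn K q • (y * z - sgn K (q * r) • (z * y)))
        - sgn K (p * (q + r)) • ((sgn K q • (y * z - sgn K (q * r) • (z * y))) * x))) := by
  have h2 : (1 + 1 : ZMod 2) = 0 := by decide
  rcases zmod2_cases p with rfl | rfl <;> rcases zmod2_cases q with rfl | rfl <;>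
    rcases zmod2_cases r with rfl | rfl <;> simp [sgn, h2] <;> noncomm_ring

/-- The Jacobi identity. The bracket is odd on `Πg`, so bracketing with `u` has the parity of `u` in
`g` itself. -/
theorem quad_isDer (g : OpLie K M) (u : g.El) : g.IsDer (par u + 1) (g.quad u) := fun x y => by
  have h : par u + 1 = u.1 := by
    have h2 : (1 + 1 : ZMod 2) = 0 := by decide
    simp only [par]; linear_combination h2
  rw [h]
  exact jacobi_op u.1 x.1 y.1 u.2.1 x.2.1 y.2.1

/-- Cartan's formula. -/
theorem dFn_cons (g : OpLie K M) {ω : Fn K fun p => ↥(g.part p)}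
    (hω : ω ∈ algSub K (fun p => ↥(g.part p)) .com) (u : g.El) (w : List g.El) :
    g.dFn ω (u :: w) = sgn K (par u) * g.dFn (fun w => ω (u :: w)) w
      + derExt (par u + 1) (g.quad u) w ω := by
  have add : ∀ (F G : List g.El → List g.El → K) (w : List g.El),
      shSum (fun x y => F x y + G x y) w = shSum F w + shSum G w := conv_add .com
  have smul : ∀ (a : K) (F : List g.El → List g.El → K) (w : List g.El),
      shSum (fun x y => a * F x y) w = a * shSum F w := conv_smul .com
  rw [← shSum_single (g.quad_parity u) w (hω.2 rfl), dFn, dFn, ← smul, ← add, shSum]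
  congr 1; funext a b
  -- Here `a` is the part of the first block drawn from `w`. One letter is the partner of `u` in the
  -- bracket and gives the adjoint action; two letters leave `u` in the complement and give the
  -- differential after insertion of `u`.
  rcases a with _ | ⟨x, _ | ⟨y, _ | ⟨z, l⟩⟩⟩
  · simp [insertBracket]
  · simp [insertBracket]
  · have h := hω.2 rfl [] b (g.quad x y) u
    have e4 : par (g.quad x y) = par x + par y + 1 := by
      have h2 : (1 + 1 : ZMod 2) = 0 := by decide
      simp only [par, quad]; linear_combination -h2
    simp only [List.nil_append] at h
    simp only [insertBracket, h, e4, wpar, add_zero, zero_add]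
    have hs := sgn_sq K (par u * (par x + par y))
    rw [mul_comm (par x + par y + 1), mul_add _ _ 1, mul_one, sgn_add]
    linear_combination (sgn K (par u) * ω (u :: g.quad x y :: b)) * hs
  · simp [insertBracket]

theorem dFn_mem_algSub (g : OpLie K M) {ω : Fn K fun p => ↥(g.part p)}
    (h : ω ∈ algSub K (fun p => ↥(g.part p)) .com) :
    g.dFn ω ∈ algSub K (fun p => ↥(g.part p)) .com :=
  conv_mem (c := .com) (insertBracket_left g h) (insertBracket_right g h)

theorem dFn_add (g : OpLie K M) (ω η : Fn K fun p => ↥(g.part p)) (w : List g.El) :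
    g.dFn (fun w => ω w + η w) w = g.dFn ω w + g.dFn η w := by
  have := congrFun (g.dFn_lin 1 ω η) w
  rw [one_smul, one_smul] at this
  exact this

theorem dFn_zero (g : OpLie K M) : g.dFn (fun _ => 0) = fun _ => 0 := by
  have := g.dFn_lin (-1) 0 0
  simp only [smul_zero, add_zero, neg_smul, one_smul, neg_add_cancel] at this
  exact this

theorem dFn_smul (g : OpLie K M) (s : K) (ω : Fn K fun p => ↥(g.part p)) (w : List g.El) :
    g.dFn (fun w => s * ω w) w = s * g.dFn ω w := by
  have h := congrFun (g.dFn_lin s ω 0) w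
  have h0 : g.dFn (0 : Fn K fun p => ↥(g.part p)) = 0 := g.dFn_zero
  rw [h0, add_zero, add_zero] at h
  exact h

/-- Induction on the number of arguments. By Cartan's formula the first argument contributes two
copies of the differential composed with the adjoint action; they have opposite signs because that
action commutes with the differential up to `sgn K (par u + 1)`. -/
theorem dFn_dFn (g : OpLie K M) {ω : Fn K fun p => ↥(g.part p)}
    (hω : ω ∈ algSub K (fun p => ↥(g.part p)) .com) (w : List g.El) : g.dFn (g.dFn ω) w = 0 := by
  induction w generalizing ω with
  | nil => rfl
  | cons u w ih =>
    have e : (fun w => g.dFn ω (u :: w)) = fun w => sgn K (par u) * g.dFn (fun w => ω (u :: w)) w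
        + derExt (par u + 1) (g.quad u) w ω := by
      funext w; exact g.dFn_cons hω u w
    rw [g.dFn_cons (g.dFn_mem_algSub hω), e, dFn_add, dFn_smul, ih (shift_mem hω u),
      (g.quad_isDer u).comm (g.quad_parity u) hω, sgn_succ]
    ring

end OpLie

end Zigzag

/-! ### From a contraction of the adjoint action to exactness of restricted cocycles. -/

section Zigzag

variable {K : Type*} [Field K] {M : Type*} [AddCommGroup M] [Module K M]
  {N : Type*} [AddCommGroup N] [Module K N] {P : Type*} [AddCommGroup P] [Module K P]

namespace OpLie

theorem Hom.el_quad {g : OpLie K M} {h : OpLie K N} (φ : g.Hom h) (x y : g.El) :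
    φ.el (g.quad x y) = h.quad (φ.el x) (φ.el y) := by
  have h1 : φ.map (x.1 + y.1) (sgn K x.1 • g.bracket x.2 y.2)
      = sgn K x.1 • h.bracket (φ.map x.1 x.2) (φ.map y.1 y.2) := by
    rw [map_smul, φ.map_bracket]
  exact congrArg (Sigma.mk (x.1 + y.1)) h1

/-- Restriction of functions of words along a homomorphism. -/
def Hom.res {g : OpLie K M} {h : OpLie K N} (φ : g.Hom h) (ω : Fn K fun p => ↥(h.part p)) :
    Fn K fun p => ↥(g.part p) := fun w => ω (w.map φ.el)

theorem Hom.res_mem {g : OpLie K M} {h : OpLie K N} (φ : g.Hom h) {n : ℕ}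
    {ω : Fn K fun p => ↥(h.part p)} (hω : ω ∈ h.cochains n) : φ.res ω ∈ g.cochains n :=
  (φ.pullback n ⟨ω, hω⟩).2

theorem Hom.dFn_res {g : OpLie K M} {h : OpLie K N} (φ : g.Hom h)
    (ω : Fn K fun p => ↥(h.part p)) : g.dFn (φ.res ω) = φ.res (h.dFn ω) := by
  funext w
  show shSum (g.insertBracket (φ.res ω)) w = shSum (h.insertBracket ω) (w.map φ.el)
  rw [shSum_map φ.el fun _ => rfl]
  congr 1; funext a b
  rcases a with _ | ⟨x, _ | ⟨y, _ | ⟨z, a⟩⟩⟩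
  · rfl
  · rfl
  · simp [insertBracket, Hom.res, φ.el_quad]
  · rfl

/-- Insertion of a fixed first argument. -/
def inner (g : OpLie K M) (y : g.El) (ω : Fn K fun p => ↥(g.part p)) :
    Fn K fun p => ↥(g.part p) := fun w => ω (y :: w)

theorem inner_mem (g : OpLie K M) (y : g.El) {n : ℕ} {ω : Fn K fun p => ↥(g.part p)}
    (h : ω ∈ g.cochains (n + 1)) : g.inner y ω ∈ g.cochains n := by
  obtain ⟨h₁, h₂, k, h₃⟩ := h
  refine ⟨shift_mem h₁ y, fun w hw => h₂ _ (by simpa using hw), k, fun w hw => h₃ _ ?_⟩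
  obtain ⟨x, hx, hs⟩ := hw
  exact ⟨x, List.mem_cons_of_mem _ hx, hs⟩

theorem inner_iter_mem (g : OpLie K M) (y : g.El) {ω : Fn K fun p => ↥(g.part p)} (k : ℕ) :
    ∀ n, ω ∈ g.cochains (n + k) → (g.inner y)^[k] ω ∈ g.cochains n := by
  induction k with
  | zero => intro n h; exact h
  | succ k ih =>
    intro n h
    rw [Function.iterate_succ_apply']
    exact g.inner_mem y (ih (n + 1) (by rwa [add_assoc, add_comm 1 k]))

theorem inner_iter_mem_algSub (g : OpLie K M) (y : g.El) {ω : Fn K fun p => ↥(g.part p)}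
    (hω : ω ∈ algSub K (fun p => ↥(g.part p)) .com) (k : ℕ) :
    (g.inner y)^[k] ω ∈ algSub K (fun p => ↥(g.part p)) .com := by
  induction k with
  | zero => exact hω
  | succ k ih =>
    rw [Function.iterate_succ_apply']
    exact shift_mem ih y

theorem slot_zero {V : ZMod 2 → Type*} [∀ p, AddCommGroup (V p)] [∀ p, Module K (V p)]
    {f : Fn K V} (hf : SlotLinear f) (l r : List (Letter V)) (p : ZMod 2) :
    f (l ++ ⟨p, 0⟩ :: r) = 0 := by
  have := slot_smul hf l r p 0 0
  rwa [zero_smul, zero_mul] at this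

theorem slot_eq_zero (g : OpLie K M) {ω : Fn K fun p => ↥(g.part p)} (hω : SlotLinear ω)
    (x : g.El) (hx : x.2.1 = 0) (w : List g.El) : ω (x :: w) = 0 := by
  obtain ⟨p, x⟩ := x
  have : x = 0 := Subtype.ext hx
  rw [this]
  exact slot_zero hω [] w p

/-- If `y` is an odd element with `[y, y] = 0`, inserting it several times into a cocycle produces
a sequence of cochains linked by the adjoint action of `y`. -/
theorem dFn_inner_iter (g : OpLie K M) (y : g.El) (hy : par y = 0) (hyy : (g.quad y y).2.1 = 0)
    {ω : Fn K fun p => ↥(g.part p)} (hω : ω ∈ algSub K (fun p => ↥(g.part p)) .com)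
    (hd : g.dFn ω = 0) (k : ℕ) (w : List g.El) :
    g.dFn ((g.inner y)^[k + 1] ω) w
      = -((k + 1 : ℕ) : K) * derExt 1 (g.quad y) w ((g.inner y)^[k] ω) := by
  -- Since `[y, y] = 0`, the adjoint action of `y` commutes with insertion of `y`. No sign appears
  -- because `y` is even in `Πg`.
  have hq : ∀ η : Fn K fun p => ↥(g.part p), SlotLinear η → ∀ w,
      derExt 1 (g.quad y) (y :: w) η = derExt 1 (g.quad y) w (g.inner y η) := by
    intro η hη w
    rw [derExt, g.slot_eq_zero hη _ hyy, hy, mul_zero, sgn_zero]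
    simp only [zero_add, one_mul]; rfl
  -- Cartan's formula, solved for the differential of an insertion. Each further insertion subtracts
  -- one more copy of the adjoint action, whence the factor `k + 1`.
  have hc : ∀ η ∈ algSub K (fun p => ↥(g.part p)) .com, ∀ w, g.dFn (g.inner y η) w
      = g.dFn η (y :: w) - derExt 1 (g.quad y) w η := by
    intro η hη w
    have := g.dFn_cons hη y w
    rw [hy, sgn_zero, one_mul, zero_add] at this
    rw [this, add_sub_cancel_right]
    rfl
  induction k generalizing w with
  | zero =>
    rw [zero_add, Function.iterate_one, Function.iterate_zero, id, hc ω hω, hd]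
    simp
  | succ k ih =>
    rw [Function.iterate_succ_apply', hc _ (g.inner_iter_mem_algSub y hω _), ih,
      hq _ (g.inner_iter_mem_algSub y hω _).1, ← Function.iterate_succ_apply' (g.inner y)]
    push_cast; ring

/-- The predicate `P` is meant to be slot-linearity: a letter with zero vector kills only linear
forms, and the recursion replaces `f` by its shifts. -/
theorem derExt_eq_zero {V : ZMod 2 → Type*} (t : ZMod 2) (a : Letter V → Letter V)
    (P : Fn K V → Prop) (hP : ∀ f, P f → ∀ u, P (fun w => f (u :: w))) (w : List (Letter V))
    (h : ∀ x ∈ w, ∀ f, P f → ∀ v, f (a x :: v) = 0) (f : Fn K V) (hf : P f) :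
    derExt t a w f = 0 := by
  induction w generalizing f with
  | nil => rfl
  | cons u w ih =>
    rw [derExt, h u List.mem_cons_self f hf,
      ih (fun x hx => h x (List.mem_cons_of_mem _ hx)) _ (hP f hf u)]
    simp

/-- Starting point of the zigzag: after `n + 1` insertions a cocycle of degree `n + 1` is a
constant, and constants are closed. -/
theorem dFn_degree_zero (g : OpLie K M) {ω : Fn K fun p => ↥(g.part p)}
    (h : ω ∈ g.cochains 0) : g.dFn ω = 0 := by
  funext w
  have : g.insertBracket ω = fun _ _ => 0 := by
    funext a b
    rcases a with _ | ⟨x, _ | ⟨y, _ | ⟨z, a⟩⟩⟩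
    · rfl
    · rfl
    · exact h.2.1 _ (by simp)
    · rfl
  rw [dFn, this]
  exact conv_zero .com w

variable [CharZero K]

/-- If the identity is an anticommutator with the odd operator `q`, then forms of positive degree
that are killed by `q` lie in its image. -/
theorem OddOp.exact {g : OpLie K M} (q σ : g.OddOp)
    (h : ∀ x : g.El, (q.el (σ.el x)).2.1 + (σ.el (q.el x)).2.1 = x.2.1) {n : ℕ}
    {ω : Fn K fun p => ↥(g.part p)} (hω : ω ∈ g.cochains (n + 1)) (hq : q.ext ω = 0) :
    ∃ κ ∈ g.cochains (n + 1), q.ext κ = ω := by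
  have h2 : (1 + 1 : ZMod 2) = 0 := by decide
  -- On forms, the anticommutator of the two induced derivations is multiplication by the degree.
  have hc := derExt_anticomm q.isOdd σ.isOdd SlotLinear
    (fun f hf u l r => hf (u :: l) r) (fun f hf u w => by
      have := g.slot_comb hf (p := 1 + (1 + u.1)) (q := 1 + (1 + u.1)) (r := u.1)
        (by linear_combination h2) (by linear_combination h2) 1 (q.el (σ.el u)).2
        (σ.el (q.el u)).2 u.2 (by rw [one_smul]; exact h u) w
      rw [one_mul] at this
      exact this)
  -- In degree `n + 1` one has `q σ ω + σ q ω = (n + 1) ω`, and the second term vanishes by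
  -- assumption; characteristic zero permits the division.
  refine ⟨((n + 1 : ℕ) : K)⁻¹ • σ.ext ω, Submodule.smul_mem _ _ (σ.ext_mem hω), ?_⟩
  funext w
  have e1 := congrFun (q.ext_lin ((n + 1 : ℕ) : K)⁻¹ (σ.ext ω) 0) w
  have e0 : q.ext (0 : Fn K fun p => ↥(g.part p)) = 0 := by
    funext w; exact derExt_zero 1 q.el w
  rw [e0, add_zero, add_zero] at e1
  rw [e1]
  show ((n + 1 : ℕ) : K)⁻¹ * derExt 1 q.el w (fun w => derExt 1 σ.el w ω) = ω w
  have e2 := hc w ω hω.1.1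
  have e3 : (fun w => derExt 1 q.el w ω) = fun _ => 0 := hq
  rw [e3, derExt_zero, add_zero] at e2
  rw [e2]
  by_cases hw : w.length = n + 1
  · rw [hw]
    have : ((n + 1 : ℕ) : K) ≠ 0 := Nat.cast_ne_zero.2 (Nat.succ_ne_zero n)
    field_simp
  · rw [hω.2.1 w hw]; simp

/-- A cocycle of `g` becomes exact on a subalgebra that commutes with an odd square zero element `y`
of `g` and lies in a subalgebra on which the adjoint action of `y` is contractible. -/
theorem exact_of_contraction {g : OpLie K M} {g' : OpLie K N} {h : OpLie K P} (ι : g'.Hom g)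
    (φ : h.Hom g') (y : g.El) (hy : par y = 0) (hyy : (g.quad y y).2.1 = 0) (q σ : g'.OddOp)
    (hq : ∀ x, ι.el (q.el x) = g.quad y (ι.el x)) (hder : g'.IsDer 1 q.el)
    (hσ : ∀ x : g'.El, (q.el (σ.el x)).2.1 + (σ.el (q.el x)).2.1 = x.2.1)
    (hφ : ∀ x : h.El, (q.el (φ.el x)).2.1 = 0) (n : ℕ)
    {ω : Fn K fun p => ↥(g.part p)} (hω : ω ∈ g.cochains (n + 1)) (hd : g.dFn ω = 0) :
    ∃ κ ∈ h.cochains n, h.dFn κ = φ.res (ι.res ω) := by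
  -- The element `y` need not lie in `g'`, so insertion takes place in `g` and is followed by
  -- restriction; the adjoint action of `y` restricts to `q`.
  have rel : ∀ k, g'.dFn (ι.res ((g.inner y)^[k + 1] ω))
      = -((k + 1 : ℕ) : K) • q.ext (ι.res ((g.inner y)^[k] ω)) := by
    intro k
    rw [ι.dFn_res]
    funext w
    show g.dFn _ (w.map ι.el) = -((k + 1 : ℕ) : K) * derExt 1 q.el w _
    rw [g.dFn_inner_iter y hy hyy hω.1 hd,
      derExt_map ι.el (fun _ => rfl) q.el (g.quad y) 1 hq]
    rfl
  have mem : ∀ k j, j + k = n + 1 → ι.res ((g.inner y)^[k] ω) ∈ g'.cochains j := fun k j hjk =>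
    ι.res_mem (g.inner_iter_mem y k j (by rwa [hjk]))
  have ext_smul : ∀ (s : K) (η : Fn K fun p => ↥(g'.part p)), q.ext (s • η) = s • q.ext η := by
    intro s η; funext w; exact derExt_smul 1 q.el s w η
  have ext_sub : ∀ (η θ : Fn K fun p => ↥(g'.part p)), q.ext (η - θ) = q.ext η - q.ext θ := by
    intro η θ
    have := q.ext_lin (-1) θ η
    rw [show η - θ = (-1 : K) • θ + η by rw [neg_smul, one_smul]; abel, this, neg_smul, one_smul]
    abel
  have d_smul : ∀ (s : K) (η : Fn K fun p => ↥(g'.part p)), g'.dFn (s • η) = s • g'.dFn η := by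
    intro s η; funext w; exact g'.dFn_smul s η w
  have anti : ∀ {j : ℕ} {κ : Fn K fun p => ↥(g'.part p)}, κ ∈ g'.cochains j →
      g'.dFn (q.ext κ) = -q.ext (g'.dFn κ) := by
    intro j κ hκ
    funext w
    have := hder.comm q.isOdd hκ.1 w
    show g'.dFn (q.ext κ) w = -derExt 1 q.el w (g'.dFn κ)
    rw [this]
    simp [sgn]; rfl
  -- One move of the zigzag. The hypothesis and `rel` give `(k + 1) q ω_k = q dκ`, so `ω_k - (k +
  -- 1)⁻¹ dκ` is killed by `q`. Its degree `j + 1` is positive, hence it lies in the image of `q`.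
  have step : ∀ j k, j + (k + 1) = n + 1 → ∀ κ ∈ g'.cochains j,
      g'.dFn (ι.res ((g.inner y)^[k + 1] ω)) = g'.dFn (q.ext κ) →
      ∃ κ' ∈ g'.cochains (j + 1), ι.res ((g.inner y)^[k] ω)
        = ((k + 1 : ℕ) : K)⁻¹ • g'.dFn κ + q.ext κ' := by
    intro j k hjk κ hκ he
    have hk : ((k + 1 : ℕ) : K) ≠ 0 := Nat.cast_ne_zero.2 (Nat.succ_ne_zero k)
    rw [rel, anti hκ, neg_smul, neg_inj] at he
    have h0 : q.ext (ι.res ((g.inner y)^[k] ω) - ((k + 1 : ℕ) : K)⁻¹ • g'.dFn κ) = 0 := by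
      rw [ext_sub, ext_smul, ← he, smul_smul, inv_mul_cancel₀ hk, one_smul, sub_self]
    obtain ⟨κ', hκ', e⟩ := q.exact σ hσ (n := j)
      (sub_mem (mem k (j + 1) (by omega)) (Submodule.smul_mem _ _ (g'.dFn_mem hκ))) h0
    exact ⟨κ', hκ', by rw [e]; abel⟩
  -- Only equality after applying `d` is carried along; this absorbs the exact term in the output of
  -- `step`, since `d² = 0`.
  have zz : ∀ j k, j + k = n + 1 → ∃ κ ∈ g'.cochains j,
      g'.dFn (ι.res ((g.inner y)^[k] ω)) = g'.dFn (q.ext κ) := by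
    intro j
    induction j with
    | zero =>
      intro k hk
      exact ⟨0, zero_mem _, by
        rw [g'.dFn_degree_zero (mem k 0 hk), g'.dFn_degree_zero (q.ext_mem (zero_mem _))]⟩
    | succ j ih =>
      intro k hk
      obtain ⟨κ, hκ, he⟩ := ih (k + 1) (by omega)
      obtain ⟨κ', hκ', e⟩ := step j k (by omega) κ hκ he
      refine ⟨κ', hκ', ?_⟩
      rw [e, g'.dFn_lin]
      have : g'.dFn (g'.dFn κ) = 0 := funext (g'.dFn_dFn hκ.1)
      rw [this, smul_zero, zero_add]
  obtain ⟨κ, hκ, he⟩ := zz n 1 rfl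
  obtain ⟨κ', hκ', e⟩ := step n 0 rfl κ hκ he
  refine ⟨φ.res κ, φ.res_mem hκ, ?_⟩
  -- Every summand contains a letter `q (φ x)`, whose vector is zero.
  have hz : φ.res (q.ext κ') = 0 := by
    funext w
    exact derExt_eq_zero _ _ SlotLinear (fun f hf u l r => hf (u :: l) r) _ (fun x hx f hf v => by
      obtain ⟨x, -, rfl⟩ := List.mem_map.1 hx
      exact g'.slot_eq_zero hf _ (hφ x) v) κ' hκ'.1.1
  have e' : ι.res ω = g'.dFn κ + q.ext κ' := by
    simpa using e
  rw [e', φ.dFn_res]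
  funext w
  have := congrFun hz w
  show _ = g'.dFn κ (w.map φ.el) + φ.res (q.ext κ') w
  rw [this, Pi.zero_apply, add_zero]
  rfl

end OpLie

end Zigzag

/-! ### Insertion of a vector, multiplication by a dual form, and counting letters off a line. -/

section Contraction

variable {K : Type*} [Field K] {U : ZMod 2 → Type*}
  [∀ p, AddCommGroup (U p)] [∀ p, Module K (U p)]

/-- The even component of `e` as a letter. -/
def dirLetter (e : ∀ p, U p) : Letter U := ⟨0, e 0⟩

/-- The projection of letters to the line spanned by `e`, given by the linear form `ξ`. -/
def toLine (ξ : ∀ p, U p →ₗ[K] K) (e : ∀ p, U p) (u : Letter U) : Letter U :=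
  ⟨u.1, ξ u.1 u.2 • e u.1⟩

/-- The complementary projection. -/
def offLine (ξ : ∀ p, U p →ₗ[K] K) (e : ∀ p, U p) (u : Letter U) : Letter U :=
  ⟨u.1, u.2 - ξ u.1 u.2 • e u.1⟩

/-- The shuffle product of a form with the linear form `ξ`. -/
def mulForm (ξ : ∀ p, U p →ₗ[K] K) : List (Letter U) → Fn K U → K
  | [], _ => 0
  | u :: w, f => ξ u.1 u.2 * f w + sgn K (par u) * mulForm ξ w (fun w => f (u :: w))

/-- The sum over all insertions of a fixed odd letter. -/
def insertAll (v : Letter U) : List (Letter U) → Fn K U → K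
  | [], f => f [v]
  | u :: w, f => f (v :: u :: w) + sgn K (par u) * insertAll v w (fun w => f (u :: w))

/-- The operator that counts the letters off the line. -/
def countOff (ξ : ∀ p, U p →ₗ[K] K) (e : ∀ p, U p) : List (Letter U) → Fn K U → K
  | [], _ => 0
  | u :: w, f => f (offLine ξ e u :: w) + countOff ξ e w (fun w => f (u :: w))

/-- Division by `m` plus the number of letters off the line. -/
def divOff (ξ : ∀ p, U p →ₗ[K] K) (e : ∀ p, U p) : ℕ → List (Letter U) → Fn K U → K
  | m, [], f => (m : K)⁻¹ * f []
  | m, u :: w, f => divOff ξ e (m + 1) w (fun w => f (offLine ξ e u :: w))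
      + divOff ξ e m w (fun w => f (toLine ξ e u :: w))

section Linear

variable (ξ : ∀ p, U p →ₗ[K] K) (e : ∀ p, U p)

theorem mulForm_lin (s : K) (w : List (Letter U)) (f g : Fn K U) :
    mulForm ξ w (fun w => s * f w + g w) = s * mulForm ξ w f + mulForm ξ w g := by
  induction w generalizing f g with
  | nil => simp [mulForm]
  | cons u w ih =>
    simp only [mulForm]
    rw [ih (fun w => f (u :: w)) (fun w => g (u :: w))]; ring

theorem mulForm_zero (w : List (Letter U)) : mulForm ξ w (fun _ => 0) = 0 := by
  simpa using mulForm_lin ξ (-1 : K) w (fun _ => 0) (fun _ => 0)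

theorem mulForm_add (w : List (Letter U)) (f g : Fn K U) :
    mulForm ξ w (fun w => f w + g w) = mulForm ξ w f + mulForm ξ w g := by
  simpa using mulForm_lin ξ 1 w f g

theorem mulForm_smul (s : K) (w : List (Letter U)) (f : Fn K U) :
    mulForm ξ w (fun w => s * f w) = s * mulForm ξ w f := by
  simpa [mulForm_zero] using mulForm_lin ξ s w f (fun _ => 0)

theorem insertAll_lin (v : Letter U) (s : K) (w : List (Letter U)) (f g : Fn K U) :
    insertAll v w (fun w => s * f w + g w) = s * insertAll v w f + insertAll v w g := by
  induction w generalizing f g with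
  | nil => simp [insertAll]
  | cons u w ih =>
    simp only [insertAll]
    rw [ih (fun w => f (u :: w)) (fun w => g (u :: w))]; ring

theorem countOff_lin (s : K) (w : List (Letter U)) (f g : Fn K U) :
    countOff ξ e w (fun w => s * f w + g w) = s * countOff ξ e w f + countOff ξ e w g := by
  induction w generalizing f g with
  | nil => simp [countOff]
  | cons u w ih =>
    simp only [countOff]
    rw [ih (fun w => f (u :: w)) (fun w => g (u :: w))]; ring

theorem divOff_lin (m : ℕ) (s : K) (w : List (Letter U)) (f g : Fn K U) :
    divOff ξ e m w (fun w => s * f w + g w) = s * divOff ξ e m w f + divOff ξ e m w g := by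
  induction w generalizing m f g with
  | nil => simp only [divOff]; ring
  | cons u w ih =>
    simp only [divOff]
    rw [ih (m + 1) (fun w => f (offLine ξ e u :: w)) (fun w => g (offLine ξ e u :: w)),
      ih m (fun w => f (toLine ξ e u :: w)) (fun w => g (toLine ξ e u :: w))]; ring

theorem divOff_zero (m : ℕ) (w : List (Letter U)) : divOff ξ e m w (fun _ => 0) = 0 := by
  simpa using divOff_lin ξ e m (-1 : K) w (fun _ => 0) (fun _ => 0)

theorem divOff_smul (m : ℕ) (s : K) (w : List (Letter U)) (f : Fn K U) :
    divOff ξ e m w (fun w => s * f w) = s * divOff ξ e m w f := by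
  simpa [divOff_zero] using divOff_lin ξ e m s w f (fun _ => 0)

theorem insertAll_zero (v : Letter U) (w : List (Letter U)) :
    insertAll v w (fun _ => (0 : K)) = 0 := by
  simpa using insertAll_lin v (-1 : K) w (fun _ => 0) (fun _ => 0)

theorem insertAll_smul (v : Letter U) (s : K) (w : List (Letter U)) (f : Fn K U) :
    insertAll v w (fun w => s * f w) = s * insertAll v w f := by
  simpa [insertAll_zero] using insertAll_lin v s w f (fun _ => 0)

theorem divOff_sgn (m : ℕ) (t : ZMod 2) (w : List (Letter U)) (f : Fn K U) :
    divOff ξ e m w (fun w => sgn K (t * wpar w) * f w)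
      = sgn K (t * wpar w) * divOff ξ e m w f := by
  induction w generalizing m f with
  | nil => simp only [divOff]; ring
  | cons u w ih =>
    simp only [divOff]
    have h : ∀ v : Letter U, par v = par u →
        (fun w => sgn K (t * wpar (v :: w)) * f (v :: w))
        = fun w => sgn K (t * wpar w) * (sgn K (t * par u) * f (v :: w)) := by
      intro v hv; funext w; rw [wpar, hv, mul_add, sgn_add]; ring
    rw [h (offLine ξ e u) rfl, h (toLine ξ e u) rfl, ih, ih, divOff_smul, divOff_smul]
    simp only [wpar, mul_add, sgn_add]; ring

/-- The defining recursion peels off the first letter; this version peels off the last one, as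
needed for cyclic rotations. -/
theorem divOff_append (m : ℕ) (w : List (Letter U)) (u : Letter U) (f : Fn K U) :
    divOff ξ e m (w ++ [u]) f = divOff ξ e (m + 1) w (fun w => f (w ++ [offLine ξ e u]))
      + divOff ξ e m w (fun w => f (w ++ [toLine ξ e u])) := by
  induction w generalizing m f with
  | nil => simp [divOff]
  | cons v w ih =>
    simp only [List.cons_append, divOff, ih]; ring

theorem mulForm_append (w : List (Letter U)) (u : Letter U) (f : Fn K U) :
    mulForm ξ (w ++ [u]) f = mulForm ξ w (fun w => f (w ++ [u]))
      + sgn K (wpar w) * (ξ u.1 u.2 * f w) := by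
  induction w generalizing f with
  | nil => simp [mulForm, wpar, sgn_zero]
  | cons v w ih =>
    simp only [List.cons_append, mulForm, ih, wpar, sgn_add]; ring

end Linear

/-- Invariance under signed cyclic rotations. -/
def CyclicInv (f : Fn K U) : Prop :=
  ∀ (u : Letter U) (w : List (Letter U)), f (u :: w) = sgn K (par u * wpar w) * f (w ++ [u])

section Slots

variable (ξ : ∀ p, U p →ₗ[K] K) (e : ∀ p, U p)

theorem mulForm_slot {f : Fn K U} (hf : SlotLinear f) : SlotLinear fun w => mulForm ξ w f := by
  intro l r p a x y
  show mulForm ξ _ f = a * mulForm ξ _ f + mulForm ξ _ f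
  induction l generalizing f with
  | nil =>
    simp only [List.nil_append, mulForm]
    have h : (fun w => f (⟨p, a • x + y⟩ :: w))
        = fun w => a * f (⟨p, x⟩ :: w) + f (⟨p, y⟩ :: w) := by
      funext w; exact hf [] w p a x y
    rw [h, mulForm_lin]
    simp only [map_add, map_smul, smul_eq_mul, par]; ring
  | cons u l ih =>
    have h := hf l r p a x y
    simp only [List.cons_append, mulForm]
    rw [ih (fun l r => hf (u :: l) r), h]; ring

theorem divOff_slot (m : ℕ) {f : Fn K U} (hf : SlotLinear f) :
    SlotLinear fun w => divOff ξ e m w f := by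
  intro l r p a x y
  show divOff ξ e m _ f = a * divOff ξ e m _ f + divOff ξ e m _ f
  induction l generalizing m f with
  | nil =>
    simp only [List.nil_append, divOff]
    have h : (fun w => f (offLine ξ e ⟨p, a • x + y⟩ :: w))
        = fun w => a * f (offLine ξ e ⟨p, x⟩ :: w) + f (offLine ξ e ⟨p, y⟩ :: w) := by
      funext w
      have := hf [] w p a (x - ξ p x • e p) (y - ξ p y • e p)
      simp only [List.nil_append] at this
      rw [offLine, offLine, offLine, ← this]
      congr 3
      simp only [map_add, map_smul, smul_eq_mul, add_smul, mul_smul, smul_sub]; abel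
    have h' : (fun w => f (toLine ξ e ⟨p, a • x + y⟩ :: w))
        = fun w => a * f (toLine ξ e ⟨p, x⟩ :: w) + f (toLine ξ e ⟨p, y⟩ :: w) := by
      funext w
      have := hf [] w p a (ξ p x • e p) (ξ p y • e p)
      simp only [List.nil_append] at this
      rw [toLine, toLine, toLine, ← this]
      congr 3
      simp only [map_add, map_smul, smul_eq_mul, add_smul, mul_smul]
    rw [h, h', divOff_lin, divOff_lin]; ring
  | cons u l ih =>
    simp only [List.cons_append, divOff]
    rw [ih (m + 1) (fun l r => hf (offLine ξ e u :: l) r),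
      ih m (fun l r => hf (toLine ξ e u :: l) r)]; ring

/-- The number of letters off the line does not depend on their order, and both projections preserve
parities. -/
theorem divOff_cyclic (m : ℕ) {f : Fn K U} (hf : CyclicInv f) :
    CyclicInv fun w => divOff ξ e m w f := by
  intro u w
  show divOff ξ e m (u :: w) f = sgn K (par u * wpar w) * divOff ξ e m (w ++ [u]) f
  rw [divOff_append, divOff]
  have h : ∀ v : Letter U, par v = par u → (fun w => f (v :: w))
      = fun w => sgn K (par u * wpar w) * f (w ++ [v]) := by
    intro v hv; funext w; rw [hf v w, hv]
  rw [h (offLine ξ e u) rfl, h (toLine ξ e u) rfl, divOff_sgn, divOff_sgn]; ring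

theorem divOff_homog (m : ℕ) (d : ZMod 2) (f : Fn K U) (hf : ∀ w, wpar w ≠ d → f w = 0)
    (w : List (Letter U)) (hw : wpar w ≠ d) : divOff ξ e m w f = 0 := by
  induction w generalizing m d f with
  | nil => rw [divOff, hf [] hw, mul_zero]
  | cons u w ih =>
    have h : ∀ v : Letter U, par v = par u → ∀ w, wpar w ≠ d - par u → f (v :: w) = 0 := by
      intro v hv w hw
      exact hf _ fun h => hw (by rw [← h, wpar, hv]; ring)
    have hw' : wpar w ≠ d - par u := fun h => hw (by rw [wpar, h]; ring)
    rw [divOff, ih _ _ _ (h (offLine ξ e u) rfl) hw', ih _ _ _ (h (toLine ξ e u) rfl) hw', add_zero]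

theorem divOff_length (m n : ℕ) (f : Fn K U) (hf : ∀ w, w.length < n → f w = 0)
    (w : List (Letter U)) (hw : w.length < n) : divOff ξ e m w f = 0 := by
  induction w generalizing m n f with
  | nil => rw [divOff, hf [] hw, mul_zero]
  | cons u w ih =>
    have h : ∀ v : Letter U, ∀ w : List (Letter U), w.length < n - 1 → f (v :: w) = 0 :=
      fun v w hw => hf _ (by simp only [List.length_cons]; omega)
    simp only [List.length_cons] at hw
    rw [divOff, ih _ _ _ (h _) (by omega), ih _ _ _ (h _) (by omega), add_zero]

theorem mulForm_length (n : ℕ) (f : Fn K U) (hf : ∀ w, w.length < n → f w = 0)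
    (w : List (Letter U)) (hw : w.length < n) : mulForm ξ w f = 0 := by
  induction w generalizing n f with
  | nil => rfl
  | cons u w ih =>
    simp only [List.length_cons] at hw
    rw [mulForm, hf w (by omega), ih (n - 1) _ (fun w hw => hf _ (by
      simp only [List.length_cons]; omega)) (by omega)]
    simp

end Slots

variable {ξ : ∀ p, U p →ₗ[K] K} {e : ∀ p, U p}

/-- The form `ξ` lives on the even part, whose vectors are odd letters of `ΠU`. Thus multiplication
by `ξ` is an odd operation, and sign checks reduce to this dichotomy. -/
theorem form_par (h1 : ξ 1 = 0) (u : Letter U) : ξ u.1 u.2 = 0 ∨ par u = 1 := by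
  obtain ⟨p, x⟩ := u
  rcases zmod2_cases p with rfl | rfl
  · right; rfl
  · left; simp [h1]

theorem mulForm_sgn (h1 : ξ 1 = 0) (t : ZMod 2) (w : List (Letter U)) (f : Fn K U) :
    mulForm ξ w (fun w => sgn K (t * wpar w) * f w)
      = sgn K (t * (wpar w + 1)) * mulForm ξ w f := by
  induction w generalizing f with
  | nil => simp [mulForm]
  | cons u w ih =>
    simp only [mulForm]
    have h : (fun w => sgn K (t * wpar (u :: w)) * f (u :: w))
        = fun w => sgn K (t * wpar w) * (sgn K (t * par u) * f (u :: w)) := by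
      funext w; rw [wpar, mul_add, sgn_add]; ring
    rw [h, ih, mulForm_smul]
    rcases form_par h1 u with hu | hu
    · rw [hu]; simp only [wpar, mul_add, sgn_add]; ring
    · have hs := sgn_sq K t
      simp only [wpar, hu, mul_add, mul_one, sgn_add]
      linear_combination (-(ξ u.1 u.2 * f w * sgn K (t * wpar w))) * hs

/-- The product is a signed sum over the letter fed to `ξ`; a rotation permutes these positions. If
`u` itself is fed to `ξ`, nothing is left to rotate and only the sign changes. -/
theorem mulForm_cyclic (h1 : ξ 1 = 0) {f : Fn K U} (hf : CyclicInv f) :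
    CyclicInv fun w => mulForm ξ w f := by
  intro u w
  show mulForm ξ (u :: w) f = sgn K (par u * wpar w) * mulForm ξ (w ++ [u]) f
  have h : (fun w => f (u :: w)) = fun w => sgn K (par u * wpar w) * f (w ++ [u]) := by
    funext w; exact hf u w
  rw [mulForm_append, mulForm, h, mulForm_sgn h1]
  have hp : par u * par u = par u := by rcases zmod2_cases (par u) with h | h <;> rw [h] <;> rfl
  have hs := sgn_sq K (par u)
  have hs' := sgn_sq K (wpar w)
  rw [mul_add, mul_one, sgn_add]
  rcases form_par h1 u with hu | hu
  · rw [hu]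
    linear_combination (sgn K (par u * wpar w) * mulForm ξ w fun w => f (w ++ [u])) * hs
  · rw [hu] at hs ⊢
    rw [one_mul]
    linear_combination (sgn K (wpar w) * mulForm ξ w fun w => f (w ++ [u])) * hs
      - (ξ u.1 u.2 * f w) * hs'

theorem mulForm_symm (h1 : ξ 1 = 0) {f : Fn K U} (hf : SuperSymm f) :
    SuperSymm fun w => mulForm ξ w f := by
  intro l r u v
  show mulForm ξ _ f = _ * mulForm ξ _ f
  induction l generalizing f with
  | nil =>
    simp only [List.nil_append, mulForm]
    have h : (fun w => f (u :: v :: w)) = fun w => sgn K (par u * par v) * f (v :: u :: w) := by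
      funext w; exact hf [] w u v
    rw [h, mulForm_smul]
    have h1' : sgn K (1 : ZMod 2) = -1 := by simp [sgn]
    have hs := sgn_sq K (par v)
    rcases form_par h1 u with hu | hu <;> rcases form_par h1 v with hv | hv
    · rw [hu, hv]; ring
    · rw [hu, hv, mul_one]; ring
    · rw [hv, hu, one_mul, h1']; linear_combination (-(ξ u.1 u.2 * f (v :: r))) * hs
    · rw [hv, hu, one_mul, h1']; ring
  | cons t l ih =>
    have h := hf l r u v
    simp only [List.cons_append, mulForm]
    rw [ih (fun l r => hf (t :: l) r), h]
    ring

theorem mulForm_homog (h1 : ξ 1 = 0) (d : ZMod 2) (f : Fn K U) (hf : ∀ w, wpar w ≠ d → f w = 0)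
    (w : List (Letter U)) (hw : wpar w ≠ 1 + d) : mulForm ξ w f = 0 := by
  induction w generalizing d f with
  | nil => rfl
  | cons u w ih =>
    rw [mulForm, ih (d - par u) _ (fun w h => hf _ fun h' => h (by rw [← h', wpar]; ring))
      (fun h => hw (by rw [wpar, h]; ring))]
    rcases form_par h1 u with hu | hu
    · rw [hu]; ring
    · rw [hf w fun h => hw (by rw [wpar, hu, h])]; ring

/-- The letters of the word are all equal to the distinguished one. -/
def OnLine (e : ∀ p, U p) (w : List (Letter U)) : Prop := ∀ u ∈ w, u = dirLetter e

theorem OnLine.tail {u : Letter U} {w : List (Letter U)} (h : OnLine e (u :: w)) : OnLine e w :=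
  fun x hx => h x (List.mem_cons_of_mem _ hx)

theorem OnLine.head {u : Letter U} {w : List (Letter U)} (h : OnLine e (u :: w)) :
    u = dirLetter e := h u List.mem_cons_self

theorem OnLine.cons {w : List (Letter U)} (h : OnLine e w) : OnLine e (dirLetter e :: w) := by
  intro x hx
  rcases List.mem_cons.1 hx with rfl | hx
  · rfl
  · exact h x hx

/-- Deleting a letter from a word on the line leaves a word on the line. -/
theorem mulForm_onLine (f : Fn K U) (hf : ∀ w, OnLine e w → f w = 0) (w : List (Letter U))
    (hw : OnLine e w) : mulForm ξ w f = 0 := by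
  induction w generalizing f with
  | nil => rfl
  | cons u w ih =>
    rw [mulForm, hf w hw.tail, ih _ (fun v hv => hf _ ?_) hw.tail]
    · simp
    · rw [hw.head]; exact hv.cons

section Projections

variable (h0 : ξ 0 (e 0) = 1) (h1 : ξ 1 = 0)
include h0 h1

theorem form_mul (p : ZMod 2) (x : U p) : ξ p x * ξ p (e p) = ξ p x := by
  rcases zmod2_cases p with rfl | rfl
  · rw [h0, mul_one]
  · simp [h1]

theorem form_offLine (u : Letter U) : ξ (offLine ξ e u).1 (offLine ξ e u).2 = 0 := by
  show ξ u.1 (u.2 - ξ u.1 u.2 • e u.1) = 0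
  rw [map_sub, map_smul, smul_eq_mul, form_mul h0 h1, sub_self]

theorem offLine_offLine (u : Letter U) : offLine ξ e (offLine ξ e u) = offLine ξ e u := by
  have h : ξ u.1 (u.2 - ξ u.1 u.2 • e u.1) = 0 := form_offLine h0 h1 u
  show (⟨u.1, (u.2 - ξ u.1 u.2 • e u.1) - ξ u.1 (u.2 - ξ u.1 u.2 • e u.1) • e u.1⟩ : Letter U) = _
  rw [h, zero_smul, sub_zero]; rfl

theorem toLine_offLine (u : Letter U) : toLine ξ e (offLine ξ e u) = ⟨u.1, 0⟩ := by
  have h := form_offLine h0 h1 u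
  show (⟨u.1, ξ (offLine ξ e u).1 (offLine ξ e u).2 • e u.1⟩ : Letter U) = _
  rw [h, zero_smul]

theorem offLine_dir : offLine ξ e (dirLetter e) = ⟨0, 0⟩ := by
  show (⟨0, e 0 - ξ 0 (e 0) • e 0⟩ : Letter U) = _
  rw [h0, one_smul, sub_self]

theorem toLine_dir : toLine ξ e (dirLetter e) = dirLetter e := by
  show (⟨0, ξ 0 (e 0) • e 0⟩ : Letter U) = _
  rw [h0, one_smul]; rfl

/-- For odd `u` both sides vanish since `ξ 1 = 0`, so the even letter `dirLetter e` serves for both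
parities. -/
theorem slot_toLine {f : Fn K U} (hf : SlotLinear f) (u : Letter U) (w : List (Letter U)) :
    f (toLine ξ e u :: w) = ξ u.1 u.2 * f (dirLetter e :: w) := by
  obtain ⟨p, x⟩ := u
  rw [toLine]
  have h := slot_smul hf [] w p (ξ p x) (e p)
  simp only [List.nil_append] at h
  rw [h]
  rcases zmod2_cases p with rfl | rfl
  · rfl
  · simp [h1]

theorem slot_split {f : Fn K U} (hf : SlotLinear f) (u : Letter U) (w : List (Letter U)) :
    f (offLine ξ e u :: w) = f (u :: w) - f (toLine ξ e u :: w) := by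
  obtain ⟨p, x⟩ := u
  have h := hf [] w p (-1) (ξ p x • e p) x
  simp only [List.nil_append] at h
  rw [show (-1 : K) • ξ p x • e p + x = x - ξ p x • e p by rw [neg_smul, one_smul]; abel] at h
  rw [offLine, toLine, h]; ring

theorem slot_nil {f : Fn K U} (hf : SlotLinear f) (p : ZMod 2) :
    (fun w => f (⟨p, 0⟩ :: w)) = fun _ => 0 := by
  funext w; exact OpLie.slot_zero hf [] w p

/-- Insertion of the distinguished letter and multiplication by `ξ`. -/
theorem insertAll_mulForm {f : Fn K U} (hf : SlotLinear f) (w : List (Letter U)) :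
    insertAll (dirLetter e) w (fun w => mulForm ξ w f)
      + mulForm ξ w (fun w => insertAll (dirLetter e) w f) = f w + countOff ξ e w f := by
  have hd : ξ (dirLetter e).1 (dirLetter e).2 = 1 := h0
  have hp : sgn K (par (dirLetter e)) = -1 := by
    show sgn K (0 + 1) = -1
    rw [sgn_succ, sgn_zero]
  -- Removing the letter just inserted returns `f w` once for each of the `|w| + 1` places. Removing
  -- a letter `u` of `w` cancels between the two orders, except that `u` has two sides to insert at
  -- while the gap it leaves counts once; the excess is minus the term with `u` projected to the
  -- line. Together this is `f w` plus the sum of the off-line projections.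
  induction w generalizing f with
  | nil => simp [insertAll, mulForm, countOff, hd]
  | cons u w ih =>
    have ih' := ih (f := fun w => f (u :: w)) (fun l r => hf (u :: l) r)
    simp only [insertAll, mulForm, countOff, hd, hp]
    rw [insertAll_lin, mulForm_add, mulForm_smul, insertAll_smul, slot_split h0 h1 hf,
      slot_toLine h0 h1 hf]
    have hs := sgn_sq K (par u)
    rcases form_par h1 u with hu | hu
    · rw [hu]
      linear_combination ih' + (insertAll (dirLetter e) w (fun w => mulForm ξ w fun w => f (u :: w))
        + mulForm ξ w (fun w => insertAll (dirLetter e) w fun w => f (u :: w))) * hs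
    · have h1' : sgn K (1 : ZMod 2) = -1 := by simp [sgn]
      rw [hu, h1']
      linear_combination ih'

/-- The inserted letter lies on the line, so the count of off-line letters is unchanged. -/
theorem divOff_insertAll (m : ℕ) {f : Fn K U} (hf : SlotLinear f) (w : List (Letter U)) :
    divOff ξ e m w (fun w => insertAll (dirLetter e) w f)
      = insertAll (dirLetter e) w (fun w => divOff ξ e m w f) := by
  have add : ∀ (m : ℕ) (w : List (Letter U)) (f g : Fn K U),
      divOff ξ e m w (fun w => f w + g w) = divOff ξ e m w f + divOff ξ e m w g := fun m w f g => by
    simpa using divOff_lin ξ e m 1 w f g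
  have add' : ∀ (v : Letter U) (w : List (Letter U)) (f g : Fn K U),
      insertAll v w (fun w => f w + g w) = insertAll v w f + insertAll v w g := fun v w f g => by
    simpa using insertAll_lin v 1 w f g
  induction w generalizing m f with
  | nil => simp [insertAll, divOff, offLine_dir h0 h1, toLine_dir h0 h1,
      show f [⟨0, 0⟩] = 0 from OpLie.slot_zero hf [] [] 0]
  | cons u w ih =>
    have i1 := ih (m + 1) (f := fun w => f (offLine ξ e u :: w)) (fun l r => hf (_ :: l) r)
    have i2 := ih m (f := fun w => f (toLine ξ e u :: w)) (fun l r => hf (_ :: l) r)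
    have z1 : (fun w => f (⟨0, 0⟩ :: offLine ξ e u :: w)) = fun _ => 0 := by
      funext w; exact OpLie.slot_zero hf [] _ 0
    have z2 : (fun w => f (⟨0, 0⟩ :: toLine ξ e u :: w)) = fun _ => 0 := by
      funext w; exact OpLie.slot_zero hf [] _ 0
    simp only [divOff, insertAll, add, add', divOff_smul, i1, i2, offLine_dir h0 h1,
      toLine_dir h0 h1, z1, z2, divOff_zero]
    have p1 : par (offLine ξ e u) = par u := rfl
    have p2 : par (toLine ξ e u) = par u := rfl
    rw [p1, p2]; ring

variable [CharZero K]

/-- Splitting every letter into its two projections diagonalizes the counting operator. The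
parameter `m` records off-line letters already passed, as the induction requires. -/
theorem countOff_divOff (m : ℕ) {f : Fn K U} (hf : SlotLinear f)
    (hm : m = 0 → ∀ w, OnLine e w → f w = 0) (w : List (Letter U)) :
    countOff ξ e w (fun w => divOff ξ e m w f) + m * divOff ξ e m w f = f w := by
  have add : ∀ (w : List (Letter U)) (f g : Fn K U),
      countOff ξ e w (fun w => f w + g w) = countOff ξ e w f + countOff ξ e w g := fun w f g => by
    simpa using countOff_lin ξ e 1 w f g
  induction w generalizing m f with
  | nil =>
    simp only [countOff, divOff, zero_add]
    rcases Nat.eq_zero_or_pos m with rfl | h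
    · rw [hm rfl [] (by intro x hx; cases hx)]; simp
    · have : (m : K) ≠ 0 := Nat.cast_ne_zero.2 h.ne'
      field_simp
  | cons u w ih =>
    have i1 := ih (m + 1) (f := fun w => f (offLine ξ e u :: w)) (fun l r => hf (_ :: l) r)
      (fun h => absurd h (Nat.succ_ne_zero m))
    have i2 := ih m (f := fun w => f (toLine ξ e u :: w)) (fun l r => hf (_ :: l) r)
      (fun h w hw => by
        show f (toLine ξ e u :: w) = 0
        rw [slot_toLine h0 h1 hf, hm h _ hw.cons, mul_zero])
    have z1 : (fun w => f (⟨u.1, 0⟩ :: w)) = fun _ => 0 := slot_nil h0 h1 hf u.1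
    simp only [countOff, divOff, add, offLine_offLine h0 h1, toLine_offLine h0 h1, z1, divOff_zero]
    have h := slot_split h0 h1 hf u w
    push_cast at i1
    linear_combination i1 + i2 + h

/-- On such words every off-line projection is zero, so only the value of `f` on the word itself
enters. -/
theorem divOff_onLine (m : ℕ) {f : Fn K U} (hl : SlotLinear f) (hf : ∀ w, OnLine e w → f w = 0)
    (w : List (Letter U)) (hw : OnLine e w) : divOff ξ e m w f = 0 := by
  induction w generalizing m f with
  | nil => rw [divOff, hf [] hw, mul_zero]
  | cons u w ih =>
    rw [divOff, hw.head, offLine_dir h0 h1, toLine_dir h0 h1, slot_nil h0 h1 hl, divOff_zero,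
      ih m (fun l r => hl (_ :: l) r) (fun w hw => hf _ hw.cons) hw.tail, add_zero]

end Projections

end Contraction

/-! ### Cyclic derivations vanishing along a line and the contraction of `ad (∂/∂e)`. -/

section LineDerivations

variable {K : Type*} [Field K] {U : ZMod 2 → Type*}
  [∀ p, AddCommGroup (U p)] [∀ p, Module K (U p)]

/-! Vanishing along a line. -/

theorem conv_onLine {e : ∀ p, U p} (c : Flavour) (F : List (Letter U) → List (Letter U) → K)
    (hF : ∀ a b, OnLine e a → F a b = 0) (w : List (Letter U)) (hw : OnLine e w) :
    conv c F w = 0 := by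
  cases c
  · show catSum F w = 0
    induction w generalizing F with
    | nil => exact hF [] [] hw
    | cons u w ih =>
      rw [catSum, hF [] _ (fun x hx => by cases hx), ih _ (fun a b h => hF _ _ ?_) hw.tail, add_zero]
      rw [hw.head]; exact h.cons
  · show shSum F w = 0
    induction w generalizing F with
    | nil => exact hF [] [] hw
    | cons u w ih =>
      rw [shSum]
      refine ih _ (fun a b h => ?_) hw.tail
      rw [hF a _ h, hF (u :: a) b (by rw [hw.head]; exact h.cons)]; simp

/-- By the Leibniz rule every term of a value has a factor `F i` evaluated on a subword, and
subwords of words on the line are on the line. -/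
theorem vf_onLine {e : ∀ p, U p} {ι : Type*} [Fintype ι] {c : Flavour} (b : ι → Letter U)
    (F : ι → Alg K U c) (d : ZMod 2) (hF : ∀ i w, OnLine e w → (F i).1 w = 0) (f : Alg K U c)
    (w : List (Letter U)) (hw : OnLine e w) : (vf b F d f).1 w = 0 := by
  have hc : ∀ (f : Fn K U) a b', OnLine e a → ctr b (fun i => (F i).1) f a b' = 0 :=
    fun f a b' h => Finset.sum_eq_zero fun i _ => by
      show (F i).1 a * _ = 0
      rw [hF i a h, zero_mul]
  cases c
  · show vfAss b _ d w f.1 = 0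
    suffices h : ∀ f : Fn K U, vfAss b (fun i => (F i).1) d w f = 0 from h f.1
    induction w with
    | nil => exact fun f => conv_onLine .ass _ (hc f) [] hw
    | cons u w ih =>
      intro f
      rw [vfAss, ih hw.tail, mul_zero, add_zero]
      exact conv_onLine .ass _ (hc f) _ hw
  · exact conv_onLine .com _ (hc f.1) w hw

theorem insertAll_eq_zero (v : Letter U) (w : List (Letter U)) (f : Fn K U)
    (hf : ∀ l r, f (l ++ v :: r) = 0) : insertAll v w f = 0 := by
  induction w generalizing f with
  | nil => exact hf [] []
  | cons u w ih =>
    rw [insertAll, ih _ (fun l r => hf (u :: l) r), mul_zero, add_zero]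
    exact hf [] _

theorem insertAll_onLine {e : ∀ p, U p} (f : Fn K U) (hf : ∀ w, OnLine e w → f w = 0)
    (w : List (Letter U)) (hw : OnLine e w) : insertAll (dirLetter e) w f = 0 := by
  induction w generalizing f with
  | nil => exact hf _ hw.cons
  | cons u w ih =>
    rw [insertAll, hf _ hw.cons, ih _ (fun w h => hf _ ?_) hw.tail]
    · simp
    · rw [hw.head]; exact h.cons

/-! The constant derivation. -/

variable (K) in
/-- The derivation `∂/∂e` in the direction of the even vector `e`. -/
def constDer (c : Flavour) (e : ∀ p, U p) : Module.End K (Alg K U c) :=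
  vf (fun _ : Unit => dirLetter e) (fun _ => 1) 1

theorem constDer_gen (c : Flavour) (e : ∀ p, U p) (φ : ∀ p, U p →ₗ[K] K) :
    constDer K c e (Alg.gen c φ) = φ 0 (e 0) • 1 := by
  rw [constDer, vf_gen, Finset.univ_unique, Finset.sum_singleton]; rfl

/-- The coefficient is the unit, so only the empty first block contributes, and the derivation is
contraction with `e`. -/
theorem constDer_com (e : ∀ p, U p) (f : Alg K U .com) (w : List (Letter U)) :
    (constDer K .com e f).1 w = f.1 (dirLetter e :: w) := by
  have h := congrFun (congrArg Subtype.val (alg_one_mul (f.shift (dirLetter e)))) w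
  refine Eq.trans ?_ h
  show shSum _ w = shSum _ w
  congr 1; funext a b
  rw [ctr, Finset.univ_unique, Finset.sum_singleton]; rfl

theorem constDer_ass (e : ∀ p, U p) (f : Alg K U .ass) (w : List (Letter U)) :
    (constDer K .ass e f).1 w = insertAll (dirLetter e) w f.1 := by
  have one : ∀ (g : Fn K U) (w : List (Letter U)),
      catSum (ctr (fun _ : Unit => dirLetter e) (fun _ => (1 : Alg K U .ass).1) g) w
        = g (dirLetter e :: w) := by
    intro g w
    have z : ∀ w : List (Letter U), catSum (fun _ _ => (0 : K)) w = 0 := conv_zero .ass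
    have o : (1 : Alg K U .ass).1 [] = 1 := rfl
    have o' : ∀ u w, (1 : Alg K U .ass).1 (u :: w) = 0 := fun _ _ => rfl
    rcases w with _ | ⟨u, w⟩
    · simp [catSum, ctr, o]
    · simp [catSum, ctr, o, o', z]
  show vfAss (fun _ : Unit => dirLetter e) (fun _ => (1 : Alg K U .ass).1) 1 w f.1 = _
  suffices h : ∀ f : Fn K U, vfAss (fun _ : Unit => dirLetter e)
      (fun _ => (1 : Alg K U .ass).1) 1 w f = insertAll (dirLetter e) w f from h f.1
  induction w with
  | nil => intro f; rw [vfAss, one]; rfl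
  | cons u w ih => intro f; rw [vfAss, one, ih, insertAll, one_mul]

theorem constDer_onLine {c : Flavour} {e : ∀ p, U p} {f : Alg K U c}
    (hf : ∀ w, OnLine e w → f.1 w = 0) (w : List (Letter U)) (hw : OnLine e w) :
    (constDer K c e f).1 w = 0 := by
  cases c
  · rw [constDer_ass]; exact insertAll_onLine _ hf w hw
  · rw [constDer_com]; exact hf _ hw.cons

variable [CharZero K] [∀ p, Module.Finite K (U p)]

theorem constDer_mem_der (c : Flavour) (e : ∀ p, U p) : constDer K c e ∈ Der K U c 1 := by
  refine vf_mem_der _ _ 1 fun _ w hw => ?_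
  rcases w with _ | ⟨u, w⟩
  · exact absurd (show (0 : ZMod 2) = 1 + (0 + 1) by decide) hw
  · rfl

/-- Values on generators are scalars, so the tensor lives on one-letter words, where rotation is
trivial. -/
theorem constDer_mem_cder (c : Flavour) (e : ∀ p, U p) (A : InnerProd K U) :
    constDer K c e ∈ CDer c A 1 := by
  refine ⟨constDer_mem_der c e, fun u w => ?_⟩
  have h : ∀ u v w, A.tensor 1 (constDer K c e) (u :: v :: w) = 0 := by
    intro u v w
    show _ * (constDer K c e (Alg.gen c _)).1 (v :: w) = 0
    rw [constDer_gen]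
    show _ * (_ * (0 : K)) = 0
    simp
  rcases w with _ | ⟨v, _ | ⟨t, w⟩⟩
  · simp [wpar, sgn_zero]
  · simp [h]
  · simp [h]

/-- The supercommutator is a derivation, and it kills generators: they go to scalars, and scalars go
to zero. -/
theorem constDer_sq (c : Flavour) (e : ∀ p, U p) :
    constDer K c e * constDer K c e
      - sgn K (1 * 1) • (constDer K c e * constDer K c e) = 0 := by
  have hy := constDer_mem_der (K := K) c e
  refine leibniz_unique (der_bracket hy hy).2.1 fun φ => ?_
  simp [constDer_gen, leibniz_one hy.2.1]

/-! Derivations vanishing along a line. -/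

variable (K) in
/-- Operators whose values vanish along the line spanned by `e`. -/
def vanishLine (c : Flavour) (e : ∀ p, U p) : Submodule K (Module.End K (Alg K U c)) where
  carrier := {D | ∀ f w, OnLine e w → (D f).1 w = 0}
  add_mem' {D E} hD hE f w hw := by
    show (D f).1 w + (E f).1 w = 0
    rw [hD f w hw, hE f w hw, add_zero]
  zero_mem' _ _ _ := rfl
  smul_mem' a D hD f w hw := by
    show a * (D f).1 w = 0
    rw [hD f w hw, mul_zero]

/-- The Lie superalgebra of cyclic derivations vanishing along the line spanned by `e`. -/
def lineLie (c : Flavour) (A : InnerProd K U) (e : ∀ p, U p) : OpLie K (Alg K U c) where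
  part p := CDer c A p ⊓ vanishLine K c e
  bracket_mem {_ _ x y} hx hy := ⟨cder_bracket A hx.1 hy.1, fun f w hw => by
    show (x (y f)).1 w - sgn K _ * (y (x f)).1 w = 0
    rw [hx.2 _ w hw, hy.2 _ w hw, mul_zero, sub_zero]⟩
  fil := Alg.fil K U c
  fil_succ _ _ hf w hw := hf w (Nat.lt_succ_of_lt hw)
  fil_lower hx n := leibniz_fil hx.1.1.2.1 n

/-- The inclusion in the Lie superalgebra of all cyclic derivations. -/
def lineIncl (c : Flavour) (A : InnerProd K U) (e : ∀ p, U p) : (lineLie c A e).Hom (cyc c A) where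
  map _ := Submodule.inclusion fun _ h => h.1
  map_bracket _ _ _ _ := rfl
  cont n := ⟨n, fun _ h => h⟩

/-- The constant derivation as an element of the Lie superalgebra of cyclic derivations. -/
def constEl (c : Flavour) (A : InnerProd K U) (e : ∀ p, U p) : (cyc c A).El :=
  ⟨1, ⟨constDer K c e, constDer_mem_cder c e A⟩⟩

/-- The adjoint action of the constant derivation. -/
def lineAd (c : Flavour) (A : InnerProd K U) (e : ∀ p, U p) : (lineLie c A e).OddOp where
  map p :=
    { toFun := fun D => ⟨sgn K 1 • (constDer K c e * D.1 - sgn K (1 * p) • (D.1 * constDer K c e)),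
        Submodule.smul_mem _ _ (cder_bracket A (constDer_mem_cder c e A) D.2.1),
        Submodule.smul_mem _ _ fun f w hw => by
          show (constDer K c e (D.1 f)).1 w - sgn K (1 * p) * (D.1 (constDer K c e f)).1 w = 0
          rw [constDer_onLine (D.2.2 f) w hw, D.2.2 _ w hw, mul_zero, sub_zero]⟩
      map_add' := fun D E => Subtype.ext (by
        simp only [Submodule.coe_add, mul_add, add_mul, smul_add, smul_sub]; abel)
      map_smul' := fun a D => Subtype.ext (by
        simp only [SetLike.val_smul, mul_smul_comm, smul_mul_assoc, RingHom.id_apply, smul_sub]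
        rw [smul_comm a, smul_comm a (sgn K 1), smul_comm a (sgn K (1 * p))]) }
  -- A constant derivation lowers the tensor degree by one, hence the shift from `n + 1` to `n`.
  cont n := ⟨n + 1, fun x hx => small_quad (cyc c A) n (constEl c A e)
    ((lineIncl c A e).el x) (Or.inr hx)⟩

/-- The Jacobi identity with `∂/∂e` as one entry; it is applied to bare operators since `∂/∂e` does
not vanish along the line in general. -/
theorem lineAd_isDer (c : Flavour) (A : InnerProd K U) (e : ∀ p, U p) :
    (lineLie c A e).IsDer 1 (lineAd c A e).el := fun x y =>
  OpLie.jacobi_op 1 x.1 y.1 (constDer K c e) x.2.1 y.2.1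

theorem lineIncl_ad (c : Flavour) (A : InnerProd K U) (e : ∀ p, U p) (x : (lineLie c A e).El) :
    (lineIncl c A e).el ((lineAd c A e).el x)
      = (cyc c A).quad (constEl c A e) ((lineIncl c A e).el x) := rfl

theorem constEl_quad (c : Flavour) (A : InnerProd K U) (e : ∀ p, U p) :
    ((cyc c A).quad (constEl c A e) (constEl c A e)).2.1 = 0 := by
  exact (congrArg (sgn K 1 • ·) (constDer_sq (K := K) c e)).trans (smul_zero _)

/-! Tensors of cyclic derivations. -/

theorem lower_lin (A : InnerProd K U) (c : Flavour) (p : ZMod 2) (a : K) (x y : U p) :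
    A.lower c ⟨p, a • x + y⟩ = a • A.lower c ⟨p, x⟩ + A.lower c ⟨p, y⟩ := by
  apply Subtype.ext; funext w
  show (Alg.gen c _).1 w = a * (Alg.gen c _).1 w + (Alg.gen c _).1 w
  match w with
  | [] => simp [Alg.gen]
  | [u] => simp [Alg.gen]
  | u :: v :: w => simp [Alg.gen]

/-- A letter dual to the basis vector with index `i`. -/
theorem exists_dual_letter (A : InnerProd K U) (i : Idx K U) :
    ∃ x : U i.1, ∀ u : Letter U, A.form u.1 i.1 u.2 x = crd K U i u.1 u.2 := by
  -- The form is even, so it is nondegenerate on each homogeneous part, and injectivity into the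
  -- dual gives surjectivity by dimension.
  let m : U i.1 →ₗ[K] Module.Dual K (U i.1) := (A.form i.1 i.1).flip
  have inj : Function.Injective m := by
    rw [injective_iff_map_eq_zero]
    intro x hx
    refine A.nondeg i.1 x fun q y => ?_
    by_cases h : i.1 = q
    · subst h
      have := LinearMap.congr_fun hx y
      rw [A.symm, show A.form i.1 i.1 y x = 0 from this, mul_zero]
    · exact A.even _ _ _ _ h
  have surj : Function.Surjective m :=
    (LinearMap.injective_iff_surjective_of_finrank_eq_finrank
      (Subspace.dual_finrank_eq (K := K) (V := U i.1)).symm).1 inj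
  obtain ⟨x, hx⟩ := surj (crd K U i i.1)
  refine ⟨x, fun u => ?_⟩
  obtain ⟨p, y⟩ := u
  by_cases h : p = i.1
  · subst h
    exact LinearMap.congr_fun hx y
  · rw [A.even _ _ _ _ h, crd_parity i p h]; rfl

/-- The dual basis with respect to the inner product. -/
noncomputable def dualBas (A : InnerProd K U) (i : Idx K U) : Letter U :=
  ⟨i.1, (exists_dual_letter A i).choose⟩

theorem dualBas_form (A : InnerProd K U) (i : Idx K U) (u : Letter U) :
    A.form u.1 (dualBas A i).1 u.2 (dualBas A i).2 = crd K U i u.1 u.2 :=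
  (exists_dual_letter A i).choose_spec u

/-- Every coordinate function is a pairing `⟨u, -⟩` up to sign, so a tensor determines the values of
its derivation on generators. -/
theorem gen_crd_eq_lower (A : InnerProd K U) (c : Flavour) (i : Idx K U) :
    Alg.gen c (crd K U i) = -sgn K (par (dualBas A i)) • A.lower c (dualBas A i) := by
  apply Subtype.ext; funext w
  show (Alg.gen c _).1 w = -sgn K (par (dualBas A i)) * (Alg.gen c _).1 w
  match w with
  | [] => simp [Alg.gen]
  | [u] =>
    show crd K U i u.1 u.2 = _ * A.form (dualBas A i).1 u.1 (dualBas A i).2 u.2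
    rw [← dualBas_form A, form_swap]
  | u :: v :: w => simp [Alg.gen]

theorem tensor_sub (A : InnerProd K U) {c : Flavour} (d : ZMod 2) (D E : Module.End K (Alg K U c))
    (w : List (Letter U)) : A.tensor d (D - E) w = A.tensor d D w - A.tensor d E w := by
  rcases w with _ | ⟨u, w⟩
  · simp [InnerProd.tensor]
  · show _ * ((D (A.lower c u)).1 w - (E (A.lower c u)).1 w) = _
    simp only [InnerProd.tensor]; ring

theorem tensor_add (A : InnerProd K U) {c : Flavour} (d : ZMod 2) (D E : Module.End K (Alg K U c))
    (w : List (Letter U)) : A.tensor d (D + E) w = A.tensor d D w + A.tensor d E w := by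
  rcases w with _ | ⟨u, w⟩
  · simp [InnerProd.tensor]
  · show _ * ((D (A.lower c u)).1 w + (E (A.lower c u)).1 w) = _
    simp only [InnerProd.tensor]; ring

theorem tensor_smul (A : InnerProd K U) {c : Flavour} (d : ZMod 2) (a : K)
    (D : Module.End K (Alg K U c)) (w : List (Letter U)) :
    A.tensor d (a • D) w = a * A.tensor d D w := by
  rcases w with _ | ⟨u, w⟩
  · simp [InnerProd.tensor]
  · show _ * (a * (D (A.lower c u)).1 w) = _
    simp only [InnerProd.tensor]; ring

theorem tensor_apply (A : InnerProd K U) {c : Flavour} (d : ZMod 2) (D : Module.End K (Alg K U c))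
    (u : Letter U) (w : List (Letter U)) :
    (D (A.lower c u)).1 w = sgn K (d * par u) * A.tensor d D (u :: w) := by
  have hs := sgn_sq K (d * par u)
  simp only [InnerProd.tensor]
  linear_combination (-(D (A.lower c u)).1 w) * hs

/-- A derivation whose tensor vanishes in small degrees has values of high order. -/
theorem fil_of_tensor (A : InnerProd K U) {c : Flavour} {d : ZMod 2} {D : Module.End K (Alg K U c)}
    (hD : D ∈ Der K U c d) (n : ℕ) (h : ∀ w, w.length < n + 1 → A.tensor d D w = 0)
    (f : Alg K U c) : D f ∈ Alg.fil K U c n := by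
  rw [der_formula hD]
  refine vf_fil _ _ d n (fun i w hw => ?_) f
  rw [gen_crd_eq_lower A, map_smul]
  show _ * (D (A.lower c (dualBas A i))).1 w = 0
  rw [tensor_apply A d, h _ (by simpa using hw)]; simp

/-- The difference has zero tensor, so its values lie in every step of the filtration, and the
filtration is separated. -/
theorem eq_of_tensor (A : InnerProd K U) {c : Flavour} {d : ZMod 2}
    {D E : Module.End K (Alg K U c)} (hD : D ∈ Der K U c d) (hE : E ∈ Der K U c d)
    (h : ∀ w, A.tensor d D w = A.tensor d E w) : D = E := by
  rw [← sub_eq_zero]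
  ext1 f
  apply Subtype.ext; funext w
  exact fil_of_tensor A (sub_mem hD hE) (w.length + 1)
    (fun w _ => by rw [tensor_sub, h, sub_self]) f w (Nat.lt_succ_self _)

/-- The tensors of cyclic derivations vanishing along the line spanned by `e`. -/
def lineTensors (K : Type*) [Field K] [∀ p, Module K (U p)] (c : Flavour) (e : ∀ p, U p)
    (d : ZMod 2) : Submodule K (Fn K U) where
  carrier := {f | f ∈ algSub K U c ∧ CyclicInv f ∧ (∀ w, wpar w ≠ d → f w = 0) ∧ f [] = 0 ∧
    ∀ u w, OnLine e w → f (u :: w) = 0}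
  add_mem' := by
    rintro f g ⟨f1, f2, f3, f4, f5⟩ ⟨g1, g2, g3, g4, g5⟩
    refine ⟨add_mem f1 g1, fun u w => ?_, fun w hw => ?_, ?_, fun u w hw => ?_⟩
    · simp only [Pi.add_apply, f2 u w, g2 u w]; ring
    · simp only [Pi.add_apply, f3 w hw, g3 w hw, add_zero]
    · simp only [Pi.add_apply, f4, g4, add_zero]
    · simp only [Pi.add_apply, f5 u w hw, g5 u w hw, add_zero]
  zero_mem' := ⟨zero_mem _, fun _ _ => by simp, fun _ _ => rfl, rfl, fun _ _ _ => rfl⟩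
  smul_mem' := by
    rintro s f ⟨f1, f2, f3, f4, f5⟩
    refine ⟨Submodule.smul_mem _ _ f1, fun u w => ?_, fun w hw => ?_, ?_, fun u w hw => ?_⟩
    · simp only [Pi.smul_apply, smul_eq_mul, f2 u w]; ring
    · simp only [Pi.smul_apply, f3 w hw, smul_zero]
    · simp only [Pi.smul_apply, f4, smul_zero]
    · simp only [Pi.smul_apply, f5 u w hw, smul_zero]

theorem lineTensors_onLine {c : Flavour} {e : ∀ p, U p} {d : ZMod 2} {f : Fn K U}
    (hf : f ∈ lineTensors K c e d) (w : List (Letter U)) (hw : OnLine e w) : f w = 0 := by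
  rcases w with _ | ⟨u, w⟩
  · exact hf.2.2.2.1
  · exact hf.2.2.2.2 u w hw.tail

/-- In the symmetric case values of a derivation are symmetric in all letters but the first.
Rotating another letter to the front moves a swap of the first two letters into that symmetric
range. -/
theorem superSymm_of_cyclic {f : Fn K U} (hc : CyclicInv f)
    (ht : ∀ u, SuperSymm fun w => f (u :: w)) : SuperSymm f := by
  intro l r u v
  rcases l with _ | ⟨t, l⟩
  · rcases List.eq_nil_or_concat r with rfl | ⟨r, t, rfl⟩
    · have := hc u [v]
      simpa [wpar] using this
    · have h1 := hc t (u :: v :: r)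
      have h2 := hc t (v :: u :: r)
      have h3 := ht t [] r u v
      simp only [List.nil_append, List.concat_eq_append, List.cons_append] at *
      have hp : wpar (v :: u :: r) = wpar (u :: v :: r) := wpar_swap [] r v u
      have hs := sgn_sq K (par t * wpar (u :: v :: r))
      rw [h1, h2, hp] at h3
      linear_combination sgn K (par t * wpar (u :: v :: r)) * h3
        - (f (u :: v :: (r ++ [t])) - sgn K (par u * par v) * f (v :: u :: (r ++ [t]))) * hs
  · exact ht t l r u v

theorem tensor_mem (A : InnerProd K U) {c : Flavour} {e : ∀ p, U p} {d : ZMod 2}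
    {D : Module.End K (Alg K U c)} (hD : D ∈ (lineLie c A e).part d) :
    A.tensor d D ∈ lineTensors K c e d := by
  obtain ⟨⟨h1, h2⟩, h3⟩ := hD
  have hc : CyclicInv (A.tensor d D) := h2
  refine ⟨⟨fun l r p a x y => ?_, fun hcom => superSymm_of_cyclic hc fun u l r s t => ?_⟩, hc,
    fun w hw => ?_, rfl, fun u w hw => ?_⟩
  · rcases l with _ | ⟨u, l⟩
    · simp only [List.nil_append, InnerProd.tensor]
      rw [lower_lin, map_add, map_smul]
      show _ * (a * (D (A.lower c ⟨p, x⟩)).1 r + (D (A.lower c ⟨p, y⟩)).1 r) = _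
      simp only [par]; ring
    · simp only [List.cons_append, InnerProd.tensor]
      rw [(D (A.lower c u)).2.1 l r p a x y]; ring
  · simp only [InnerProd.tensor]
    rw [(D (A.lower c u)).2.2 hcom l r s t]; ring
  · rcases w with _ | ⟨u, w⟩
    · rfl
    · simp only [InnerProd.tensor]
      rw [h1.1 _ _ (lower_homog A c u) w, mul_zero]
      intro h
      apply hw
      rw [wpar, h]
      have h2 : par u + par u = 0 := CharTwo.add_self_eq_zero _
      linear_combination h2
  · simp only [InnerProd.tensor]
    rw [h3 _ w hw, mul_zero]

/-- Realizes tensors by derivations, so that the homotopy can be written down on tensors, where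
cyclicity is visible. -/
theorem exists_tensor (A : InnerProd K U) {c : Flavour} {e : ∀ p, U p} {d : ZMod 2} {f : Fn K U}
    (hf : f ∈ lineTensors K c e d) : ∃ D ∈ (lineLie c A e).part d, ∀ w, A.tensor d D w = f w := by
  obtain ⟨h1, h2, h3, h4, h5⟩ := hf
  let F : Idx K U → Alg K U c := fun i => ⟨fun w => sgn K (d * par (bas K U i)) * f (bas K U i :: w),
    (algSub K U c).smul_mem _ (shift_mem h1 _)⟩
  -- With the dual basis as directions, `⟨u, -⟩` is sent to `∑ crd_i(u) F i`, which recovers `f (u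
  -- :: w)` by linearity in the first letter.
  let D : Module.End K (Alg K U c) := vf (dualBas A) F d
  have hlow : ∀ u w, (D (A.lower c u)).1 w = sgn K (d * par u) * f (u :: w) := by
    intro u w
    show (vf (dualBas A) F d (Alg.gen c _)).1 w = _
    rw [vf_gen, AddSubmonoidClass.coe_finsetSum, Finset.sum_apply, ← sum_crd_fn h1.1 u w,
      Finset.mul_sum]
    refine Finset.sum_congr rfl fun i _ => ?_
    show A.form u.1 (dualBas A i).1 u.2 (dualBas A i).2
      * (sgn K (d * par (bas K U i)) * f (bas K U i :: w)) = _
    rw [dualBas_form]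
    linear_combination f (bas K U i :: w) * crd_sgn (K := K) d i u
  have ht : ∀ w, A.tensor d D w = f w := by
    intro w
    rcases w with _ | ⟨u, w⟩
    · exact h4.symm
    · simp only [InnerProd.tensor]
      rw [hlow, ← mul_assoc, sgn_sq, one_mul]
  refine ⟨D, ⟨⟨vf_mem_der _ _ d fun i w hw => ?_, fun u w => ?_⟩, fun g w hw => ?_⟩, ht⟩
  · show _ * f (bas K U i :: w) = 0
    rw [h3 _ fun h => hw ?_, mul_zero]
    have h2 : par (bas K U i) + par (bas K U i) = 0 := CharTwo.add_self_eq_zero _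
    have hp : par (dualBas A i) = par (bas K U i) := rfl
    rw [hp, ← h, wpar]; linear_combination -h2
  · rw [ht, ht]; exact h2 u w
  · exact vf_onLine _ F d (fun i w hw => by
      show _ * f (bas K U i :: w) = 0
      rw [h5 _ w hw, mul_zero]) g w hw

/-- Derivations and their tensors. -/
noncomputable def tensorEquiv (A : InnerProd K U) (c : Flavour) (e : ∀ p, U p) (d : ZMod 2) :
    (lineLie c A e).part d ≃ₗ[K] lineTensors K c e d :=
  LinearEquiv.ofBijective
    { toFun := fun D => ⟨A.tensor d D.1, tensor_mem A D.2⟩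
      map_add' := fun D E => Subtype.ext (funext (tensor_add A d D.1 E.1))
      map_smul' := fun a D => Subtype.ext (funext (tensor_smul A d a D.1)) }
    ⟨fun D E h => Subtype.ext (eq_of_tensor A D.2.1.1 E.2.1.1
        (congrFun (congrArg Subtype.val h))),
      fun f => by
        obtain ⟨D, hD, h⟩ := exists_tensor A f.2
        exact ⟨⟨D, hD⟩, Subtype.ext (funext h)⟩⟩

theorem tensorEquiv_apply (A : InnerProd K U) (c : Flavour) (e : ∀ p, U p) (d : ZMod 2)
    (D : (lineLie c A e).part d) (w : List (Letter U)) :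
    (tensorEquiv A c e d D).1 w = A.tensor d D.1 w := rfl

theorem tensor_symm (A : InnerProd K U) (c : Flavour) (e : ∀ p, U p) (d : ZMod 2)
    (f : lineTensors K c e d) (w : List (Letter U)) :
    A.tensor d ((tensorEquiv A c e d).symm f).1 w = f.1 w := by
  rw [← tensorEquiv_apply, LinearEquiv.apply_symm_apply]

/-! The contraction. -/

variable {ξ : ∀ p, U p →ₗ[K] K} {e : ∀ p, U p}

theorem mulForm_mem (h1 : ξ 1 = 0) {c : Flavour} {d : ZMod 2} {f : Fn K U}
    (hf : f ∈ lineTensors K c e d) :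
    (fun w => mulForm ξ w f) ∈ lineTensors K c e (1 + d) := by
  have hl := lineTensors_onLine hf
  obtain ⟨k1, k2, k3, k4, k5⟩ := hf
  refine ⟨⟨mulForm_slot ξ k1.1, fun h => mulForm_symm h1 (k1.2 h)⟩, mulForm_cyclic h1 k2,
    mulForm_homog h1 d f k3, rfl, fun u w hw => ?_⟩
  show mulForm ξ (u :: w) f = 0
  rw [mulForm, hl w hw, mulForm_onLine _ (fun w hw => k5 u w hw) w hw]; simp

/-- Stated for the tensor case only: in the symmetric case the homotopy involves no division. -/
theorem divOff_mem (h0 : ξ 0 (e 0) = 1) (h1 : ξ 1 = 0) {d : ZMod 2} {f : Fn K U}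
    (hf : f ∈ lineTensors K .ass e d) :
    (fun w => divOff ξ e 0 w f) ∈ lineTensors K .ass e d := by
  obtain ⟨k1, k2, k3, k4, k5⟩ := hf
  refine ⟨⟨divOff_slot ξ e 0 k1.1, fun h => by cases h⟩, divOff_cyclic ξ e 0 k2,
    divOff_homog ξ e 0 d f k3, by simp [divOff], fun u w hw => ?_⟩
  show divOff ξ e 0 (u :: w) f = 0
  rw [divOff, divOff_onLine h0 h1 _ (fun l r => k1.1 (_ :: l) r) (fun w hw => k5 _ w hw) w hw,
    divOff_onLine h0 h1 _ (fun l r => k1.1 (_ :: l) r) (fun w hw => k5 _ w hw) w hw, add_zero]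

/-- The homotopy on tensors. -/
def tensorHomotopy (ξ : ∀ p, U p →ₗ[K] K) (e : ∀ p, U p) (c : Flavour) (f : Fn K U) : Fn K U :=
  match c with
  | .ass => fun w => -mulForm ξ w (fun w => divOff ξ e 0 w f)
  | .com => fun w => -mulForm ξ w f

theorem tensorHomotopy_mem (h0 : ξ 0 (e 0) = 1) (h1 : ξ 1 = 0) {c : Flavour} {d : ZMod 2}
    {f : Fn K U} (hf : f ∈ lineTensors K c e d) :
    tensorHomotopy ξ e c f ∈ lineTensors K c e (1 + d) := by
  cases c
  · exact neg_mem (mulForm_mem h1 (divOff_mem h0 h1 hf))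
  · exact neg_mem (mulForm_mem h1 hf)

theorem tensorHomotopy_lin (ξ : ∀ p, U p →ₗ[K] K) (e : ∀ p, U p) (c : Flavour) (s : K)
    (f g : Fn K U) :
    tensorHomotopy ξ e c (s • f + g) = s • tensorHomotopy ξ e c f + tensorHomotopy ξ e c g := by
  funext w
  cases c
  · show -mulForm ξ w (fun w => divOff ξ e 0 w (fun w => s * f w + g w))
      = s * -mulForm ξ w _ + -mulForm ξ w _
    simp only [divOff_lin, mulForm_lin]; ring
  · show -mulForm ξ w (fun w => s * f w + g w) = s * -mulForm ξ w _ + -mulForm ξ w _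
    rw [mulForm_lin]; ring

theorem tensorHomotopy_length (ξ : ∀ p, U p →ₗ[K] K) (e : ∀ p, U p) (c : Flavour) (n : ℕ)
    (f : Fn K U) (hf : ∀ w, w.length < n → f w = 0) (w : List (Letter U)) (hw : w.length < n) :
    tensorHomotopy ξ e c f w = 0 := by
  cases c
  · exact neg_eq_zero.2 (mulForm_length ξ n _ (divOff_length ξ e 0 n f hf) w hw)
  · exact neg_eq_zero.2 (mulForm_length ξ n f hf w hw)

/-- The adjoint action of the constant derivation on tensors. -/
def tensorAd (e : ∀ p, U p) (c : Flavour) (f : Fn K U) : Fn K U :=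
  match c with
  | .ass => fun w => -(insertAll (dirLetter e) w f - f (dirLetter e :: w))
  | .com => fun w => -f (dirLetter e :: w)

/-- The tensor at `u :: w` is a value at `w`, so `e` is inserted everywhere except in front of `u`.
The front and the end are the same place of a cyclic word, so each cyclic gap is used once. -/
theorem tensor_ad (A : InnerProd K U) (c : Flavour) (e : ∀ p, U p) (d : ZMod 2)
    (D : (lineLie c A e).part d) (w : List (Letter U)) :
    A.tensor (1 + d) ((lineAd c A e).map d D).1 w = tensorAd e c (A.tensor d D.1) w := by
  have hT := tensor_mem A D.2
  have s1 : sgn K (1 : ZMod 2) = -1 := by simp [sgn]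
  rcases w with _ | ⟨u, w⟩
  · have h0 : A.tensor d D.1 [dirLetter e] = 0 := hT.2.2.2.2 _ [] (fun x hx => by cases hx)
    cases c
    · show 0 = -(insertAll (dirLetter e) [] _ - A.tensor d D.1 [dirLetter e])
      simp [insertAll]
    · show 0 = -A.tensor d D.1 [dirLetter e]
      rw [h0, neg_zero]
  · have e1 : constDer K c e (A.lower c u) = A.form u.1 0 u.2 (e 0) • 1 := constDer_gen c e _
    have e2 : (((lineAd c A e).map d D).1 (A.lower c u)).1 w
        = -(constDer K c e (D.1 (A.lower c u))).1 w := by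
      -- In the commutator `∂/∂e` turns a generator into a scalar, which `D` kills; only `∂/∂e`
      -- applied after `D` remains.
      have : ((lineAd c A e).map d D).1 (A.lower c u)
          = -(constDer K c e (D.1 (A.lower c u))) := by
        show (sgn K 1 • (constDer K c e * D.1 - sgn K (1 * d) • (D.1 * constDer K c e)))
          (A.lower c u) = _
        simp only [LinearMap.smul_apply, LinearMap.sub_apply, Module.End.mul_apply, e1, map_smul,
          leibniz_one D.2.1.1.2.1, smul_zero, sub_zero, s1, neg_smul, one_smul]
      rw [this]; rfl
    rw [InnerProd.tensor, e2]
    cases c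
    · rw [constDer_ass]
      show _ = -(insertAll (dirLetter e) (u :: w) (A.tensor d D.1)
        - A.tensor d D.1 (dirLetter e :: u :: w))
      have e3 : insertAll (dirLetter e) w (fun w => A.tensor d D.1 (u :: w))
          = sgn K (d * par u) * insertAll (dirLetter e) w (D.1 (A.lower .ass u)).1 :=
        insertAll_smul _ _ _ _
      rw [insertAll, e3, add_mul, one_mul, sgn_add]; ring
    · rw [constDer_com]
      show _ = -A.tensor d D.1 (dirLetter e :: u :: w)
      have h := hT.1.2 rfl [] w (dirLetter e) u
      simp only [List.nil_append] at h
      rw [h, InnerProd.tensor, show par (dirLetter e) = 1 from rfl, add_mul, one_mul, sgn_add]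
      ring

/-- Multiplying by `ξ` and contracting with `e` anticommute to the identity in the symmetric case.
In the tensor case the cyclic insertion, which omits the front place, removes the summand `f w` from
`insertAll_mulForm`; what remains is the off-line count, inverted by `divOff`. -/
theorem tensor_homotopy (h0 : ξ 0 (e 0) = 1) (h1 : ξ 1 = 0) {c : Flavour} {d : ZMod 2}
    {f : Fn K U} (hf : f ∈ lineTensors K c e d) (w : List (Letter U)) :
    tensorAd e c (tensorHomotopy ξ e c f) w + tensorHomotopy ξ e c (tensorAd e c f) w = f w := by
  have hd : ξ (dirLetter e).1 (dirLetter e).2 = 1 := h0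
  have hp : sgn K (par (dirLetter e)) = -1 := by
    show sgn K (0 + 1) = -1
    rw [sgn_succ, sgn_zero]
  have neg : ∀ (w : List (Letter U)) (f : Fn K U),
      mulForm ξ w (fun w => -f w) = -mulForm ξ w f := fun w f => by
    simpa using mulForm_smul ξ (-1) w f
  have cons : ∀ (g : Fn K U) (w : List (Letter U)), mulForm ξ (dirLetter e :: w) g
      = g w - mulForm ξ w (fun w => g (dirLetter e :: w)) := by
    intro g w; rw [mulForm, hd, hp]; ring
  cases c
  · have hs := hf.1.1
    have hg := (divOff_mem h0 h1 hf).1.1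
    show -(insertAll (dirLetter e) w (fun w => -mulForm ξ w (fun w => divOff ξ e 0 w f))
        - -mulForm ξ (dirLetter e :: w) (fun w => divOff ξ e 0 w f))
      + -mulForm ξ w (fun w => divOff ξ e 0 w
        (fun w => -(insertAll (dirLetter e) w f - f (dirLetter e :: w)))) = f w
    have a1 : insertAll (dirLetter e) w (fun w => -mulForm ξ w (fun w => divOff ξ e 0 w f))
        = -insertAll (dirLetter e) w (fun w => mulForm ξ w (fun w => divOff ξ e 0 w f)) := by
      simpa using insertAll_smul (dirLetter e) (-1 : K) w
        (fun w => mulForm ξ w (fun w => divOff ξ e 0 w f))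
    -- A leading letter on the line has no off-line part, so it passes through the division; with
    -- `divOff_insertAll` the division commutes with the adjoint action.
    have a2 : ∀ w, divOff ξ e 0 w (fun w => f (dirLetter e :: w))
        = divOff ξ e 0 (dirLetter e :: w) f := by
      intro w
      rw [divOff, offLine_dir h0 h1, toLine_dir h0 h1, slot_nil h0 h1 hs, divOff_zero, zero_add]
    have a3 : (fun w => divOff ξ e 0 w
        (fun w => -(insertAll (dirLetter e) w f - f (dirLetter e :: w))))
        = fun w => (-1) * insertAll (dirLetter e) w (fun w => divOff ξ e 0 w f)
          + divOff ξ e 0 (dirLetter e :: w) f := by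
      funext w
      have : (fun w => -(insertAll (dirLetter e) w f - f (dirLetter e :: w)))
          = fun w => (-1) * insertAll (dirLetter e) w f + f (dirLetter e :: w) := by
        funext w; ring
      rw [this, divOff_lin, divOff_insertAll h0 h1 0 hs, a2]
    rw [a1, a3, mulForm_lin, cons]
    have b1 := insertAll_mulForm h0 h1 hg w
    have b2 := countOff_divOff h0 h1 0 hs (fun _ => lineTensors_onLine hf) w
    rw [Nat.cast_zero, zero_mul, add_zero] at b2
    linear_combination b1 + b2
  · show - -mulForm ξ (dirLetter e :: w) f + -mulForm ξ w (fun w => -f (dirLetter e :: w)) = f w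
    rw [neg, cons]; ring

/-- The contraction of the adjoint action of the constant derivation. -/
noncomputable def lineHomotopy (h0 : ξ 0 (e 0) = 1) (h1 : ξ 1 = 0) (c : Flavour)
    (A : InnerProd K U) : (lineLie c A e).OddOp where
  map p := (tensorEquiv A c e (1 + p)).symm.toLinearMap ∘ₗ
    { toFun := fun f => ⟨tensorHomotopy ξ e c f.1, tensorHomotopy_mem h0 h1 f.2⟩
      map_add' := fun f g => Subtype.ext (by
        have := tensorHomotopy_lin ξ e c 1 f.1 g.1
        rwa [one_smul, one_smul] at this)
      map_smul' := fun a f => Subtype.ext (by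
        have h := tensorHomotopy_lin ξ e c a f.1 0
        have z := tensorHomotopy_lin ξ e c (-1) (0 : Fn K U) 0
        rw [neg_smul, neg_smul, one_smul, one_smul, neg_add_cancel, neg_add_cancel] at z
        rw [z, add_zero, add_zero] at h
        exact h) } ∘ₗ (tensorEquiv A c e p).toLinearMap
  -- The homotopy never lowers the length of words on which a tensor vanishes. The bound is `n + 1`
  -- on tensors because a tensor has one letter more than the value it encodes.
  cont n := ⟨n, fun x hx => fil_of_tensor A
    ((tensorEquiv A c e (1 + x.1)).symm _).2.1.1 n fun w hw => by
      refine (tensor_symm A c e _ _ w).trans ?_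
      refine tensorHomotopy_length ξ e c (n + 1) _ (fun w hw => ?_) w hw
      rcases w with _ | ⟨u, w⟩
      · rfl
      · show _ * (x.2.1 (A.lower c u)).1 w = 0
        rw [hx _ w (by simpa using hw), mul_zero]⟩

theorem tensor_lineHomotopy (h0 : ξ 0 (e 0) = 1) (h1 : ξ 1 = 0) (c : Flavour)
    (A : InnerProd K U) (p : ZMod 2) (D : (lineLie c A e).part p) (w : List (Letter U)) :
    A.tensor (1 + p) ((lineHomotopy h0 h1 c A).map p D).1 w
      = tensorHomotopy ξ e c (A.tensor p D.1) w :=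
  tensor_symm A c e (1 + p) _ w

theorem lineHomotopy_spec (h0 : ξ 0 (e 0) = 1) (h1 : ξ 1 = 0) (c : Flavour) (A : InnerProd K U)
    (x : (lineLie c A e).El) :
    ((lineAd c A e).el ((lineHomotopy h0 h1 c A).el x)).2.1
      + ((lineHomotopy h0 h1 c A).el ((lineAd c A e).el x)).2.1 = x.2.1 := by
  obtain ⟨p, D⟩ := x
  have hd : 1 + (1 + p) = p := by
    have h2 : (1 + 1 : ZMod 2) = 0 := by decide
    linear_combination h2
  let X := (lineAd c A e).map (1 + p) ((lineHomotopy h0 h1 c A).map p D)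
  let Y := (lineHomotopy h0 h1 c A).map (1 + p) ((lineAd c A e).map p D)
  show X.1 + Y.1 = D.1
  -- Both composites carry the parity label `1 + (1 + p)`, so `D` is transported there before
  -- tensors are compared.
  refine eq_of_tensor A (d := 1 + (1 + p)) (add_mem X.2.1.1 Y.2.1.1) (hd.symm ▸ D.2.1.1) fun w => ?_
  have e1 : A.tensor (1 + p) ((lineHomotopy h0 h1 c A).map p D).1
      = tensorHomotopy ξ e c (A.tensor p D.1) := funext (tensor_lineHomotopy h0 h1 c A p D)
  have e2 : A.tensor (1 + p) ((lineAd c A e).map p D).1 = tensorAd e c (A.tensor p D.1) :=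
    funext (tensor_ad A c e p D)
  rw [tensor_add, tensor_ad, tensor_lineHomotopy, e1, e2, tensor_homotopy h0 h1 (tensor_mem A D.2),
    hd]

end LineDerivations

/-! ### Application to the orthogonal sum and passage to chains. -/

section Stabilization

variable {K : Type*} [Field K] [CharZero K]
  {V : ZMod 2 → Type*} [∀ p, AddCommGroup (V p)] [∀ p, Module K (V p)] [∀ p, Module.Finite K (V p)]
  {W : ZMod 2 → Type*} [∀ p, AddCommGroup (W p)] [∀ p, Module K (W p)] [∀ p, Module.Finite K (W p)]

/-- The vector of `V ⊕ W` with even component `(0, x)`. -/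
def inRight (V : ZMod 2 → Type*) [∀ p, AddCommGroup (V p)] (x : W 0) : ∀ p, DSum V W p :=
  Function.update 0 0 (0, x)

theorem prL_dirLetter (x : W 0) : prL (dirLetter (inRight V x)) = (⟨0, 0⟩ : Letter V) := by
  simp [prL, dirLetter, inRight]

/-- Values on generators are pulled back from `V`, so they vanish as soon as a letter from `W`
occurs. The empty word is the only other word on the line, and there the absence of a constant term
is needed. -/
theorem extDer_onLine {c : Flavour} {B : InnerProd K V} (x : W 0) {d : ZMod 2}
    {D : Module.End K (Alg K V c)} (hD : D ∈ CDer0 c B d) :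
    extDer W d D ∈ vanishLine K c (inRight V x) := by
  refine fun f w hw => vf_onLine _ _ d (fun i w hw => ?_) f w hw
  show (D (Alg.gen c (crd K V i))).1 (w.map prL) = 0
  rcases w with _ | ⟨u, w⟩
  · exact hD.2 _ (Alg.gen_fil _) [] (by simp)
  · rw [List.map_cons, hw.head, prL_dirLetter]
    exact OpLie.slot_zero (D (Alg.gen c (crd K V i))).2.1 [] _ 0

/-- The stabilization map on derivations without constant term. -/
noncomputable def lineStab (c : Flavour) (B : InnerProd K V) (C : InnerProd K W) (x : W 0) :
    (cyc0 c B).Hom (lineLie c (B.dsum C) (inRight V x)) where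
  map p :=
    { toFun := fun D => ⟨extDer W p D.1, extDer_mem D.2.1, extDer_onLine x D.2⟩
      map_add' := fun D E => Subtype.ext (extDer_add D.2.1.1 E.2.1.1)
      map_smul' := fun a D => Subtype.ext (extDer_smul a D.2.1.1) }
  map_bracket _ _ D E := Subtype.ext (extDer_bracket D.2.1.1 E.2.1.1)
  cont n := ⟨n, fun D hD => vf_fil _ _ _ n (fun _ w hw => hD _ _ (by simpa using hw))⟩

theorem constDer_pull (c : Flavour) (x : W 0) (f : Alg K V c) :
    constDer K c (inRight V x) (Alg.pull W f) = 0 := by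
  have h : ∀ l r : List (Letter (DSum V W)),
      (Alg.pull W f).1 (l ++ dirLetter (inRight V x) :: r) = 0 := by
    intro l r
    show f.1 ((l ++ dirLetter (inRight V x) :: r).map prL) = 0
    rw [List.map_append, List.map_cons, prL_dirLetter]
    exact OpLie.slot_zero f.2.1 _ _ 0
  apply Subtype.ext; funext w
  cases c
  · rw [constDer_ass]; exact insertAll_eq_zero _ w _ h
  · rw [constDer_com]; exact h [] w

/-- Checked on generators: the extended derivation takes values pulled back from `V`, which `∂/∂e`
kills, while `∂/∂e` takes scalar values, which the extended derivation kills. -/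
theorem lineAd_lineStab (c : Flavour) (B : InnerProd K V) (C : InnerProd K W) (x : W 0)
    (D : (cyc0 c B).El) :
    ((lineAd c (B.dsum C) (inRight V x)).el ((lineStab c B C x).el D)).2.1 = 0 := by
  have hy := constDer_mem_der (K := K) c (inRight V x)
  have hD := extDer_leibniz (W := W) D.2.2.1.1
  have h : constDer K c (inRight V x) * extDer W D.1 D.2.1
      - sgn K (1 * D.1) • (extDer W D.1 D.2.1 * constDer K c (inRight V x)) = 0 := by
    refine leibniz_unique (der_bracket hy hD).2.1 fun φ => ?_
    simp only [LinearMap.sub_apply, LinearMap.smul_apply, Module.End.mul_apply, constDer_gen,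
      extDer_gen, constDer_pull, map_smul, leibniz_one hD.2.1, smul_zero, sub_zero]
  exact (congrArg (sgn K 1 • ·) h).trans (smul_zero _)

theorem stab_cocycle_exact (c : Flavour) (B : InnerProd K V) (C : InnerProd K W)
    (hW : Nontrivial (W 0)) (n : ℕ) (ω : (cyc c (B.dsum C)).cochains (n + 1))
    (hω : (cyc c (B.dsum C)).diff (n + 1) ω = 0) :
    ∃ κ : (cyc0 c B).cochains n, (cyc0 c B).diff n κ
      = (incl c B).pullback (n + 1) ((stab c B C).pullback (n + 1) ω) := by
  obtain ⟨x, hx⟩ := exists_ne (0 : W 0)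
  obtain ⟨f, hf⟩ : ∃ f : Module.Dual K (W 0), f x ≠ 0 := by
    by_contra h
    push Not at h
    exact hx ((Module.forall_dual_apply_eq_zero_iff K x).1 h)
  -- A form on the even part that factors through `W`, normalized so that its value at the chosen
  -- vector is `1`.
  let ξ : ∀ p, DSum V W p →ₗ[K] K :=
    Function.update 0 0 ((f x)⁻¹ • f ∘ₗ LinearMap.snd K (V 0) (W 0))
  have h0 : ξ 0 (inRight V x 0) = 1 := by simp [ξ, inRight, hf]
  have h1 : ξ 1 = 0 := by simp [ξ]
  obtain ⟨κ, hκ, h⟩ := OpLie.exact_of_contraction (lineIncl c (B.dsum C) (inRight V x))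
    (lineStab c B C x) (constEl c (B.dsum C) (inRight V x)) (show (1 + 1 : ZMod 2) = 0 by decide)
    (constEl_quad c _ _) (lineAd c _ _) (lineHomotopy h0 h1 c (B.dsum C))
    (lineIncl_ad c _ _) (lineAd_isDer c _ _) (lineHomotopy_spec h0 h1 c _)
    (lineAd_lineStab c B C x) n ω.2 (congrArg Subtype.val hω)
  refine ⟨⟨κ, hκ⟩, Subtype.ext (h.trans ?_)⟩
  funext w
  show ω.1 ((w.map _).map _) = ω.1 ((w.map _).map _)
  rw [List.map_map, List.map_map]
  rfl

/-- Dual to `stab_cocycle_exact`: a cycle annihilates coboundaries, so its image annihilates all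
cocycles, and a functional annihilating the kernel of a linear map over a field factors through that
map. -/
theorem stab_cycle_boundary (c : Flavour) (B : InnerProd K V) (C : InnerProd K W)
    (hW : Nontrivial (W 0)) (n : ℕ) (z : (cyc0 c B).chains (n + 1))
    (hz : (cyc0 c B).boundary n z = 0) :
    ∃ y : (cyc c (B.dsum C)).chains (n + 2), (cyc c (B.dsum C)).boundary (n + 1) y
      = (stab c B C).push (n + 1) ((incl c B).push (n + 1) z) := by
  have h : (stab c B C).push (n + 1) ((incl c B).push (n + 1) z)
      ∈ LinearMap.range ((cyc c (B.dsum C)).diff (n + 1)).dualMap := by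
    rw [LinearMap.range_dualMap_eq_dualAnnihilator_ker, Submodule.mem_dualAnnihilator]
    intro ω hω
    obtain ⟨κ, hκ⟩ := stab_cocycle_exact c B C hW n ω hω
    show z ((incl c B).pullback (n + 1) ((stab c B C).pullback (n + 1) ω)) = 0
    rw [← hκ]
    exact LinearMap.congr_fun hz κ
  exact h

end Stabilization

end CurvedStab

/-- The degree `i ≥ 1` is written `n + 1`. -/
theorem theorem4p1 {K : Type*} [Field K] [CharZero K]
    {V : ZMod 2 → Type*} [∀ p, AddCommGroup (V p)] [∀ p, Module K (V p)]
    [∀ p, Module.Finite K (V p)]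
    {W : ZMod 2 → Type*} [∀ p, AddCommGroup (W p)] [∀ p, Module K (W p)]
    [∀ p, Module.Finite K (W p)]
    (B : CurvedStab.InnerProd K V) (C : CurvedStab.InnerProd K W) (hW : Nontrivial (W 0))
    (n : ℕ) :
    (∀ z : (CurvedStab.cyc0 .com B).chains (n + 1), (CurvedStab.cyc0 .com B).boundary n z = 0 →
      ∃ y : (CurvedStab.cyc .com (B.dsum C)).chains (n + 2),
        (CurvedStab.cyc .com (B.dsum C)).boundary (n + 1) y
          = (CurvedStab.stab .com B C).push (n + 1)
              ((CurvedStab.incl .com B).push (n + 1) z)) ∧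
    (∀ z : (CurvedStab.cyc0 .ass B).chains (n + 1), (CurvedStab.cyc0 .ass B).boundary n z = 0 →
      ∃ y : (CurvedStab.cyc .ass (B.dsum C)).chains (n + 2),
        (CurvedStab.cyc .ass (B.dsum C)).boundary (n + 1) y
          = (CurvedStab.stab .ass B C).push (n + 1)
              ((CurvedStab.incl .ass B).push (n + 1) z)) :=
  ⟨CurvedStab.stab_cycle_boundary .com B C hW n, CurvedStab.stab_cycle_boundary .ass B C hW n⟩
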